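/- **Setting.** Let $d\in\{2,3\}$, let $\Omega\subseteq\mathbb R^d$ be open with $\operatorname{int}\overline\Omega=\Omega$ (for instance a bounded polygonal/polyhedral Lipschitz domain), and let $\mathcal M$ be a finite matching simplicial mesh of $\Omega$: closed nondegenerate $d$-simplices covering $\overline\Omega$ such that $K\cap K'$ is the convex hull of a (possibly empty) subset of the vertices of $K$ for all $K,K'\in\mathcal M$. Let $\mathcal F_K$ be the set of facets of $K$, $\mathcal F=\bigcup_K\mathcal F_K$, let $\mathcal F^i$ be the interfaces (facets of two distinct cells), $\mathcal F^b=\mathcal F\setminus\mathcal F^i$ the boundary faces, and $\Sigma=\bigcup_{F\in\mathcal F}F$ the skeleton. Let $p\in\mathbb N_0$ and $\mathbb P_{-1}=\{0\}$. Let $\mathbb P_k(\mathcal M)\subset L^2(\Omega)$ be the cell-wise polynomials of degree $\le k$, $\mathbb P_p(\Sigma)\subset L^2(\Sigma)$ the face-wise polynomials of degree $\le p$ vanishing on the boundary faces, and $\hat S=\mathbb P_p(\mathcal M)\times\mathbb P_p(\Sigma)$, with elements $\hat s=(s_{\mathcal M},s_\Sigma)$. Let $\Pi_{\mathcal M}:L^2(\Omega)\to\mathbb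 P_p(\mathcal M)$, $\Pi_\Sigma:L^2(\Sigma)\to\mathbb P_p(\Sigma)$ and $\Pi_F:L^2(F)\to\mathbb P_p(F)$ be the $L^2$-orthogonal projections. The reconstruction $\mathcal R:\hat S\to\mathbb P_{p+1}(\mathcal M)$ is defined, for all $K\in\mathcal M$ and $q\in\mathbb P_{p+1}(K)$, by $$\int_K\nabla\mathcal R\hat s\cdot\nabla q=-\int_K s_{\mathcal M}\Delta q+\int_{\partial K}s_\Sigma\nabla q\cdot n_K,\qquad \int_K\mathcal R\hat s=\int_K s_{\mathcal M}.$$ Put $\mathcal S\hat s=s_{\mathcal M}+(\mathrm{Id}-\Pi_{\mathcal M})\mathcal R\hat s$ and, for fixed weights $\omega_F>0$ ($F\in\mathcal F$; e.g. $\omega_F=1$ or $\omega_F=(\operatorname{diam}F)^{-1}$), $$\mathrm{Stab}(\hat s,\hat\sigma)=\sum_{K\in\mathcal M}\sum_{F\in\mathcal F_K}\omega_F\int_F\Pi_F\big(s_\Sigma-(\mathcal S\hat s)_{|K}\big)\,\Pi_F\big(\sigma_\Sigma-(\mathcal S\hat\sigma)_{|K}\big),$$ $$b_H(\hat s,\hat\sigma)=\int_\Omega\nabla_{\mathcal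 M}\mathcal R\hat s\cdot\nabla_{\mathcal M}\mathcal R\hat\sigma+\mathrm{Stab}(\hat s,\hat\sigma),$$ where $\nabla_{\mathcal M}$ is the cell-wise gradient. Identify $v\in H^1_0(\Omega)$ with $\hat v=(v,v_{|\Sigma})$ ($v_{|\Sigma}$ the trace) and let $\hat V=\{\hat v: v\in H^1_0(\Omega)\}$. On $\hat V+\hat S\subset L^2(\Omega)\times L^2(\Sigma)$ consider $$\tilde a_H(\hat v+\hat s,\hat w+\hat\sigma)=\int_\Omega\nabla_{\mathcal M}(v+\mathcal R\hat s)\cdot\nabla_{\mathcal M}(w+\mathcal R\hat\sigma)+\mathrm{Stab}(\hat s,\hat\sigma),\qquad \|x\|_{\tilde a_H}=\sqrt{\tilde a_H(x,x)},$$ and set $\hat Z=\{\hat z\in\hat V:\inf_{\hat s\in\hat S}\|\hat z-\hat s\|_{\tilde a_H}=0\}$ and $\hat{\mathcal I}v=(\Pi_{\mathcal M}v,\Pi_\Sigma v_{|\Sigma})$ for $v\in H^1_0(\Omega)$. Let $E_H:\hat S\to H^1_0(\Omega)$ be linear and $\hat E_H\hat\sigma=(E_H\hat\sigma,(E_H\hat\sigma)_{|\Sigma})$.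 We say that $E_H$ *preserves the moments of* $\hat\sigma\in\hat S$ if $$\int_K q\,E_H\hat\sigma=\int_K q\,\sigma_{\mathcal M}\quad\text{and}\quad\int_F r\,E_H\hat\sigma=\int_F r\,\sigma_\Sigma$$ for all $K\in\mathcal M$, $q\in\mathbb P_{p-1}(K)$ and all $F\in\mathcal F^i$, $r\in\mathbb P_p(F)$. **Lemma (consistency via moment-preserving smoothers).** The form $\tilde a_H$ is well defined on $\hat V+\hat S$ (independent of the decompositions), and: 1. If $E_H$ preserves the moments of $\hat\sigma\in\hat S$, then $\tilde a_H(\hat s,\hat\sigma-\hat E_H\hat\sigma)=\mathrm{Stab}(\hat s,\hat\sigma)$ for all $\hat s\in\hat S$. 2. Suppose that $E_H$ preserves the moments of every $\hat\sigma\in\hat S$. Then for each $f\in H^{-1}(\Omega)$ the method "find $\hat U\in\hat S$ with $b_H(\hat U,\hat\sigma)=\langle f,E_H\hat\sigma\rangle$ for all $\hat\sigma\in\hat S$" has exactly one solution $\hat U$; and if $u\in H^1_0(\Omega)$ solves $\int_\Omega\nabla u\cdot\nabla w=\langle f,w\rangle$ for all $w\in H^1_0(\Omega)$ and $\hat u=(u,u_{|\Sigma})\in\hat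 Z$, then all the consistency conditions hold: $$\|\hat u-\hat U\|_{\tilde a_H}=0,\qquad \hat U=\hat{\mathcal I}u,\qquad \tilde a_H(\hat u,\hat\sigma-\hat E_H\hat\sigma)=0\quad\text{for all }\hat\sigma\in\hat S.$$ -/

import Mathlib

open MeasureTheory Set InnerProductSpace
open scoped ENNReal ContDiff Gradient Laplacian

noncomputable section

namespace HHO

/-- The Euclidean space `ℝ^d`. -/
abbrev E (d : ℕ) := EuclideanSpace ℝ (Fin d)

/-- Geometric realisation of a simplex given by its set of vertices. -/
def hull {d : ℕ} (A : Finset (E d)) : Set (E d) := convexHull ℝ (A : Set (E d))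

/-- A matching simplicial mesh of `Ω`: finitely many nondegenerate closed `d`-simplices (given by
their vertices) which cover the closure of `Ω`, such that the intersection of a cell `K` with any
other cell is the convex hull of a (possibly empty) subset of the vertices of `K`. -/
structure SimplicialMesh {d : ℕ} (Ω : Set (E d)) where
  cells : Finset (Finset (E d))
  card_eq : ∀ K ∈ cells, K.card = d + 1
  affineIndependent : ∀ K ∈ cells, AffineIndependent ℝ (fun x : K => (x : E d))
  matching : ∀ K ∈ cells, ∀ K' ∈ cells, ∃ A : Finset (E d), A ⊆ K ∧ hull K ∩ hull K' = hull A
  cover : (⋃ K ∈ cells, hull K) = closure Ω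

/-- The `(d-1)`-dimensional faces of a `d`-simplex `K`. -/
def facets {d : ℕ} (K : Finset (E d)) : Finset (Finset (E d)) := K.powersetCard d

/-- Outer unit normal of the simplex `K` on its facet `F`: the normalised component, orthogonal to
`F`, of the vector from the barycentre of `K` to the barycentre of `F`. -/
def outerNormal {d : ℕ} (K F : Finset (E d)) : E d :=
  NormedSpace.normalize
    ((vectorSpan ℝ (F : Set (E d)))ᗮ.starProjection (F.centroid ℝ id - K.centroid ℝ id))

/-- Evaluation of a polynomial in `d` variables as a function on `ℝ^d`. -/
def evalPoly (d : ℕ) : MvPolynomial (Fin d) ℝ →ₗ[ℝ] (E d → ℝ) :=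
  LinearMap.pi fun x => (MvPolynomial.aeval fun i => x i).toLinearMap

/-- Polynomial functions of total degree `≤ k` on `ℝ^d`; this is `{0}` for `k = -1`. -/
def polyFun (d : ℕ) (k : ℤ) : Submodule ℝ (E d → ℝ) :=
  (MvPolynomial.restrictSupport ℝ {m : Fin d →₀ ℕ | (m.degree : ℤ) ≤ k}).map (evalPoly d)

/-! ### The Sobolev space `H^1_0` -/

/-- Smooth functions with compact support in `Ω`. -/
def IsTest {d : ℕ} (Ω : Set (E d)) (φ : E d → ℝ) : Prop :=
  ContDiff ℝ ∞ φ ∧ HasCompactSupport φ ∧ tsupport φ ⊆ Ω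

/-- Lebesgue measure on `Ω`. -/
abbrev vol {d : ℕ} (Ω : Set (E d)) : Measure (E d) := volume.restrict Ω

/-- `L²(Ω)`. -/
abbrev L2 {d : ℕ} (Ω : Set (E d)) := Lp ℝ 2 (vol Ω)

/-- `L²(Ω; ℝ^d)`. -/
abbrev L2vec {d : ℕ} (Ω : Set (E d)) := Lp (E d) 2 (vol Ω)

theorem IsTest.zero {d : ℕ} (Ω : Set (E d)) : IsTest Ω (0 : E d → ℝ) := by
  refine ⟨contDiff_const, HasCompactSupport.zero, ?_⟩
  simp [tsupport]

theorem IsTest.add {d : ℕ} {Ω : Set (E d)} {φ ψ : E d → ℝ} (hφ : IsTest Ω φ) (hψ : IsTest Ω ψ) :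
    IsTest Ω (φ + ψ) :=
  ⟨hφ.1.add hψ.1, hφ.2.1.add hψ.2.1,
    (tsupport_add φ ψ).trans (union_subset hφ.2.2 hψ.2.2)⟩

theorem IsTest.smul {d : ℕ} {Ω : Set (E d)} {φ : E d → ℝ} (c : ℝ) (hφ : IsTest Ω φ) :
    IsTest Ω (c • φ) := by
  refine ⟨hφ.1.const_smul c, ?_, ?_⟩
  · exact hφ.2.1.mono' ((Function.support_const_smul_subset c φ).trans subset_closure)
  · exact (closure_mono (Function.support_const_smul_subset c φ)).trans hφ.2.2

/-- The pairs `(φ, ∇φ)` with `φ ∈ C_c^∞(Ω)`, inside `L²(Ω) × L²(Ω; ℝ^d)`. -/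
def testPairs {d : ℕ} (Ω : Set (E d)) : Submodule ℝ (L2 Ω × L2vec Ω) where
  carrier := {v | ∃ φ : E d → ℝ, IsTest Ω φ ∧ v.1 =ᵐ[vol Ω] φ ∧ v.2 =ᵐ[vol Ω] ∇ φ}
  zero_mem' := by
    refine ⟨0, IsTest.zero Ω, Lp.coeFn_zero ℝ 2 (vol Ω), ?_⟩
    have h : ∇ (0 : E d → ℝ) = 0 := by
      funext x
      exact gradient_const x (0 : ℝ)
    rw [h]
    exact Lp.coeFn_zero (E d) 2 (vol Ω)
  add_mem' := by
    rintro v w ⟨φ, hφ, h1, h2⟩ ⟨ψ, hψ, h3, h4⟩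
    refine ⟨φ + ψ, hφ.add hψ, (Lp.coeFn_add v.1 w.1).trans (h1.add h3), ?_⟩
    have h : ∇ (φ + ψ) = ∇ φ + ∇ ψ := by
      funext x
      simp only [gradient, Pi.add_apply]
      rw [fderiv_add (hφ.1.differentiable (by simp) x) (hψ.1.differentiable (by simp) x), map_add]
    rw [h]
    exact (Lp.coeFn_add v.2 w.2).trans (h2.add h4)
  smul_mem' := by
    rintro c v ⟨φ, hφ, h1, h2⟩
    refine ⟨c • φ, hφ.smul c, (Lp.coeFn_smul c v.1).trans (h1.const_smul c), ?_⟩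
    have h : ∇ (c • φ) = c • ∇ φ := by
      funext x
      simp only [gradient, Pi.smul_apply]
      rw [fderiv_const_smul (hφ.1.differentiable (by simp) x), map_smul]
    rw [h]
    exact (Lp.coeFn_smul c v.2).trans (h2.const_smul c)

/-- `H^1_0(Ω)`: the closure of `C_c^∞(Ω)` in the `H^1`-norm. An element is stored as the pair
`(v, ∇v)` of the function and its weak gradient. -/
def H10 {d : ℕ} (Ω : Set (E d)) : Submodule ℝ (L2 Ω × L2vec Ω) :=
  (testPairs Ω).topologicalClosure

/-- The function underlying an element of `H^1_0(Ω)`. -/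
def fn {d : ℕ} {Ω : Set (E d)} (v : H10 Ω) : L2 Ω := v.1.1

/-- The weak gradient of an element of `H^1_0(Ω)`. -/
def grad {d : ℕ} {Ω : Set (E d)} (v : H10 Ω) : L2vec Ω := v.1.2

/-- The bilinear form `∫_Ω ∇v · ∇w` of the Poisson problem on `H^1_0(Ω)`. -/
def aForm {d : ℕ} {Ω : Set (E d)} (v w : H10 Ω) : ℝ :=
  ∫ x in Ω, inner ℝ (grad v x) (grad w x)

/-- `∫_K g` for a cell `K` of a mesh of `Ω`. -/
def cellInt {d : ℕ} (Ω : Set (E d)) (K : Finset (E d)) (g : E d → ℝ) : ℝ :=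
  ∫ x in hull K, g x ∂(vol Ω)

/-- The polynomial function which coincides with `f` on the cell `K`, for a piecewise polynomial
`f`. -/
def cellPoly {d : ℕ} {Ω : Set (E d)} (f : L2 Ω) (K : Finset (E d)) : E d → ℝ :=
  Classical.epsilon fun q => (∃ k : ℤ, q ∈ polyFun d k) ∧
    f =ᵐ[(vol Ω).restrict (hull K)] q

namespace SimplicialMesh

variable {d : ℕ} {Ω : Set (E d)} (M : SimplicialMesh Ω)

/-! ### Faces, skeleton, broken polynomials -/

/-- All faces of the mesh. -/
def faces : Set (Finset (E d)) := {F | ∃ K ∈ M.cells, F ∈ facets K}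

/-- Interfaces: the common faces of two distinct cells. -/
def interfaces : Set (Finset (E d)) :=
  {F | ∃ K₁ ∈ M.cells, ∃ K₂ ∈ M.cells, K₁ ≠ K₂ ∧ F ∈ facets K₁ ∧ F ∈ facets K₂}

/-- Boundary faces: the faces of one cell only. -/
def boundaryFaces : Set (Finset (E d)) := M.faces \ M.interfaces

/-- The skeleton `Σ`. -/
def skeleton : Set (E d) := ⋃ F ∈ M.faces, hull F

/-- Surface measure on the skeleton. -/
abbrev surf : Measure (E d) := (μHE[d - 1] : Measure (E d)).restrict M.skeleton

/-- `L²(Σ)`. -/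
abbrev L2skel := Lp ℝ 2 M.surf

/-- The space `L²(Ω) × L²(Σ)` in which pairs (cell component, face component) live. -/
abbrev Pairs := L2 Ω × M.L2skel

/-- `∫_F g` for a face `F`. -/
def faceInt (F : Finset (E d)) (g : E d → ℝ) : ℝ := ∫ x in hull F, g x ∂M.surf

/-- Piecewise polynomials of degree `≤ k` on the mesh. -/
def brokenPoly (k : ℤ) : Submodule ℝ (L2 Ω) where
  carrier := {f | ∀ K ∈ M.cells, ∃ q ∈ polyFun d k, f =ᵐ[(vol Ω).restrict (hull K)] q}
  zero_mem' := fun K _ =>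
    ⟨0, Submodule.zero_mem _, ae_restrict_of_ae (Lp.coeFn_zero ℝ 2 (vol Ω))⟩
  add_mem' := by
    intro f g hf hg K hK
    obtain ⟨q, hq, h1⟩ := hf K hK
    obtain ⟨r, hr, h2⟩ := hg K hK
    exact ⟨q + r, Submodule.add_mem _ hq hr,
      Filter.EventuallyEq.trans (ae_restrict_of_ae (Lp.coeFn_add f g)) (h1.add h2)⟩
  smul_mem' := by
    intro c f hf K hK
    obtain ⟨q, hq, h1⟩ := hf K hK
    exact ⟨c • q, Submodule.smul_mem _ c hq,
      Filter.EventuallyEq.trans (ae_restrict_of_ae (Lp.coeFn_smul c f)) (h1.const_smul c)⟩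

/-- Face-wise polynomials of degree `≤ k` on the skeleton that vanish on the boundary faces. -/
def skelPoly (k : ℤ) : Submodule ℝ M.L2skel where
  carrier := {f | (∀ F ∈ M.faces, ∃ q ∈ polyFun d k, f =ᵐ[M.surf.restrict (hull F)] q) ∧
    ∀ F ∈ M.boundaryFaces, f =ᵐ[M.surf.restrict (hull F)] (0 : E d → ℝ)}
  zero_mem' := ⟨fun F _ =>
    ⟨0, Submodule.zero_mem _, ae_restrict_of_ae (Lp.coeFn_zero ℝ 2 M.surf)⟩,
    fun F _ => ae_restrict_of_ae (Lp.coeFn_zero ℝ 2 M.surf)⟩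
  add_mem' := by
    rintro f g ⟨hf, hf'⟩ ⟨hg, hg'⟩
    refine ⟨fun F hF => ?_, fun F hF => ?_⟩
    · obtain ⟨q, hq, h1⟩ := hf F hF
      obtain ⟨r, hr, h2⟩ := hg F hF
      exact ⟨q + r, Submodule.add_mem _ hq hr,
        Filter.EventuallyEq.trans (ae_restrict_of_ae (Lp.coeFn_add f g)) (h1.add h2)⟩
    · have h := Filter.EventuallyEq.trans (ae_restrict_of_ae (Lp.coeFn_add f g))
        ((hf' F hF).add (hg' F hF))
      simpa using h
  smul_mem' := by
    rintro c f ⟨hf, hf'⟩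
    refine ⟨fun F hF => ?_, fun F hF => ?_⟩
    · obtain ⟨q, hq, h1⟩ := hf F hF
      exact ⟨c • q, Submodule.smul_mem _ c hq,
        Filter.EventuallyEq.trans (ae_restrict_of_ae (Lp.coeFn_smul c f)) (h1.const_smul c)⟩
    · have h := Filter.EventuallyEq.trans (ae_restrict_of_ae (Lp.coeFn_smul c f))
        ((hf' F hF).const_smul c)
      simpa using h

/-- The HHO space of degree `p`. -/
def space (p : ℕ) : Submodule ℝ M.Pairs := (M.brokenPoly p).prod (M.skelPoly p)

/-! ### Projections, reconstruction, stabilization -/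

/-- The `L²`-orthogonal projection `Π_M : L²(Ω) → P_p(M)`. -/
def projCells (p : ℕ) (f : L2 Ω) : L2 Ω :=
  Classical.epsilon fun g => g ∈ M.brokenPoly p ∧ ∀ K ∈ M.cells, ∀ q ∈ polyFun d p,
    cellInt Ω K (fun x => q x * g x) = cellInt Ω K (fun x => q x * f x)

/-- The `L²`-orthogonal projection `Π_Σ : L²(Σ) → P_p(Σ)`. -/
def projSkel (p : ℕ) (f : M.L2skel) : M.L2skel :=
  Classical.epsilon fun g => g ∈ M.skelPoly p ∧ ∀ F ∈ M.interfaces, ∀ r ∈ polyFun d p,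
    M.faceInt F (fun x => r x * g x) = M.faceInt F (fun x => r x * f x)

/-- The `L²(F)`-orthogonal projection onto polynomials of degree `≤ p` on a single face `F`
(the values of the result matter on `F` only). -/
def projFace (p : ℕ) (F : Finset (E d)) (f : E d → ℝ) : E d → ℝ :=
  Classical.epsilon fun g => g ∈ polyFun d p ∧ ∀ r ∈ polyFun d p,
    M.faceInt F (fun x => r x * g x) = M.faceInt F (fun x => r x * f x)

/-- The defining conditions of the reconstruction `R ŝ`. -/
def IsRecon (p : ℕ) (s : M.Pairs) (f : L2 Ω) : Prop :=
  f ∈ M.brokenPoly (p + 1) ∧ ∀ K ∈ M.cells,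
    (∀ q ∈ polyFun d (p + 1),
      cellInt Ω K (fun x => inner ℝ (∇ (cellPoly f K) x) (∇ q x)) =
        -cellInt Ω K (fun x => s.1 x * (Δ q) x) +
          ∑ F ∈ facets K, M.faceInt F (fun x => s.2 x * inner ℝ (∇ q x) (outerNormal K F))) ∧
    cellInt Ω K (fun x => f x) = cellInt Ω K (fun x => s.1 x)

/-- The higher-order reconstruction `R : HHO space → P_{p+1}(M)`. -/
def recon (p : ℕ) (s : M.space p) : L2 Ω := Classical.epsilon (M.IsRecon p s.1)

/-- The stabilization operator `S ŝ = s_M + (Id - Π_M) R ŝ`. -/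
def stabOp (p : ℕ) (s : M.space p) : L2 Ω :=
  s.1.1 + (M.recon p s - M.projCells p (M.recon p s))

/-- The stabilization form, with a weight `wt F` on the face `F`. -/
def stab (p : ℕ) (wt : Finset (E d) → ℝ) (s σ : M.space p) : ℝ :=
  ∑ K ∈ M.cells, ∑ F ∈ facets K, wt F * M.faceInt F (fun x =>
    M.projFace p F (fun y => s.1.2 y - cellPoly (M.stabOp p s) K y) x *
    M.projFace p F (fun y => σ.1.2 y - cellPoly (M.stabOp p σ) K y) x)

/-- The HHO bilinear form. -/
def bForm (p : ℕ) (wt : Finset (E d) → ℝ) (s σ : M.space p) : ℝ :=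
  ∑ K ∈ M.cells, cellInt Ω K (fun x =>
    inner ℝ (∇ (cellPoly (M.recon p s) K) x) (∇ (cellPoly (M.recon p σ) K) x)) +
  M.stab p wt s σ

/-! ### Traces, the extended form and the method -/

/-- The trace of `v ∈ H^1_0(Ω)` on the skeleton: the `L²(Σ)`-limit of `φ_n|_Σ` for test functions
`φ_n` converging to `v` in the `H^1`-norm. -/
def trace (v : H10 Ω) : M.L2skel :=
  Classical.epsilon fun t => ((v : L2 Ω × L2vec Ω), t) ∈
    closure {z : (L2 Ω × L2vec Ω) × M.L2skel | ∃ φ : E d → ℝ, IsTest Ω φ ∧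
      z.1.1 =ᵐ[vol Ω] φ ∧ z.1.2 =ᵐ[vol Ω] ∇ φ ∧ z.2 =ᵐ[M.surf] φ}

/-- The pair `(v, v|_Σ)` for `v ∈ H^1_0(Ω)`. -/
def hat (v : H10 Ω) : M.Pairs := (fn v, M.trace v)

/-- The interpolant `Î v = (Π_M v, Π_Σ v)`, as an element of `L²(Ω) × L²(Σ)`. -/
def interp (p : ℕ) (v : H10 Ω) : M.Pairs := (M.projCells p (fn v), M.projSkel p (M.trace v))

/-- The expression
`∫_Ω ∇_M(v + R ŝ) · ∇_M(w + R σ̂) + Stab(ŝ, σ̂)`. -/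
def pairForm (p : ℕ) (wt : Finset (E d) → ℝ) (v : H10 Ω) (s : M.space p) (w : H10 Ω)
    (σ : M.space p) : ℝ :=
  ∑ K ∈ M.cells, cellInt Ω K (fun x =>
    inner ℝ (grad v x + ∇ (cellPoly (M.recon p s) K) x)
      (grad w x + ∇ (cellPoly (M.recon p σ) K) x)) +
  M.stab p wt s σ

/-- A decomposition `x = v̂ + ŝ` with `v ∈ H^1_0(Ω)` and `ŝ` in the HHO space. -/
def split (p : ℕ) (x : M.Pairs) : H10 Ω × M.space p :=
  Classical.epsilon fun z => x = M.hat z.1 + z.2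

/-- The extended form `ã` on the sum of (the pairs from) `H^1_0(Ω)` and the HHO space, evaluated
through any decomposition of its arguments. -/
def aExt (p : ℕ) (wt : Finset (E d) → ℝ) (x y : M.Pairs) : ℝ :=
  M.pairForm p wt (M.split p x).1 (M.split p x).2 (M.split p y).1 (M.split p y).2

/-- The extended energy semi-norm. -/
def extNorm (p : ℕ) (wt : Finset (E d) → ℝ) (x : M.Pairs) : ℝ := √(M.aExt p wt x x)

/-- The set `Ẑ` of pairs `ẑ = (z, z|_Σ)`, `z ∈ H^1_0(Ω)`, at distance zero from the HHO space. -/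
def zeroDist (p : ℕ) (wt : Finset (E d) → ℝ) : Set M.Pairs :=
  {x | (∃ z : H10 Ω, x = M.hat z) ∧ ⨅ s : M.space p, M.extNorm p wt (x - s) = 0}

/-- The operator `Es` preserves the moments of `σ̂` of degree `≤ p - 1` on the cells and of degree
`≤ p` on the interfaces. -/
def PreservesMoments (p : ℕ) (Es : M.space p →ₗ[ℝ] H10 Ω) (σ : M.space p) : Prop :=
  (∀ K ∈ M.cells, ∀ q ∈ polyFun d ((p : ℤ) - 1),
    cellInt Ω K (fun x => q x * fn (Es σ) x) = cellInt Ω K (fun x => q x * σ.1.1 x)) ∧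
  (∀ F ∈ M.interfaces, ∀ r ∈ polyFun d p,
    M.faceInt F (fun x => r x * M.trace (Es σ) x) = M.faceInt F (fun x => r x * σ.1.2 x))

/-- `U` solves the HHO method with smoother `Es` and load `f ∈ H^{-1}(Ω)`. -/
def SolvesMethod (p : ℕ) (wt : Finset (E d) → ℝ) (Es : M.space p →ₗ[ℝ] H10 Ω)
    (f : StrongDual ℝ (H10 Ω)) (U : M.space p) : Prop :=
  ∀ σ : M.space p, M.bForm p wt U σ = f (Es σ)

end SimplicialMesh

end HHO

end

/-! Everything rests on one computation. For a polynomial q of degree at most p + 1 on a cell K,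
Green's formula writes ∫_K ∇v · ∇q as −∫_K v Δq + ∫_∂K v ∇q · n_K. Here Δq has degree at most p − 1,
and ∇q · n_K has degree at most p on each facet because the normal is constant there. The value
therefore depends only on the moments of v that a moment-preserving smoother keeps, and those
moments turn it into the right-hand side that defines the reconstruction
(`cellInt_grad_eq_reconRhs`). Hence the gradients of Rσ̂ and of E_H σ̂ have the same products with
∇Rŝ. The gradient part of ã(ŝ, σ̂ − Ê_H σ̂) cancels, and Stab(ŝ, σ̂) is what remains
(`aExt_sub_smoother`).

Well-definedness follows from the same computation. Two decompositions differ by an element of both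
spaces, that is, by an H^1_0-function that is piecewise polynomial. Such a function is reproduced by
R and has no stabilization defect (`recPoly_of_moments`), so the difference contributes nothing
(`pairForm_congr_left`).

Unique solvability is definiteness of b_H in finite dimension. A kernel element is a constant c_K on
each cell, with the same constant on the facets of that cell. The pair with values c_K² is again a
discrete element whose face values are consistent. Smoothing it gives v in H^1_0 with facet means
c_K². Testing with the position field x gives ∫_K (∇v · x + d v) = d c_K² |K|, and the sum over all
cells vanishes by integration by parts on Ω. So every c_K is zero (`eq_zero_of_bForm_eq_zero`).

For û in Ẑ the infimum is attained (`exists_isCloseTo`): some ŝ has ∇u = ∇Rŝ on every cell and no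
defect. The key computation shows that ŝ solves the method (`IsCloseTo.solvesMethod`), so Û = ŝ. By
a Poincaré inequality u − Rŝ is constant on each cell, hence u is piecewise polynomial of degree p +
1 and its interpolant is also at distance zero (`IsCloseTo.interp`). Uniqueness once more gives Û =
Îu.

The analysis underneath is elementary. The divergence theorem and the trace inequality on a simplex
come from integrating a radial field over a cone (`radial_divergence`). Since H^1_0 and its traces
are closures of test functions, each fact about them is checked on smooth functions and carried over
by L²-continuity (`traceGraph_induction`). -/

noncomputable section

namespace HHO

/-! ### Integration over cones in orthogonal coordinates -/

section Cone

variable {V : Type*} [NormedAddCommGroup V] [InnerProductSpace ℝ V] [FiniteDimensional ℝ V]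
  [MeasurableSpace V] [BorelSpace V]

/-- Orthogonal coordinates with respect to a hyperplane `H` with unit normal `n`. -/
def hyperplaneEquiv (H : Submodule ℝ V) (n : V) (hn : ‖n‖ = 1) (hH : Hᗮ = ℝ ∙ n) (a : V) :
    H × ℝ ≃ᵐ V :=
  (MeasurableEquiv.prodCongr (MeasurableEquiv.refl H)
    ((LinearIsometryEquiv.toSpanUnitSingleton n hn).trans
      (LinearIsometryEquiv.ofEq _ _ hH.symm)).toHomeomorph.toMeasurableEquiv).trans
    (H.measurableEquivProd a).symm

theorem hyperplaneEquiv_apply (H : Submodule ℝ V) (n : V) (hn : ‖n‖ = 1) (hH : Hᗮ = ℝ ∙ n) (a : V)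
    (q : H × ℝ) : hyperplaneEquiv H n hn hH a q = a + ((q.1 : V) + q.2 • n) := by
  change (H.measurableEquivProd a).symm (q.1, (LinearIsometryEquiv.ofEq _ _ hH.symm)
    (LinearIsometryEquiv.toSpanUnitSingleton n hn q.2)) = _
  simp [add_comm]

theorem measurePreserving_hyperplaneEquiv (H : Submodule ℝ V) (n : V) (hn : ‖n‖ = 1)
    (hH : Hᗮ = ℝ ∙ n) (a : V) : MeasurePreserving (hyperplaneEquiv H n hn hH a) := by
  have h1 := (H.measurePreserving_measurableEquivProd a).symm
  rw [InnerProductSpace.euclideanHausdorffMeasure_eq_volume] at h1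
  refine MeasurePreserving.trans ?_ h1
  exact (MeasurePreserving.id volume).prod (((LinearIsometryEquiv.toSpanUnitSingleton n hn).trans
      (LinearIsometryEquiv.ofEq _ _ hH.symm)).measurePreserving)

theorem integral_comp_hyperplane (H : Submodule ℝ V) (n : V) (hn : ‖n‖ = 1) (hH : Hᗮ = ℝ ∙ n)
    (a : V) {f : V → ℝ} (hf : Integrable f) :
    ∫ x, f x = ∫ s : ℝ, ∫ z : H, f (a + ((z : V) + s • n)) := by
  have h := measurePreserving_hyperplaneEquiv H n hn hH a
  rw [← h.integral_comp' (g := f), Measure.volume_eq_prod, integral_prod_symm]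
  · simp only [hyperplaneEquiv_apply]
  · rw [← Measure.volume_eq_prod]
    exact (h.integrable_comp_emb (MeasurableEquiv.measurableEmbedding _)).2 hf

/-- Integration over a cone with apex `a` over a base `B` in the hyperplane at height `h`. -/
theorem setIntegral_cone (H : Submodule ℝ V) (n : V) (hn : ‖n‖ = 1) (hH : Hᗮ = ℝ ∙ n)
    (a : V) {h : ℝ} (hh : 0 < h) {B : Set H} (hB : MeasurableSet B) {K : Set V}
    (hK : IsCompact K)
    (hcone : ∀ (r : ℝ) (z : H), 0 < r → (a + r • ((z : V) + h • n) ∈ K ↔ r ≤ 1 ∧ z ∈ B))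
    (hneg : ∀ (r : ℝ) (z : H), r < 0 → a + r • ((z : V) + h • n) ∉ K)
    {f : V → ℝ} (hf : Continuous f) :
    ∫ x in K, f x = h * ∫ r in (0 : ℝ)..1, r ^ (Module.finrank ℝ H) *
      ∫ z in B, f (a + r • ((z : V) + h • n)) := by
  have hKm := hK.measurableSet
  rw [← integral_indicator hKm, integral_comp_hyperplane H n hn hH a
    ((integrable_indicator_iff hKm).2 (hf.continuousOn.integrableOn_compact hK))]
  -- Heights are written as r h. The slice at height r h is the base dilated by r, so substituting r
  -- z for z in the hyperplane produces the factor r to the dimension of `H`. The apex slice r = 0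
  -- is a null set of heights and may be ignored.
  have h1 : ∀ r : ℝ, r ≠ 0 → ∫ z : H, K.indicator f (a + ((z : V) + (r * h) • n)) =
      (Ioc (0 : ℝ) 1).indicator (fun r => r ^ (Module.finrank ℝ H) *
      ∫ z in B, f (a + r • ((z : V) + h • n))) r := by
    intro r hr
    have e1 : ∀ z : H, K.indicator f (a + ((z : V) + (r * h) • n)) =
        (fun z : H => K.indicator f (a + r • ((z : V) + h • n))) (r⁻¹ • z) := by
      intro z
      simp only [Submodule.coe_smul, smul_add, smul_smul, mul_inv_cancel₀ hr, one_smul]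
    simp_rw [e1]
    rw [Measure.integral_comp_smul volume (fun z : H => K.indicator f (a + r • ((z : V) + h • n)))]
    rcases lt_or_gt_of_ne hr with h0 | h0
    · rw [indicator_of_notMem (by simp [h0.le])]
      have : ∀ z : H, K.indicator f (a + r • ((z : V) + h • n)) = 0 := fun z =>
        indicator_of_notMem (hneg r z h0) _
      simp only [this, integral_zero, smul_zero]
    · by_cases hr1 : r ≤ 1
      · rw [indicator_of_mem (mem_Ioc.2 ⟨h0, hr1⟩), ← integral_indicator hB]
        have : ∀ z : H, K.indicator f (a + r • ((z : V) + h • n)) =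
            B.indicator (fun z : H => f (a + r • ((z : V) + h • n))) z := by
          intro z
          by_cases hz : z ∈ B
          · rw [indicator_of_mem hz, indicator_of_mem ((hcone r z h0).2 ⟨hr1, hz⟩)]
          · rw [indicator_of_notMem hz, indicator_of_notMem (fun h => hz ((hcone r z h0).1 h).2)]
        simp_rw [this]
        simp [abs_of_pos h0]
      · rw [indicator_of_notMem (by simp [hr1])]
        have : ∀ z : H, K.indicator f (a + r • ((z : V) + h • n)) = 0 := fun z =>
          indicator_of_notMem (fun hz => hr1 ((hcone r z h0).1 hz).1) _
        simp only [this, integral_zero, smul_zero]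
  have h2 := Measure.integral_comp_mul_right
    (fun s : ℝ => ∫ z : H, K.indicator f (a + ((z : V) + s • n))) h
  have h3 : ∫ s : ℝ, ∫ z : H, K.indicator f (a + ((z : V) + s • n)) =
      h * ∫ r : ℝ, ∫ z : H, K.indicator f (a + ((z : V) + (r * h) • n)) := by
    rw [h2, abs_of_pos (inv_pos.2 hh), smul_eq_mul, ← mul_assoc, mul_inv_cancel₀ hh.ne', one_mul]
  rw [h3, intervalIntegral.integral_of_le zero_le_one, ← integral_indicator measurableSet_Ioc]
  congr 1
  refine integral_congr_ae ?_
  have : ∀ᵐ r : ℝ, r ≠ 0 := by simp [ae_iff]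
  filter_upwards [this] with r hr using h1 r hr

/-- Integrating the divergence of the radial field `f (x - a)` over a cone with apex `a`. -/
theorem setIntegral_radial_divergence (H : Submodule ℝ V) (n : V) (hn : ‖n‖ = 1)
    (hH : Hᗮ = ℝ ∙ n) (a : V) {h : ℝ} (hh : 0 < h) {B : Set H} (hB : IsCompact B) {K : Set V}
    (hK : IsCompact K)
    (hcone : ∀ (r : ℝ) (z : H), 0 < r → (a + r • ((z : V) + h • n) ∈ K ↔ r ≤ 1 ∧ z ∈ B))
    (hneg : ∀ (r : ℝ) (z : H), r < 0 → a + r • ((z : V) + h • n) ∉ K)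
    {f : V → ℝ} (hf : ContDiff ℝ 1 f) :
    ∫ x in K, ((Module.finrank ℝ H + 1) * f x + fderiv ℝ f x (x - a)) =
      h * ∫ z in B, f (a + ((z : V) + h • n)) := by
  have hf' : Continuous (fderiv ℝ f) := hf.continuous_fderiv (by simp)
  have hc : Continuous (fun x => ((Module.finrank ℝ H + 1) * f x + fderiv ℝ f x (x - a))) := by
    have := hf.continuous
    fun_prop
  rw [setIntegral_cone H n hn hH a hh hB.measurableSet hK hcone hneg hc]
  congr 1
  set m := Module.finrank ℝ H
  have hfc := hf.continuous
  have e1 : ∀ r : ℝ, r ^ m * ∫ z in B, ((m + 1) * f (a + r • ((z : V) + h • n)) +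
      fderiv ℝ f (a + r • ((z : V) + h • n)) (a + r • ((z : V) + h • n) - a)) =
      ∫ z in B, r ^ m * ((m + 1) * f (a + r • ((z : V) + h • n)) +
      fderiv ℝ f (a + r • ((z : V) + h • n)) (a + r • ((z : V) + h • n) - a)) := fun r =>
    (integral_const_mul _ _).symm
  simp_rw [e1]
  rw [intervalIntegral.integral_of_le zero_le_one, ← integral_Icc_eq_integral_Ioc,
    integral_integral_swap]
  · refine setIntegral_congr_fun hB.measurableSet fun z _ => ?_
    rw [integral_Icc_eq_integral_Ioc, ← intervalIntegral.integral_of_le zero_le_one]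
    -- Along each ray, r^m times the divergence is the derivative of r^(m+1) f. Only the base r = 1
    -- contributes, because the power vanishes at the apex.
    have hd : ∀ r : ℝ, HasDerivAt (fun r : ℝ => r ^ (m + 1) * f (a + r • ((z : V) + h • n)))
        (r ^ m * ((m + 1) * f (a + r • ((z : V) + h • n)) +
      fderiv ℝ f (a + r • ((z : V) + h • n)) (a + r • ((z : V) + h • n) - a))) r := by
      intro r
      have g1 : HasDerivAt (fun r : ℝ => a + r • ((z : V) + h • n)) ((z : V) + h • n) r := by
        simpa using ((hasDerivAt_id r).smul_const ((z : V) + h • n)).const_add a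
      have g2 := ((hf.differentiable (by simp) (a + r • ((z : V) + h • n))).hasFDerivAt).comp_hasDerivAt r g1
      have g3 := (hasDerivAt_pow (m + 1) r).mul g2
      refine g3.congr_deriv ?_
      simp only [add_sub_cancel_left, map_smul, smul_eq_mul, Nat.add_sub_cancel, Function.comp]
      push_cast
      ring
    rw [intervalIntegral.integral_eq_sub_of_hasDerivAt (fun r _ => hd r)
      (Continuous.intervalIntegrable (by fun_prop) _ _)]
    simp
  · rw [Measure.prod_restrict]
    exact ContinuousOn.integrableOn_compact (isCompact_Icc.prod hB) (by
      unfold Function.uncurry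
      fun_prop)

end Cone
end HHO

/-! ### Simplices as cones over their facets -/

namespace HHO

variable {d : ℕ}

/-- `K` is the vertex set of a nondegenerate `d`-simplex. -/
structure IsSimplex (K : Finset (E d)) : Prop where
  card_eq : K.card = d + 1
  indep : AffineIndependent ℝ (fun x : K => (x : E d))

theorem SimplicialMesh.isSimplex {Ω : Set (E d)} (M : SimplicialMesh Ω) {K : Finset (E d)}
    (hK : K ∈ M.cells) : IsSimplex K := ⟨M.card_eq K hK, M.affineIndependent K hK⟩

theorem hull_mono {A B : Finset (E d)} (h : A ⊆ B) : hull A ⊆ hull B :=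
  convexHull_mono (Finset.coe_subset.2 h)

theorem isCompact_hull (A : Finset (E d)) : IsCompact (hull A) :=
  A.finite_toSet.isCompact_convexHull ℝ

theorem convex_hull (A : Finset (E d)) : Convex ℝ (hull A) := convex_convexHull ℝ _

theorem measurableSet_hull (A : Finset (E d)) : MeasurableSet (hull A) :=
  (isCompact_hull A).measurableSet

theorem mem_hull_of_mem {A : Finset (E d)} {x : E d} (h : x ∈ A) : x ∈ hull A :=
  subset_convexHull ℝ _ h

theorem mem_facets_iff {K F : Finset (E d)} (hK : K.card = d + 1) :
    F ∈ facets K ↔ ∃ a ∈ K, K.erase a = F := by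
  rw [facets, Finset.mem_powersetCard]
  constructor
  · rintro ⟨h1, h2⟩
    have h3 : (K \ F).card = 1 := by rw [Finset.card_sdiff_of_subset h1]; omega
    obtain ⟨a, ha⟩ := Finset.card_eq_one.1 h3
    have ha' : a ∈ K \ F := by simp [ha]
    refine ⟨a, (Finset.mem_sdiff.1 ha').1, ?_⟩
    rw [← Finset.sdiff_singleton_eq_erase, ← ha, Finset.sdiff_sdiff_eq_self h1]
  · rintro ⟨a, ha, rfl⟩
    exact ⟨Finset.erase_subset _ _, by rw [Finset.card_erase_of_mem ha]; omega⟩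

theorem sum_facets {K : Finset (E d)} (hK : K.card = d + 1) (g : Finset (E d) → ℝ) :
    ∑ F ∈ facets K, g F = ∑ a ∈ K, g (K.erase a) := by
  classical
  have : facets K = K.image K.erase := by
    ext F; simp [mem_facets_iff hK]
  rw [this, Finset.sum_image]
  exact Finset.erase_injOn K

theorem finset_centroid_eq (s : Finset (E d)) (hs : s.Nonempty) :
    s.centroid ℝ id = (s.card : ℝ)⁻¹ • ∑ x ∈ s, x := by
  rw [Finset.centroid_def, Finset.affineCombination_eq_linear_combination _ _ _
    (s.sum_centroidWeights_eq_one_of_nonempty ℝ hs)]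
  simp [Finset.centroidWeights_apply, Finset.smul_sum]

theorem _root_.AffineIndependent.notMem_affineSpan_finset_erase {K : Finset (E d)}
    (hK : AffineIndependent ℝ (fun x : K => (x : E d))) {a : E d} (ha : a ∈ K) :
    a ∉ affineSpan ℝ (K.erase a : Set (E d)) := by
  have h := hK.notMem_affineSpan_sdiff ⟨a, ha⟩ Set.univ
  convert h using 3
  ext x
  simp only [Finset.coe_erase, mem_sdiff, mem_image, mem_singleton_iff, mem_univ, true_and]
  constructor
  · rintro ⟨h1, h2⟩
    exact ⟨⟨x, h1⟩, fun h => h2 (congrArg Subtype.val h), rfl⟩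
  · rintro ⟨y, h1, rfl⟩
    exact ⟨y.2, fun h => h1 (Subtype.ext h)⟩

namespace IsSimplex

variable {K : Finset (E d)}

theorem nonempty (hK : IsSimplex K) : K.Nonempty := by
  rw [← Finset.card_pos, hK.card_eq]; omega

theorem card_erase (hK : IsSimplex K) {a : E d} (ha : a ∈ K) : (K.erase a).card = d := by
  rw [Finset.card_erase_of_mem ha, hK.card_eq]; rfl

theorem erase_nonempty (hK : IsSimplex K) (hd : 0 < d) {a : E d} (ha : a ∈ K) :
    (K.erase a).Nonempty := by
  rw [← Finset.card_pos, hK.card_erase ha]; exact hd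

theorem indep_subset (hK : IsSimplex K) {A : Finset (E d)} (hA : A ⊆ K) :
    AffineIndependent ℝ (fun x : A => (x : E d)) :=
  AffineIndependent.mono hK.indep (Finset.coe_subset.2 hA)

theorem finrank_vectorSpan_erase (hK : IsSimplex K) (hd : 0 < d) {a : E d} (ha : a ∈ K) :
    Module.finrank ℝ (vectorSpan ℝ (K.erase a : Set (E d))) + 1 = d := by
  have h := (hK.indep_subset (K.erase_subset a)).finrank_vectorSpan
    (n := d - 1) (by rw [Fintype.card_coe, hK.card_erase ha]; omega)
  rw [Subtype.range_coe_subtype] at h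
  have e : {x | x ∈ K.erase a} = ((K.erase a : Finset (E d)) : Set (E d)) := rfl
  rw [e] at h
  omega

theorem notMem_affineSpan_erase (hK : IsSimplex K) {a : E d} (ha : a ∈ K) :
    a ∉ affineSpan ℝ (K.erase a : Set (E d)) := hK.indep.notMem_affineSpan_finset_erase ha

theorem sub_mem_vectorSpan {A : Finset (E d)} {x y : E d} (hx : x ∈ hull A) (hy : y ∈ hull A) :
    x - y ∈ vectorSpan ℝ (A : Set (E d)) := by
  rw [← direction_affineSpan]
  exact AffineSubspace.vsub_mem_direction (convexHull_subset_affineSpan _ hx)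
    (convexHull_subset_affineSpan _ hy)

/-- The normal is the normalised projection of c − a onto the complement of the facet directions,
where c is the facet barycentre. That projection is nonzero because `a` lies off the hyperplane of
the facet, and the complement is a line by counting dimensions. Differences of facet points are
orthogonal to the normal, so all of them have the same height over `a`. Positivity of that height is
what makes the normal point outwards. -/
theorem exists_height (hK : IsSimplex K) (hd : 0 < d) {a : E d} (ha : a ∈ K) :
    ∃ h : ℝ, 0 < h ∧ ‖outerNormal K (K.erase a)‖ = 1 ∧
      (vectorSpan ℝ (K.erase a : Set (E d)))ᗮ = ℝ ∙ outerNormal K (K.erase a) ∧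
      ∀ y ∈ hull (K.erase a), inner ℝ (outerNormal K (K.erase a)) (y - a) = h := by
  set F := K.erase a with hF
  set H := vectorSpan ℝ (F : Set (E d)) with hH
  set c := F.centroid ℝ id with hc
  have hFne : F.Nonempty := hK.erase_nonempty hd ha
  have hFc : (F.card : ℝ) = d := by rw [hF, hK.card_erase ha]
  have hd' : (d : ℝ) ≠ 0 := by positivity
  have hcm : c ∈ hull F := by
    rw [hull, hc]
    exact Finset.centroid_mem_convexHull F hFne
  have e1 : c - K.centroid ℝ id = ((d : ℝ) + 1)⁻¹ • (c - a) := by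
    have h1 : (∑ x ∈ F, x) = (d : ℝ) • c := by
      rw [hc, finset_centroid_eq F hFne, hFc, smul_inv_smul₀ hd']
    have h2 : K.centroid ℝ id = ((d : ℝ) + 1)⁻¹ • (a + (d : ℝ) • c) := by
      rw [finset_centroid_eq K hK.nonempty, ← Finset.add_sum_erase K (fun x => x) ha, hK.card_eq]
      rw [← hF, h1]; push_cast; rfl
    rw [h2]
    have : ((d : ℝ) + 1) ≠ 0 := by positivity
    rw [eq_inv_smul_iff₀ this, smul_sub, smul_inv_smul₀ this, add_smul, one_smul]
    abel
  set w := Hᗮ.starProjection (c - a) with hw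
  have hw0 : w ≠ 0 := by
    intro h0
    have h1 : c - a ∈ H := by
      rw [hw, Submodule.starProjection_apply_eq_zero_iff, Submodule.orthogonal_orthogonal] at h0
      exact h0
    apply hK.notMem_affineSpan_erase ha
    have h2 : (a - c) +ᵥ c ∈ affineSpan ℝ (F : Set (E d)) := by
      refine AffineSubspace.vadd_mem_of_mem_direction ?_ (convexHull_subset_affineSpan _ hcm)
      rw [direction_affineSpan, ← neg_sub]
      exact Submodule.neg_mem _ h1
    rw [vadd_eq_add, sub_add_cancel] at h2
    exact h2
  have hwH : w ∈ Hᗮ := Submodule.starProjection_apply_mem _ _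
  have hn : outerNormal K F = ‖w‖⁻¹ • w := by
    have hpos : 0 < ((d : ℝ) + 1)⁻¹ := by positivity
    rw [outerNormal, e1, map_smul, NormedSpace.normalize_smul_of_pos hpos]
    rfl
  have hn1 : ‖outerNormal K F‖ = 1 := by
    rw [hn, norm_smul, norm_inv, norm_norm, inv_mul_cancel₀ (norm_ne_zero_iff.2 hw0)]
  have hnH : outerNormal K F ∈ Hᗮ := hn ▸ Submodule.smul_mem _ _ hwH
  refine ⟨‖w‖, norm_pos_iff.2 hw0, hn1, ?_, ?_⟩
  · symm
    apply Submodule.eq_of_le_of_finrank_eq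
    · rw [Submodule.span_singleton_le_iff_mem]; exact hnH
    · rw [finrank_span_singleton (by rw [← norm_ne_zero_iff, hn1]; exact one_ne_zero)]
      have h1 := H.finrank_add_finrank_orthogonal
      have h2 := hK.finrank_vectorSpan_erase hd ha
      rw [← hF, ← hH] at h2
      rw [finrank_euclideanSpace_fin] at h1
      omega
  · intro y hy
    have h1 : y - a = (y - c) + (c - a) := by abel
    have h2 : inner ℝ (outerNormal K F) (y - c) = 0 :=
      (Submodule.mem_orthogonal' _ _).1 hnH _ (sub_mem_vectorSpan hy hcm)
    have h3 : inner ℝ w (c - a) = ‖w‖ * ‖w‖ := by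
      rw [← real_inner_self_eq_norm_mul_norm]
      conv_lhs => rw [← Submodule.starProjection_eq_self_iff.2 hwH,
        Submodule.inner_starProjection_left_eq_right]
    rw [h1, inner_add_right, h2, zero_add, hn, real_inner_smul_left, h3,
      inv_mul_cancel_left₀ (norm_ne_zero_iff.2 hw0)]

/-- Provides the hyperplane coordinate of a facet point under the parametrisation that sends z to a
+ z + h n. -/
theorem sub_sub_height_mem {a : E d} {h : ℝ}
    (hn : ‖outerNormal K (K.erase a)‖ = 1)
    (hH : (vectorSpan ℝ (K.erase a : Set (E d)))ᗮ = ℝ ∙ outerNormal K (K.erase a))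
    (hh : ∀ y ∈ hull (K.erase a), inner ℝ (outerNormal K (K.erase a)) (y - a) = h)
    {y : E d} (hy : y ∈ hull (K.erase a)) :
    y - a - h • outerNormal K (K.erase a) ∈ vectorSpan ℝ (K.erase a : Set (E d)) := by
  rw [← Submodule.orthogonal_orthogonal (vectorSpan ℝ (K.erase a : Set (E d))), hH,
    Submodule.mem_orthogonal_singleton_iff_inner_right, inner_sub_right, hh y hy,
    real_inner_smul_right, real_inner_self_eq_norm_mul_norm, hn]
  ring

theorem mem_hull_iff_cone (hK : IsSimplex K) (hd : 0 < d) {a : E d} (ha : a ∈ K) {x : E d} :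
    x ∈ hull K ↔ ∃ y ∈ hull (K.erase a), ∃ t : ℝ, 0 ≤ t ∧ t ≤ 1 ∧ x = a + t • (y - a) := by
  have h1 : (K : Set (E d)) = insert a (K.erase a : Set (E d)) := by
    rw [← Finset.coe_insert, Finset.insert_erase ha]
  rw [hull, h1, convexHull_insert (hK.erase_nonempty hd ha), mem_convexJoin]
  simp only [mem_singleton_iff, exists_eq_left]
  refine exists_congr fun y => and_congr_right fun _ => ?_
  rw [segment_eq_image']
  constructor
  · rintro ⟨t, ⟨h0, h1⟩, rfl⟩; exact ⟨t, h0, h1, rfl⟩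
  · rintro ⟨t, h0, h1, rfl⟩; exact ⟨t, ⟨h0, h1⟩, rfl⟩

/-- Surface integrals over a facet, in coordinates of the hyperplane through that facet. -/
theorem setIntegral_facet (hK : IsSimplex K) (hd : 0 < d) {a : E d} (ha : a ∈ K) {h : ℝ}
    (hn : ‖outerNormal K (K.erase a)‖ = 1)
    (hH : (vectorSpan ℝ (K.erase a : Set (E d)))ᗮ = ℝ ∙ outerNormal K (K.erase a))
    (hh : ∀ y ∈ hull (K.erase a), inner ℝ (outerNormal K (K.erase a)) (y - a) = h) :
    MeasurePreserving
      (fun z : vectorSpan ℝ (K.erase a : Set (E d)) =>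
        a + ((z : E d) + h • outerNormal K (K.erase a)))
      (volume.restrict ((fun z : vectorSpan ℝ (K.erase a : Set (E d)) =>
        a + ((z : E d) + h • outerNormal K (K.erase a))) ⁻¹' hull (K.erase a)))
      ((μHE[d - 1] : Measure (E d)).restrict (hull (K.erase a))) := by
  set H := vectorSpan ℝ (K.erase a : Set (E d))
  set n := outerNormal K (K.erase a)
  have hiso : Isometry (fun z : H => a + ((z : E d) + h • n)) := by
    intro x y
    simp only [edist_add_left, edist_add_right]
    rfl
  have hr : Module.finrank ℝ H = d - 1 := by
    have : Module.finrank ℝ H + 1 = d := hK.finrank_vectorSpan_erase hd ha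
    omega
  refine ⟨hiso.continuous.measurable, ?_⟩
  rw [← Measure.restrict_map hiso.continuous.measurable (measurableSet_hull _),
    ← InnerProductSpace.euclideanHausdorffMeasure_eq_volume, hr,
    hiso.map_euclideanHausdorffMeasure, Measure.restrict_restrict (measurableSet_hull _)]
  congr 1
  -- An isometry carries Hausdorff measure to Hausdorff measure restricted to its range, and the
  -- facet lies in that range.
  refine inter_eq_left.2 fun y hy => ?_
  exact ⟨⟨_, sub_sub_height_mem hn hH hh hy⟩, by change a + (y - a - h • n + h • n) = y; abel⟩

theorem isometry_facet {H : Submodule ℝ (E d)} (a w : E d) :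
    Isometry (fun z : H => a + ((z : E d) + w)) := by
  intro x y
  simp only [edist_add_left, edist_add_right]
  rfl

/-- Integrating the divergence of the radial field `f (x - a)`, for a vertex `a` of a simplex. -/
theorem radial_divergence (hK : IsSimplex K) (hd : 0 < d) {a : E d} (ha : a ∈ K) {h : ℝ}
    (hpos : 0 < h) (hn : ‖outerNormal K (K.erase a)‖ = 1)
    (hH : (vectorSpan ℝ (K.erase a : Set (E d)))ᗮ = ℝ ∙ outerNormal K (K.erase a))
    (hh : ∀ y ∈ hull (K.erase a), inner ℝ (outerNormal K (K.erase a)) (y - a) = h)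
    {f : E d → ℝ} (hf : ContDiff ℝ 1 f) :
    ∫ x in hull K, (d * f x + fderiv ℝ f x (x - a)) =
      h * ∫ x in hull (K.erase a), f x ∂μHE[d - 1] := by
  have hmp := hK.setIntegral_facet hd ha hn hH hh
  set H := vectorSpan ℝ (K.erase a : Set (E d))
  set n := outerNormal K (K.erase a)
  have hr : (Module.finrank ℝ H : ℝ) + 1 = d := by
    exact_mod_cast hK.finrank_vectorSpan_erase hd ha
  have hiso : Isometry (fun z : H => a + ((z : E d) + h • n)) := isometry_facet a _
  set B := (fun z : H => a + ((z : E d) + h • n)) ⁻¹' hull (K.erase a)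
  have hB : IsCompact B := hiso.isClosedEmbedding.isCompact_preimage (isCompact_hull _)
  rw [← hmp.integral_comp hiso.isClosedEmbedding.measurableEmbedding, ← hr]
  -- Pairing with the normal reads off the height, so the cone parameter is determined by the point.
  have key : ∀ (r : ℝ) (z : H) (y : E d) (t : ℝ), y ∈ hull (K.erase a) →
      a + r • ((z : E d) + h • n) = a + t • (y - a) → t = r := by
    intro r z y t hy he
    have h1 : inner ℝ n (r • ((z : E d) + h • n)) = inner ℝ n (t • (y - a)) := by
      rw [add_left_cancel he]
    have hz : inner ℝ n (z : E d) = 0 := by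
      have : n ∈ Hᗮ := hH ▸ Submodule.mem_span_singleton_self n
      exact (Submodule.mem_orthogonal' _ _).1 this _ z.2
    rw [real_inner_smul_right, real_inner_smul_right, hh y hy, inner_add_right, hz,
      real_inner_smul_right, real_inner_self_eq_norm_mul_norm, hn] at h1
    have : r * h = t * h := by linarith
    exact (mul_right_cancel₀ hpos.ne' this).symm
  refine setIntegral_radial_divergence H n hn hH a hpos hB (isCompact_hull K) ?_ ?_ hf
  · intro r z hr0
    rw [hK.mem_hull_iff_cone hd ha]
    constructor
    · rintro ⟨y, hy, t, h0, h1, he⟩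
      obtain rfl := key r z y t hy he
      refine ⟨h1, ?_⟩
      have h2 := smul_right_injective (E d) hr0.ne' (add_left_cancel he)
      change a + ((z : E d) + h • n) ∈ hull (K.erase a)
      rw [h2]; simpa using hy
    · rintro ⟨h1, hz⟩
      exact ⟨_, hz, r, hr0.le, h1, by simp⟩
  · intro r z hr0
    rw [hK.mem_hull_iff_cone hd ha]
    rintro ⟨y, hy, t, h0, h1, he⟩
    obtain rfl := key r z y t hy he
    exact absurd hr0 (not_lt.2 h0)

end IsSimplex
end HHO

namespace HHO

/-! ### A Poincaré inequality on compact convex sets -/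

section Poincare

variable {V : Type*} [NormedAddCommGroup V] [InnerProductSpace ℝ V] [FiniteDimensional ℝ V]
  [MeasurableSpace V] [BorelSpace V]

/-- The map sending x to (1 − t) x + t y keeps K inside K by convexity, and the inverse of its
Jacobian is at most 2^n as long as t ≤ 1/2. -/
theorem setIntegral_contraction_le {K : Set V} (hK : IsCompact K) (hc : Convex ℝ K) {g : V → ℝ}
    (hg : Continuous g) (hg0 : ∀ x, 0 ≤ g x) {t : ℝ} (ht0 : 0 ≤ t) (ht : t ≤ 1 / 2) {y : V}
    (hy : y ∈ K) :
    ∫ x in K, g (x + t • (y - x)) ≤ 2 ^ Module.finrank ℝ V * ∫ x in K, g x := by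
  have hKm := hK.measurableSet
  have hi : Integrable (K.indicator g) :=
    (integrable_indicator_iff hKm).2 (hg.continuousOn.integrableOn_compact hK)
  have e : ∀ x : V, x + t • (y - x) = (1 - t) • x + t • y := fun x => by module
  simp_rw [e]
  have ht1 : 0 < 1 - t := by linarith
  have hi2 : Integrable (fun x => K.indicator g ((1 - t) • x + t • y)) :=
    (hi.comp_add_right (t • y)).comp_smul ht1.ne'
  rw [← integral_indicator hKm]
  calc ∫ x, K.indicator (fun x => g ((1 - t) • x + t • y)) x
      ≤ ∫ x, K.indicator g ((1 - t) • x + t • y) := by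
        refine integral_mono_of_nonneg (ae_of_all _ fun x => ?_) hi2 (ae_of_all _ fun x => ?_)
        · exact indicator_nonneg (fun _ _ => hg0 _) _
        · by_cases hx : x ∈ K
          · dsimp only
            rw [indicator_of_mem hx, indicator_of_mem
              (hc hx hy ht1.le ht0 (by ring))]
          · dsimp only
            rw [indicator_of_notMem hx]
            exact indicator_nonneg (fun _ _ => hg0 _) _
    _ = |((1 - t) ^ Module.finrank ℝ V)⁻¹| * ∫ x in K, g x := by
        rw [Measure.integral_comp_smul volume (fun x => K.indicator g (x + t • y)),
          integral_add_right_eq_self, smul_eq_mul, integral_indicator hKm]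
    _ ≤ 2 ^ Module.finrank ℝ V * ∫ x in K, g x := by
        refine mul_le_mul_of_nonneg_right ?_ (integral_nonneg hg0)
        rw [abs_of_pos (by positivity), ← inv_pow]
        refine pow_le_pow_left₀ (by positivity) ?_ _
        rw [inv_le_comm₀ ht1 two_pos]
        linarith

/-- On an interval of length 1/2 the mean of g is twice its integral. Expanding the nonnegative
integral of the squared deviation from the mean gives the bound. -/
theorem sq_intervalIntegral_half_le {g : ℝ → ℝ} (hg : Continuous g) :
    (∫ t in (0 : ℝ)..1 / 2, g t) ^ 2 ≤ ∫ t in (0 : ℝ)..1 / 2, g t ^ 2 := by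
  set m := ∫ t in (0 : ℝ)..1 / 2, g t with hm
  have h1 : ∫ t in (0 : ℝ)..1 / 2, (g t - 2 * m) ^ 2 =
      (∫ t in (0 : ℝ)..1 / 2, g t ^ 2) - 2 * m ^ 2 := by
    have : ∀ t, (g t - 2 * m) ^ 2 = g t ^ 2 - 4 * m * g t + 4 * m ^ 2 := fun t => by ring
    simp_rw [this]
    rw [intervalIntegral.integral_add, intervalIntegral.integral_sub,
      intervalIntegral.integral_const_mul, intervalIntegral.integral_const, ← hm]
    · simp only [smul_eq_mul]; ring
    all_goals exact Continuous.intervalIntegrable (by fun_prop) _ _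
  have h2 : 0 ≤ ∫ t in (0 : ℝ)..1 / 2, (g t - 2 * m) ^ 2 :=
    intervalIntegral.integral_nonneg (by norm_num) fun t _ => sq_nonneg _
  nlinarith [sq_nonneg m]

/-- The left side is half the double integral of (ψ x − ψ y)² over K × K. Each difference is an
integral of the derivative along the segment from x to y, and the integrals of the squared
derivative along these segments are bounded by contraction. No division by the volume occurs, so K
may have empty interior. -/
theorem exists_poincare {K : Set V} (hK : IsCompact K) (hc : Convex ℝ K) :
    ∃ C : ℝ, ∀ ψ : V → ℝ, ContDiff ℝ 1 ψ →
      volume.real K * (∫ x in K, ψ x ^ 2) - (∫ x in K, ψ x) ^ 2 ≤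
        C * ∫ x in K, ‖fderiv ℝ ψ x‖ ^ 2 := by
  obtain ⟨D, hD⟩ := hK.isBounded.exists_norm_le
  refine ⟨2 * (volume.real K * ((2 * D) ^ 2 * 2 ^ Module.finrank ℝ V)), fun ψ hψ => ?_⟩
  have hψc := hψ.continuous
  have hψ' : Continuous (fderiv ℝ ψ) := hψ.continuous_fderiv (by simp)
  have hKm := hK.measurableSet
  have : IsFiniteMeasure (volume.restrict K) := ⟨by simpa using hK.measure_lt_top⟩
  set μ := (volume.restrict K : Measure V) with hμ
  have hint : ∀ {g : V × V → ℝ}, Continuous g → Integrable g (μ.prod μ) := by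
    intro g hg
    rw [hμ, Measure.prod_restrict]
    exact hg.continuousOn.integrableOn_compact (hK.prod hK)
  have hint1 : ∀ {g : V → ℝ}, Continuous g → Integrable g μ := fun hg =>
    hg.continuousOn.integrableOn_compact hK
  have e1 : ∫ q, (ψ q.1 - ψ q.2) ^ 2 ∂μ.prod μ =
      2 * (volume.real K * (∫ x in K, ψ x ^ 2) - (∫ x in K, ψ x) ^ 2) := by
    have : ∀ q : V × V, (ψ q.1 - ψ q.2) ^ 2 = ψ q.1 ^ 2 * 1 + 1 * ψ q.2 ^ 2 - 2 * (ψ q.1 * ψ q.2) :=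
      fun q => by ring
    simp_rw [this]
    rw [integral_sub (hint (by fun_prop)) (hint (by fun_prop)),
      integral_add (hint (by fun_prop)) (hint (by fun_prop)),
      integral_prod_mul (fun x => ψ x ^ 2) (fun _ => (1 : ℝ)),
      integral_prod_mul (fun _ => (1 : ℝ)) (fun x => ψ x ^ 2), integral_const_mul,
      integral_prod_mul ψ ψ]
    simp only [integral_const, hμ, smul_eq_mul, mul_one, measureReal_restrict_apply_univ]
    ring
  -- Splitting at the midpoint keeps the parameter in [0, 1/2]. Over the whole segment the
  -- contraction towards y would degenerate as t tends to 1. The two halves contribute equally by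
  -- symmetry.
  set mid : V × V → V := fun q => q.1 + (1 / 2 : ℝ) • (q.2 - q.1) with hmid
  have hmidc : Continuous mid := by fun_prop
  have e2 : ∫ q, (ψ q.2 - ψ (mid q)) ^ 2 ∂μ.prod μ = ∫ q, (ψ q.1 - ψ (mid q)) ^ 2 ∂μ.prod μ := by
    rw [← integral_prod_swap]
    refine integral_congr_ae (ae_of_all _ fun q => ?_)
    have : mid q.swap = mid q := by simp only [hmid, Prod.fst_swap, Prod.snd_swap]; module
    simp only [this, Prod.snd_swap]
  have e3 : ∫ q, (ψ q.1 - ψ q.2) ^ 2 ∂μ.prod μ ≤ 4 * ∫ q, (ψ q.1 - ψ (mid q)) ^ 2 ∂μ.prod μ := by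
    calc _ ≤ ∫ q, (2 * (ψ q.1 - ψ (mid q)) ^ 2 + 2 * (ψ q.2 - ψ (mid q)) ^ 2) ∂μ.prod μ := by
          refine integral_mono (hint (by fun_prop)) (hint (by fun_prop)) fun q => ?_
          have := sq_nonneg ((ψ q.1 - ψ (mid q)) + (ψ q.2 - ψ (mid q)))
          dsimp only
          nlinarith
      _ = _ := by
          rw [integral_add (hint (by fun_prop)) (hint (by fun_prop)), integral_const_mul,
            integral_const_mul, e2]
          ring
  have e4 : ∀ x ∈ K, ∀ y ∈ K, (ψ x - ψ (mid (x, y))) ^ 2 ≤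
      ∫ t in (0 : ℝ)..1 / 2, (2 * D) ^ 2 * ‖fderiv ℝ ψ (x + t • (y - x))‖ ^ 2 := by
    intro x hx y hy
    have hd : ∀ t : ℝ, HasDerivAt (fun t : ℝ => ψ (x + t • (y - x)))
        (fderiv ℝ ψ (x + t • (y - x)) (y - x)) t := by
      intro t
      have g1 : HasDerivAt (fun t : ℝ => x + t • (y - x)) (y - x) t := by
        simpa using ((hasDerivAt_id t).smul_const (y - x)).const_add x
      exact ((hψ.differentiable (by simp) _).hasFDerivAt).comp_hasDerivAt t g1
    have h1 := intervalIntegral.integral_eq_sub_of_hasDerivAt (a := 0) (b := 1 / 2)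
      (fun t _ => hd t) (Continuous.intervalIntegrable (by fun_prop) _ _)
    have h2 : (ψ x - ψ (mid (x, y))) ^ 2 =
        (∫ t in (0 : ℝ)..1 / 2, fderiv ℝ ψ (x + t • (y - x)) (y - x)) ^ 2 := by
      rw [h1]; simp only [hmid, zero_smul, add_zero]; ring
    rw [h2]
    refine (sq_intervalIntegral_half_le (by fun_prop)).trans ?_
    refine intervalIntegral.integral_mono_on (by norm_num)
      (Continuous.intervalIntegrable (by fun_prop) _ _)
      (Continuous.intervalIntegrable (by fun_prop) _ _) fun t _ => ?_
    rw [← mul_pow, ← sq_abs]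
    refine pow_le_pow_left₀ (abs_nonneg _) ?_ 2
    have h3 := (fderiv ℝ ψ (x + t • (y - x))).le_opNorm (y - x)
    rw [Real.norm_eq_abs] at h3
    have h4 : ‖y - x‖ ≤ 2 * D := by
      have := norm_sub_le y x
      have := hD x hx
      have := hD y hy
      linarith
    calc _ ≤ _ := h3
      _ ≤ ‖fderiv ℝ ψ (x + t • (y - x))‖ * (2 * D) := by gcongr
      _ = _ := mul_comm _ _
  have e5 : ∫ q, (ψ q.1 - ψ (mid q)) ^ 2 ∂μ.prod μ ≤
      ∫ q, (∫ t in (0 : ℝ)..1 / 2, (2 * D) ^ 2 * ‖fderiv ℝ ψ (q.1 + t • (q.2 - q.1))‖ ^ 2)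
        ∂μ.prod μ := by
    refine integral_mono_ae (hint (by fun_prop)) (hint ?_) ?_
    · exact intervalIntegral.continuous_parametric_intervalIntegral_of_continuous' (by fun_prop) _ _
    · rw [hμ, Measure.prod_restrict]
      refine (ae_restrict_iff' (hKm.prod hKm)).2 (ae_of_all _ fun q hq => ?_)
      exact e4 q.1 hq.1 q.2 hq.2
  have e6 : ∫ q, (∫ t in (0 : ℝ)..1 / 2, (2 * D) ^ 2 * ‖fderiv ℝ ψ (q.1 + t • (q.2 - q.1))‖ ^ 2)
        ∂μ.prod μ =
      ∫ t in (0 : ℝ)..1 / 2, (2 * D) ^ 2 *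
        ∫ y in K, ∫ x in K, ‖fderiv ℝ ψ (x + t • (y - x))‖ ^ 2 := by
    simp_rw [intervalIntegral.integral_of_le (show (0 : ℝ) ≤ 1 / 2 by norm_num),
      ← integral_Icc_eq_integral_Ioc]
    rw [integral_integral_swap]
    · refine integral_congr_ae (ae_of_all _ fun t => ?_)
      dsimp only
      rw [integral_const_mul, integral_prod_symm _ (hint (by fun_prop))]
    · rw [hμ, Measure.prod_restrict, Measure.prod_restrict]
      exact ContinuousOn.integrableOn_compact ((hK.prod hK).prod isCompact_Icc) (by
        unfold Function.uncurry
        fun_prop)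
  have e7 : ∀ t ∈ Icc (0 : ℝ) (1 / 2), ‖(2 * D) ^ 2 *
        ∫ y in K, ∫ x in K, ‖fderiv ℝ ψ (x + t • (y - x))‖ ^ 2‖ ≤
        (2 * D) ^ 2 * (volume.real K * (2 ^ Module.finrank ℝ V *
          ∫ x in K, ‖fderiv ℝ ψ x‖ ^ 2)) := by
    intro t ht
    have h0 : 0 ≤ ∫ y in K, ∫ x in K, ‖fderiv ℝ ψ (x + t • (y - x))‖ ^ 2 :=
      integral_nonneg fun _ => integral_nonneg fun _ => sq_nonneg _
    rw [Real.norm_of_nonneg (by positivity)]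
    refine mul_le_mul_of_nonneg_left ?_ (by positivity)
    calc _ ≤ ∫ y in K, 2 ^ Module.finrank ℝ V * ∫ x in K, ‖fderiv ℝ ψ x‖ ^ 2 := by
          refine integral_mono_of_nonneg (ae_of_all _ fun _ => integral_nonneg fun _ => sq_nonneg _)
            (integrable_const _) ?_
          refine (ae_restrict_iff' hKm).2 (ae_of_all _ fun y hy => ?_)
          exact setIntegral_contraction_le hK hc (g := fun x => ‖fderiv ℝ ψ x‖ ^ 2)
            (by fun_prop) (fun _ => sq_nonneg _) ht.1 ht.2 hy
      _ = _ := by simp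
  have e8 : (∫ t in (0 : ℝ)..1 / 2, (2 * D) ^ 2 *
        ∫ y in K, ∫ x in K, ‖fderiv ℝ ψ (x + t • (y - x))‖ ^ 2) ≤
        ((2 * D) ^ 2 * (volume.real K * (2 ^ Module.finrank ℝ V *
          ∫ x in K, ‖fderiv ℝ ψ x‖ ^ 2))) * |1 / 2 - 0| := by
    refine (Real.le_norm_self _).trans (intervalIntegral.norm_integral_le_of_norm_le_const fun t ht => ?_)
    rw [uIoc_of_le (by norm_num)] at ht
    exact e7 t ⟨ht.1.le, ht.2⟩
  have h0 : (0 : ℝ) ≤ volume.real K * ((2 * D) ^ 2 * 2 ^ Module.finrank ℝ V) *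
      ∫ x in K, ‖fderiv ℝ ψ x‖ ^ 2 := by positivity
  rw [e6] at e5
  have e9 : |(1 : ℝ) / 2 - 0| = 1 / 2 := by norm_num
  rw [e9] at e8
  linarith [e1, e3, e5, e8]

end Poincare
end HHO

/-! ### Divergence theorem, Green's formula and trace inequality on a simplex -/

namespace HHO

variable {d : ℕ}

/-- The divergence of a vector field on `ℝ^d`. -/
def divg (X : E d → E d) (x : E d) : ℝ :=
  ∑ i, fderiv ℝ X x (EuclideanSpace.single i 1) i

theorem fderiv_apply_coord {X : E d → E d} {x : E d} (hX : DifferentiableAt ℝ X x) (v : E d)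
    (i : Fin d) : fderiv ℝ X x v i = fderiv ℝ (fun x => X x i) x v := by
  have h1 := (EuclideanSpace.proj i : E d →L[ℝ] ℝ).hasFDerivAt.comp x hX.hasFDerivAt
  have h2 : HasFDerivAt (fun x => X x i) _ x := h1
  rw [h2.fderiv]
  rfl

theorem divg_smul {φ : E d → ℝ} {X : E d → E d} {x : E d} (hφ : DifferentiableAt ℝ φ x)
    (hX : DifferentiableAt ℝ X x) :
    divg (fun x => φ x • X x) x = fderiv ℝ φ x (X x) + φ x * divg X x := by
  simp only [divg]
  have h1 : HasFDerivAt (fun x => φ x • X x) _ x := hφ.hasFDerivAt.smul hX.hasFDerivAt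
  rw [h1.fderiv]
  have h2 : fderiv ℝ φ x (X x) = ∑ i, fderiv ℝ φ x (EuclideanSpace.single i 1) * X x i := by
    conv_lhs => rw [← (EuclideanSpace.basisFun (Fin d) ℝ).sum_repr (X x)]
    simp [map_sum, mul_comm]
  rw [h2, Finset.mul_sum, ← Finset.sum_add_distrib]
  refine Finset.sum_congr rfl fun i _ => ?_
  simp
  ring

theorem continuous_divg {X : E d → E d} (hX : ContDiff ℝ 1 X) : Continuous (divg X) := by
  have : Continuous (fderiv ℝ X) := hX.continuous_fderiv (by simp)
  unfold divg
  fun_prop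

namespace IsSimplex

variable {K : Finset (E d)}

theorem surface_lt_top (hK : IsSimplex K) (hd : 0 < d) {F : Finset (E d)} (hF : F ∈ facets K) :
    (μHE[d - 1] : Measure (E d)) (hull F) < ⊤ := by
  obtain ⟨a, ha, rfl⟩ := (mem_facets_iff hK.card_eq).1 hF
  obtain ⟨h, -, hn, hH, hh⟩ := hK.exists_height hd ha
  have hmp := hK.setIntegral_facet hd ha hn hH hh
  have h1 := hmp.measure_preimage MeasurableSet.univ.nullMeasurableSet
  rw [preimage_univ, Measure.restrict_apply_univ, Measure.restrict_apply_univ] at h1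
  rw [← h1]
  exact ((isometry_facet a _).isClosedEmbedding.isCompact_preimage (isCompact_hull _)).measure_lt_top

theorem vectorSpan_eq_top (hK : IsSimplex K) : vectorSpan ℝ (K : Set (E d)) = ⊤ := by
  have h := hK.indep.vectorSpan_eq_top_of_card_eq_finrank_add_one (by
    rw [Fintype.card_coe, hK.card_eq, finrank_euclideanSpace_fin])
  rw [Subtype.range_coe_subtype] at h
  exact h

/-- Both sides are linear in the direction, and the differences of vertices span the space. For b −
a, subtract the radial identities with apexes `a` and `b`: since (x − a) − (x − b) = b − a, the
zeroth-order terms cancel and the two opposite facets remain. Every other facet contains both `a`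
and `b`, so its normal is orthogonal to b − a. -/
theorem setIntegral_fderiv (hK : IsSimplex K) (hd : 0 < d) {f : E d → ℝ} (hf : ContDiff ℝ 1 f)
    (e : E d) :
    ∫ x in hull K, fderiv ℝ f x e = ∑ F ∈ facets K,
      inner ℝ (outerNormal K F) e * ∫ x in hull F, f x ∂μHE[d - 1] := by
  classical
  rw [sum_facets hK.card_eq fun F => inner ℝ (outerNormal K F) e *
    ∫ x in hull F, f x ∂μHE[d - 1]]
  have hfc := hf.continuous
  have hf' : Continuous (fderiv ℝ f) := hf.continuous_fderiv (by simp)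
  have hint : ∀ {g : E d → ℝ}, Continuous g → IntegrableOn g (hull K) := fun hg =>
    hg.continuousOn.integrableOn_compact (isCompact_hull K)
  have hint' : ∀ v : E d, IntegrableOn (fun x => fderiv ℝ f x v) (hull K) := fun v =>
    hint (by fun_prop)
  have he : e ∈ vectorSpan ℝ (K : Set (E d)) := hK.vectorSpan_eq_top ▸ Submodule.mem_top
  rw [vectorSpan_def] at he
  induction he using Submodule.span_induction with
  | zero => simp
  | add u v _ _ hu hv =>
    simp only [map_add, inner_add_right, add_mul, Finset.sum_add_distrib]
    rw [integral_add (hint' u) (hint' v), hu, hv]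
  | smul c u _ hu =>
    simp only [map_smul, smul_eq_mul, inner_smul_right, mul_assoc]
    rw [integral_const_mul, hu, Finset.mul_sum]
  | mem u hu =>
    obtain ⟨b, hb, a, ha, rfl⟩ := Set.mem_vsub.1 hu
    rw [Finset.mem_coe] at ha hb
    by_cases hab : a = b
    · simp [hab]
    obtain ⟨h1, hp1, hn1, hH1, hh1⟩ := hK.exists_height hd ha
    obtain ⟨h2, hp2, hn2, hH2, hh2⟩ := hK.exists_height hd hb
    have r1 := hK.radial_divergence hd ha hp1 hn1 hH1 hh1 hf
    have r2 := hK.radial_divergence hd hb hp2 hn2 hH2 hh2 hf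
    have e1 : ∫ x in hull K, fderiv ℝ f x (b -ᵥ a) =
        h1 * ∫ x in hull (K.erase a), f x ∂μHE[d - 1] -
        h2 * ∫ x in hull (K.erase b), f x ∂μHE[d - 1] := by
      rw [← r1, ← r2, ← integral_sub (hint (by fun_prop)) (hint (by fun_prop))]
      refine integral_congr_ae (ae_of_all _ fun x => ?_)
      have : (b -ᵥ a : E d) = (x - a) - (x - b) := by simp
      dsimp only
      rw [this, map_sub]
      ring
    have i1 : inner ℝ (outerNormal K (K.erase a)) (b -ᵥ a) = h1 :=
      hh1 b (mem_hull_of_mem (Finset.mem_erase.2 ⟨Ne.symm hab, hb⟩))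
    have i2 : inner ℝ (outerNormal K (K.erase b)) (b -ᵥ a) = -h2 := by
      rw [← hh2 a (mem_hull_of_mem (Finset.mem_erase.2 ⟨hab, ha⟩)), ← inner_neg_right]
      simp
    have i3 : ∀ c ∈ K, c ∉ ({a, b} : Finset (E d)) →
        inner ℝ (outerNormal K (K.erase c)) (b -ᵥ a) *
        ∫ x in hull (K.erase c), f x ∂μHE[d - 1] = 0 := by
      intro c hc hcab
      simp only [Finset.mem_insert, Finset.mem_singleton, not_or] at hcab
      obtain ⟨h3, -, -, -, hh3⟩ := hK.exists_height hd hc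
      have j1 := hh3 a (mem_hull_of_mem (Finset.mem_erase.2 ⟨Ne.symm hcab.1, ha⟩))
      have j2 := hh3 b (mem_hull_of_mem (Finset.mem_erase.2 ⟨Ne.symm hcab.2, hb⟩))
      have : (b -ᵥ a : E d) = (b - c) - (a - c) := by simp
      rw [this, inner_sub_right, j1, j2, sub_self, zero_mul]
    rw [e1, ← Finset.sum_subset (s₁ := {a, b}) (by simp [Finset.insert_subset_iff, ha, hb]) i3,
      Finset.sum_pair hab, i1, i2]
    ring

/-- The divergence theorem on a simplex. -/
theorem setIntegral_divg (hK : IsSimplex K) (hd : 0 < d) {X : E d → E d} (hX : ContDiff ℝ 1 X) :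
    ∫ x in hull K, divg X x = ∑ F ∈ facets K,
      ∫ x in hull F, inner ℝ (X x) (outerNormal K F) ∂μHE[d - 1] := by
  have hXi : ∀ i, ContDiff ℝ 1 (fun x => X x i) := fun i => by fun_prop
  have hc : ∀ i, Continuous (fun x => X x i) := fun i => (hXi i).continuous
  have e1 : ∀ i x (e : E d), fderiv ℝ X x e i = fderiv ℝ (fun x => X x i) x e := fun i x e =>
    fderiv_apply_coord (hX.differentiable (by simp) x) e i
  simp_rw [divg, e1]
  rw [integral_finsetSum]
  · simp_rw [hK.setIntegral_fderiv hd (hXi _)]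
    rw [Finset.sum_comm]
    refine Finset.sum_congr rfl fun F hF => ?_
    have hFf := hK.surface_lt_top hd hF
    have hint : ∀ i, IntegrableOn (fun x => X x i) (hull F) (μHE[d - 1]) := by
      intro i
      refine (hc i).continuousOn.integrableOn_of_subset_isCompact (isCompact_hull F)
        (measurableSet_hull F) subset_rfl hFf.ne
    simp_rw [← integral_const_mul]
    rw [← integral_finsetSum _ fun i _ => (hint i).const_mul _]
    refine integral_congr_ae (ae_of_all _ fun x => ?_)
    simp [PiLp.inner_apply, mul_comm]
  · intro i _
    refine Continuous.continuousOn ?_ |>.integrableOn_compact (isCompact_hull K)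
    have := (hXi i).continuous_fderiv (by simp)
    fun_prop

/-- Green's formula on a simplex. -/
theorem setIntegral_green (hK : IsSimplex K) (hd : 0 < d) {X : E d → E d} (hX : ContDiff ℝ 1 X)
    {φ : E d → ℝ} (hφ : ContDiff ℝ 1 φ) :
    ∫ x in hull K, (fderiv ℝ φ x (X x) + φ x * divg X x) = ∑ F ∈ facets K,
      ∫ x in hull F, φ x * inner ℝ (X x) (outerNormal K F) ∂μHE[d - 1] := by
  have h := hK.setIntegral_divg hd (X := fun x => φ x • X x) (hφ.smul hX)
  simp only [real_inner_smul_left] at h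
  rw [← h]
  exact integral_congr_ae (ae_of_all _ fun x =>
    (divg_smul (hφ.differentiable (by simp) x) (hX.differentiable (by simp) x)).symm)

/-- The radial identity for φ², with apex the vertex opposite to F, expresses the facet integral as
a volume integral of d φ² + 2 φ ∂φ(x − a), divided by the height. The mixed term is absorbed by
Young's inequality together with |x − a| ≤ 2D on the simplex. -/
theorem exists_trace_inequality (hK : IsSimplex K) (hd : 0 < d) {F : Finset (E d)}
    (hF : F ∈ facets K) :
    ∃ C : ℝ, 0 ≤ C ∧ ∀ φ : E d → ℝ, ContDiff ℝ 1 φ →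
      ∫ x in hull F, φ x ^ 2 ∂μHE[d - 1] ≤
        C * ((∫ x in hull K, φ x ^ 2) + ∫ x in hull K, ‖fderiv ℝ φ x‖ ^ 2) := by
  obtain ⟨a, ha, rfl⟩ := (mem_facets_iff hK.card_eq).1 hF
  obtain ⟨h, hpos, hn, hH, hh⟩ := hK.exists_height hd ha
  obtain ⟨D, hD⟩ := (isCompact_hull K).isBounded.exists_norm_le
  have hD0 : 0 ≤ D := (norm_nonneg _).trans (hD a (mem_hull_of_mem ha))
  refine ⟨h⁻¹ * (d + 1 + (2 * D) ^ 2), by positivity, fun φ hφ => ?_⟩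
  have hφc := hφ.continuous
  have hφ' : Continuous (fderiv ℝ φ) := hφ.continuous_fderiv (by simp)
  have hint : ∀ {g : E d → ℝ}, Continuous g → IntegrableOn g (hull K) := fun hg =>
    hg.continuousOn.integrableOn_compact (isCompact_hull K)
  have r := hK.radial_divergence hd ha hpos hn hH hh (hφ.pow 2)
  have hder : ∀ x v, fderiv ℝ (fun x => φ x ^ 2) x v = 2 * φ x * fderiv ℝ φ x v := by
    intro x v
    rw [((hφ.differentiable (by simp) x).hasFDerivAt.pow 2).fderiv]
    simp
  simp_rw [hder] at r
  have e1 : ∫ x in hull K, (d * φ x ^ 2 + 2 * φ x * fderiv ℝ φ x (x - a)) ≤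
      ∫ x in hull K, ((d + 1 + (2 * D) ^ 2) * φ x ^ 2 + (d + 1 + (2 * D) ^ 2) * ‖fderiv ℝ φ x‖ ^ 2) := by
    refine setIntegral_mono_on (hint (by fun_prop)) (hint (by fun_prop)) (measurableSet_hull K)
      fun x hx => ?_
    have h1 := (fderiv ℝ φ x).le_opNorm (x - a)
    rw [Real.norm_eq_abs] at h1
    have h2 : ‖x - a‖ ≤ 2 * D := by
      have := norm_sub_le x a
      have := hD x hx
      have := hD a (mem_hull_of_mem ha)
      linarith
    have h3 : |fderiv ℝ φ x (x - a)| ≤ ‖fderiv ℝ φ x‖ * (2 * D) :=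
      h1.trans (by gcongr)
    have h4 : fderiv ℝ φ x (x - a) ^ 2 ≤ ‖fderiv ℝ φ x‖ ^ 2 * (2 * D) ^ 2 := by
      rw [← mul_pow, ← sq_abs]
      exact pow_le_pow_left₀ (abs_nonneg _) h3 2
    nlinarith [sq_nonneg (φ x - fderiv ℝ φ x (x - a)), sq_nonneg (φ x * D),
      mul_nonneg (Nat.cast_nonneg (α := ℝ) d) (sq_nonneg ‖fderiv ℝ φ x‖),
      sq_nonneg ‖fderiv ℝ φ x‖]
  rw [r, integral_add (hint (by fun_prop)) (hint (by fun_prop)), integral_const_mul,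
    integral_const_mul] at e1
  rw [mul_assoc, ← div_eq_inv_mul, le_div_iff₀ hpos]
  linarith

end IsSimplex
end HHO

namespace HHO

variable {d : ℕ}

/-! ### Polynomial functions -/

theorem evalPoly_apply (P : MvPolynomial (Fin d) ℝ) (x : E d) :
    evalPoly d P x = MvPolynomial.aeval (fun i => x i) P := rfl

theorem mem_polyFun_iff {k : ℤ} {f : E d → ℝ} :
    f ∈ polyFun d k ↔ ∃ P ∈ MvPolynomial.restrictSupport ℝ {m : Fin d →₀ ℕ | (m.degree : ℤ) ≤ k},
      evalPoly d P = f := Submodule.mem_map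

theorem analyticOnNhd_of_mem_polyFun {k : ℤ} {f : E d → ℝ} (hf : f ∈ polyFun d k) :
    AnalyticOnNhd ℝ f univ := by
  obtain ⟨P, -, rfl⟩ := mem_polyFun_iff.1 hf
  exact AnalyticOnNhd.aeval_mvPolynomial (f := fun (x : E d) i => x i)
    (fun i x _ => (EuclideanSpace.proj i : E d →L[ℝ] ℝ).analyticAt x) P

theorem contDiff_of_mem_polyFun {k : ℤ} {f : E d → ℝ} (hf : f ∈ polyFun d k) {n : WithTop ℕ∞} :
    ContDiff ℝ n f := (analyticOnNhd_of_mem_polyFun hf).contDiff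

theorem continuous_of_mem_polyFun {k : ℤ} {f : E d → ℝ} (hf : f ∈ polyFun d k) : Continuous f :=
  (contDiff_of_mem_polyFun hf (n := 1)).continuous

theorem polyFun_mono {k l : ℤ} (h : k ≤ l) : polyFun d k ≤ polyFun d l :=
  Submodule.map_mono (MvPolynomial.restrictSupport_mono ℝ fun _ hm => le_trans hm h)

theorem const_mem_polyFun {k : ℤ} (h : 0 ≤ k) (c : ℝ) : (fun _ => c) ∈ polyFun d k := by
  refine mem_polyFun_iff.2 ⟨MvPolynomial.monomial 0 c, ?_, ?_⟩
  · rw [MvPolynomial.monomial_mem_restrictSupport]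
    left
    simpa using h
  · funext x
    simp [evalPoly_apply]

instance finite_polyFun (k : ℤ) : Module.Finite ℝ (polyFun d k) := by
  have hfin : {m : Fin d →₀ ℕ | (m.degree : ℤ) ≤ k}.Finite := by
    refine ((Finset.finite_toSet (Finset.Iic (Finsupp.equivFunOnFinite.symm
      (fun _ : Fin d => k.toNat)))).subset ?_)
    intro m hm
    simp only [Finset.coe_Iic, mem_Iic]
    intro i
    have h1 : m i ≤ m.degree := Finsupp.le_degree i m
    have h2 : (m.degree : ℤ) ≤ k := hm
    simp
    omega
  rw [polyFun, MvPolynomial.restrictSupport_eq_span]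
  have : Module.Finite ℝ (Submodule.span ℝ
      ((fun m : Fin d →₀ ℕ => MvPolynomial.monomial m (1 : ℝ)) ''
        {m : Fin d →₀ ℕ | (m.degree : ℤ) ≤ k})) :=
    Module.Finite.span_of_finite ℝ (hfin.image _)
  infer_instance

theorem hasFDerivAt_evalPoly (P : MvPolynomial (Fin d) ℝ) (x : E d) :
    HasFDerivAt (evalPoly d P) (∑ i, evalPoly d (MvPolynomial.pderiv i P) x •
      (EuclideanSpace.proj i : E d →L[ℝ] ℝ)) x := by
  induction P using MvPolynomial.induction_on with
  | C a =>
    have : evalPoly d (MvPolynomial.C a) = fun _ => a := by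
      funext y; simp [evalPoly_apply]
    rw [this]
    simp only [MvPolynomial.pderiv_C, map_zero, Pi.zero_apply, zero_smul, Finset.sum_const_zero]
    exact hasFDerivAt_const _ _
  | add P Q hP hQ =>
    rw [map_add]
    refine (hP.add hQ).congr_fderiv ?_
    simp only [map_add, Pi.add_apply, add_smul, Finset.sum_add_distrib]
  | mul_X P j hP =>
    have : evalPoly d (P * MvPolynomial.X j) =
        fun y => evalPoly d P y * (EuclideanSpace.proj j : E d →L[ℝ] ℝ) y := by
      funext y; simp [evalPoly_apply]
    rw [this]
    refine (hP.mul (EuclideanSpace.proj j : E d →L[ℝ] ℝ).hasFDerivAt).congr_fderiv ?_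
    ext v
    simp [MvPolynomial.pderiv_X, evalPoly_apply, Pi.single_apply, Finset.mul_sum, add_mul,
      Finset.sum_add_distrib, Finset.sum_ite_eq, apply_ite, ite_mul]
    refine Finset.sum_congr rfl fun i _ => by ring

theorem pderiv_mem_restrictSupport {k : ℤ} {P : MvPolynomial (Fin d) ℝ} (i : Fin d)
    (hP : P ∈ MvPolynomial.restrictSupport ℝ {m : Fin d →₀ ℕ | (m.degree : ℤ) ≤ k}) :
    MvPolynomial.pderiv i P ∈
      MvPolynomial.restrictSupport ℝ {m : Fin d →₀ ℕ | (m.degree : ℤ) ≤ k - 1} := by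
  rw [MvPolynomial.restrictSupport_eq_span] at hP
  induction hP using Submodule.span_induction with
  | zero => simp
  | add P Q _ _ hP hQ => rw [map_add]; exact Submodule.add_mem _ hP hQ
  | smul c P _ hP => rw [Derivation.map_smul]; exact Submodule.smul_mem _ c hP
  | mem P hP =>
    obtain ⟨m, hm, rfl⟩ := hP
    dsimp only
    rw [MvPolynomial.pderiv_monomial, MvPolynomial.monomial_mem_restrictSupport]
    by_cases h : m i = 0
    · right; simp [h]
    · left
      have h1 : m - Finsupp.single i 1 + Finsupp.single i 1 = m := by
        refine tsub_add_cancel_of_le ?_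
        rw [Finsupp.single_le_iff]
        omega
      have h2 := congrArg Finsupp.degree h1
      rw [map_add, Finsupp.degree_single] at h2
      have h3 : (m.degree : ℤ) ≤ k := hm
      change ((m - Finsupp.single i 1).degree : ℤ) ≤ k - 1
      omega

theorem fderiv_mem_polyFun {k : ℤ} {f : E d → ℝ} (hf : f ∈ polyFun d k) (v : E d) :
    (fun x => fderiv ℝ f x v) ∈ polyFun d (k - 1) := by
  obtain ⟨P, hP, rfl⟩ := mem_polyFun_iff.1 hf
  have : (fun x => fderiv ℝ (evalPoly d P) x v) =
      ∑ i, v i • evalPoly d (MvPolynomial.pderiv i P) := by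
    funext x
    rw [(hasFDerivAt_evalPoly P x).fderiv]
    simp [mul_comm]
  rw [this]
  exact Submodule.sum_mem _ fun i _ => Submodule.smul_mem _ _
    (mem_polyFun_iff.2 ⟨_, pderiv_mem_restrictSupport i hP, rfl⟩)

theorem inner_gradient (f : E d → ℝ) (x v : E d) : inner ℝ (∇ f x) v = fderiv ℝ f x v := by
  rw [gradient, InnerProductSpace.toDual_symm_apply]

theorem norm_gradient (f : E d → ℝ) (x : E d) : ‖∇ f x‖ = ‖fderiv ℝ f x‖ := by
  rw [gradient, LinearIsometryEquiv.norm_map]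

theorem contDiff_gradient {f : E d → ℝ} (hf : ContDiff ℝ ∞ f) : ContDiff ℝ 1 (∇ f) := by
  have h : ContDiff ℝ 1 (fderiv ℝ f) := hf.fderiv_right (by norm_cast)
  exact (InnerProductSpace.toDual ℝ (E d)).symm.contDiff.comp h

theorem laplacian_eq_divg {f : E d → ℝ} (hf : ContDiff ℝ ∞ f) : Δ f = divg (∇ f) := by
  rw [laplacian_eq_iteratedFDeriv_orthonormalBasis f (EuclideanSpace.basisFun (Fin d) ℝ)]
  funext x
  refine Finset.sum_congr rfl fun i _ => ?_
  have h : DifferentiableAt ℝ (fderiv ℝ f) x :=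
    (hf.fderiv_right (m := 1) (by norm_cast)).differentiable (by simp) x
  have h1 : HasFDerivAt (∇ f) _ x :=
    ((InnerProductSpace.toDual ℝ (E d)).symm.toContinuousLinearEquiv.hasFDerivAt.comp x
      h.hasFDerivAt)
  rw [h1.fderiv, iteratedFDeriv_two_apply]
  have e : ∀ w : E d, w i = inner ℝ w (EuclideanSpace.single i (1 : ℝ)) := by
    intro w; simp [EuclideanSpace.inner_single_right]
  rw [e]
  simp [InnerProductSpace.toDual_symm_apply]

theorem laplacian_mem_polyFun {k : ℤ} {f : E d → ℝ} (hf : f ∈ polyFun d k) :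
    Δ f ∈ polyFun d (k - 2) := by
  have : Δ f = ∑ i, fun x => fderiv ℝ (fun y => fderiv ℝ f y (EuclideanSpace.single i 1)) x
      (EuclideanSpace.single i 1) := by
    rw [laplacian_eq_iteratedFDeriv_orthonormalBasis f (EuclideanSpace.basisFun (Fin d) ℝ)]
    funext x
    rw [Finset.sum_apply]
    refine Finset.sum_congr rfl fun i _ => ?_
    have h : DifferentiableAt ℝ (fderiv ℝ f) x :=
      ((contDiff_of_mem_polyFun hf (n := ∞)).fderiv_right (m := 1) (by norm_cast)).differentiable
        (by simp) x
    rw [iteratedFDeriv_two_apply, fderiv_clm_apply h (differentiableAt_const _)]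
    simp
  rw [this]
  refine Submodule.sum_mem _ fun i _ => ?_
  have := fderiv_mem_polyFun (fderiv_mem_polyFun hf (EuclideanSpace.single i 1))
    (EuclideanSpace.single i 1)
  rwa [sub_sub] at this

/-- Continuity upgrades the almost-everywhere identity to the interior, and the identity theorem for
analytic functions extends it to the whole space. -/
theorem eq_zero_of_mem_polyFun {k : ℤ} {f : E d → ℝ} (hf : f ∈ polyFun d k) {s : Set (E d)}
    (hs : (interior s).Nonempty) (h0 : f =ᵐ[volume.restrict s] 0) : f = 0 := by
  obtain ⟨z, hz⟩ := hs
  have h1 : f =ᵐ[volume.restrict (interior s)] 0 := ae_restrict_of_ae_restrict_of_subset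
    interior_subset h0
  have h2 : EqOn f 0 (interior s) := Measure.eqOn_open_of_ae_eq h1 isOpen_interior
    (continuous_of_mem_polyFun hf).continuousOn continuousOn_const
  have h3 : f =ᶠ[nhds z] 0 := Filter.eventuallyEq_of_mem (isOpen_interior.mem_nhds hz) h2
  exact AnalyticOnNhd.eq_of_eventuallyEq (analyticOnNhd_of_mem_polyFun hf)
    (fun _ _ => analyticAt_const) h3

theorem eq_const_of_fderiv_eq_zero {k : ℤ} {f : E d → ℝ} (hf : f ∈ polyFun d k)
    (h : ∀ x, fderiv ℝ f x = 0) : ∃ c, f = fun _ => c :=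
  ⟨f 0, funext fun x => is_const_of_fderiv_eq_zero
    ((contDiff_of_mem_polyFun hf (n := 1)).differentiable (by simp)) h x 0⟩

theorem IsSimplex.interior_nonempty {K : Finset (E d)} (hK : IsSimplex K) :
    (interior (hull K)).Nonempty := by
  rw [hull, interior_convexHull_nonempty_iff_affineSpan_eq_top]
  have h := hK.indep.affineSpan_eq_top_iff_card_eq_finrank_add_one.2 (by
    rw [Fintype.card_coe, hK.card_eq, finrank_euclideanSpace_fin])
  rw [Subtype.range_coe_subtype] at h
  exact h

theorem IsSimplex.eq_zero_of_ae {K : Finset (E d)} (hK : IsSimplex K) {k : ℤ} {f : E d → ℝ}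
    (hf : f ∈ polyFun d k) (h0 : f =ᵐ[volume.restrict (hull K)] 0) : f = 0 :=
  eq_zero_of_mem_polyFun hf hK.interior_nonempty h0

end HHO

namespace HHO

variable {d : ℕ}

/-! ### Geometry of the mesh -/

/-- By Krein–Milman the hull is generated by its extreme points. A vertex that was not extreme would
lie in the hull of the other vertices, against affine independence. Consequently the hull determines
its vertex set. -/
theorem extremePoints_hull {A : Finset (E d)}
    (hA : AffineIndependent ℝ (fun x : A => (x : E d))) :
    (hull A).extremePoints ℝ = A := by
  have h1 : (hull A).extremePoints ℝ ⊆ A := extremePoints_convexHull_subset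
  refine h1.antisymm fun x hx => ?_
  have h2 := closure_convexHull_extremePoints (isCompact_hull A) (convex_hull A)
  have h3 : IsClosed (convexHull ℝ ((hull A).extremePoints ℝ)) :=
    ((A.finite_toSet.subset h1).isCompact_convexHull ℝ).isClosed
  rw [h3.closure_eq] at h2
  by_contra hne
  refine hA.notMem_affineSpan_finset_erase hx ?_
  have h4 : x ∈ convexHull ℝ ((hull A).extremePoints ℝ) := by
    rw [h2]; exact mem_hull_of_mem hx
  refine affineSpan_mono ℝ ?_ (convexHull_subset_affineSpan _ h4)
  intro y hy
  rw [Finset.coe_erase]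
  exact ⟨h1 hy, fun h => hne (h ▸ hy)⟩

theorem eq_of_hull_eq {A B : Finset (E d)}
    (hA : AffineIndependent ℝ (fun x : A => (x : E d)))
    (hB : AffineIndependent ℝ (fun x : B => (x : E d))) (h : hull A = hull B) : A = B := by
  rw [← Finset.coe_inj, ← extremePoints_hull hA, ← extremePoints_hull hB, h]

namespace IsSimplex

variable {K : Finset (E d)}

theorem hull_inter (hK : IsSimplex K) {A B : Finset (E d)} (hA : A ⊆ K) (hB : B ⊆ K) :
    hull A ∩ hull B = hull (A ∩ B) := by
  rw [hull, hull, hull, Finset.coe_inter, hK.indep.convexHull_inter hA hB]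

theorem volume_hull_eq_zero (hK : IsSimplex K) {A : Finset (E d)} (hA : A ⊂ K) :
    volume (hull A) = 0 := by
  obtain ⟨a, ha, haA⟩ := Finset.exists_of_ssubset hA
  refine measure_mono_null ?_ (Measure.addHaar_affineSubspace volume
    (affineSpan ℝ (K.erase a : Set (E d))) ?_)
  · refine (hull_mono ?_).trans (convexHull_subset_affineSpan _)
    exact Finset.subset_erase.2 ⟨hA.1, haA⟩
  · intro h
    exact hK.notMem_affineSpan_erase ha (h ▸ AffineSubspace.mem_top ℝ _ a)

/-- In hyperplane coordinates G lies in an affine subspace, which is proper because it misses a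
vertex of F that is not in G. -/
theorem surface_hull_eq_zero (hK : IsSimplex K) (hd : 0 < d) {F G : Finset (E d)}
    (hF : F ∈ facets K) (hG : G ⊂ F) : (μHE[d - 1] : Measure (E d)) (hull G) = 0 := by
  obtain ⟨a, ha, rfl⟩ := (mem_facets_iff hK.card_eq).1 hF
  obtain ⟨h, -, hn, hH, hh⟩ := hK.exists_height hd ha
  have hmp := hK.setIntegral_facet hd ha hn hH hh
  have h1 := hmp.measure_preimage (measurableSet_hull G).nullMeasurableSet
  rw [Measure.restrict_apply (measurableSet_hull G), inter_eq_left.2 (hull_mono hG.1)] at h1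
  rw [← h1]
  refine nonpos_iff_eq_zero.1 ((Measure.restrict_apply_le _ _).trans (le_of_eq ?_))
  obtain ⟨b, hb, hbG⟩ := Finset.exists_of_ssubset hG
  set H := vectorSpan ℝ (K.erase a : Set (E d))
  let f : H →ᵃ[ℝ] E d := H.subtype.toAffineMap +
    AffineMap.const ℝ H (a + h • outerNormal K (K.erase a))
  have hf : ∀ z : H, f z = a + ((z : E d) + h • outerNormal K (K.erase a)) := by
    intro z
    simp only [f, AffineMap.coe_add, Pi.add_apply, LinearMap.coe_toAffineMap,
      Submodule.coe_subtype, AffineMap.const_apply]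
    abel
  refine measure_mono_null ?_ (Measure.addHaar_affineSubspace volume
    ((affineSpan ℝ (G : Set (E d))).comap f) ?_)
  · intro z hz
    rw [SetLike.mem_coe, AffineSubspace.mem_comap, hf]
    exact convexHull_subset_affineSpan _ hz
  · intro htop
    have h2 : (⟨_, sub_sub_height_mem hn hH hh (mem_hull_of_mem hb)⟩ : H) ∈
        (affineSpan ℝ (G : Set (E d))).comap f := htop ▸ AffineSubspace.mem_top ℝ _ _
    rw [AffineSubspace.mem_comap, hf] at h2
    have h3 : a + (b - a - h • outerNormal K (K.erase a) + h • outerNormal K (K.erase a)) = b := by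
      abel
    have h4 : b ∈ affineSpan ℝ (G : Set (E d)) := by
      rw [← h3]; exact h2
    refine hK.notMem_affineSpan_erase (Finset.mem_of_mem_erase hb) (affineSpan_mono ℝ ?_ h4)
    exact Finset.coe_subset.2 (Finset.subset_erase.2 ⟨hG.1.trans (Finset.erase_subset _ _), hbG⟩)

end IsSimplex

namespace SimplicialMesh

variable {Ω : Set (E d)} (M : SimplicialMesh Ω)

theorem hull_subset_closure {K : Finset (E d)} (hK : K ∈ M.cells) : hull K ⊆ closure Ω := by
  rw [← M.cover]
  exact subset_biUnion_of_mem (u := fun K => hull K) hK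

theorem interior_hull_subset (hreg : interior (closure Ω) = Ω) {K : Finset (E d)}
    (hK : K ∈ M.cells) : interior (hull K) ⊆ Ω := by
  conv_rhs => rw [← hreg]
  exact interior_mono (M.hull_subset_closure hK)

/-- Regularity of Ω puts the interior of each cell inside Ω, so only the frontier can escape, and
the frontier of a convex set is null. This lets integrals over a cell ignore the restriction to Ω.
-/
theorem hull_diff_null (hreg : interior (closure Ω) = Ω) {K : Finset (E d)}
    (hK : K ∈ M.cells) : volume (hull K \ Ω) = 0 := by
  refine measure_mono_null ?_ ((convex_hull K).addHaar_frontier volume)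
  rintro x ⟨hx, hxΩ⟩
  exact ⟨subset_closure hx, fun h => hxΩ (M.interior_hull_subset hreg hK h)⟩

theorem restrict_hull (hreg : interior (closure Ω) = Ω) {K : Finset (E d)}
    (hK : K ∈ M.cells) : (vol Ω).restrict (hull K) = volume.restrict (hull K) := by
  rw [Measure.restrict_restrict (measurableSet_hull K)]
  refine Measure.restrict_congr_set ?_
  refine Filter.EventuallyLE.antisymm (Filter.Eventually.of_forall fun x hx => hx.1) ?_
  rw [ae_le_set, sdiff_self_inter]
  exact M.hull_diff_null hreg hK

theorem cellInt_eq (hreg : interior (closure Ω) = Ω) {K : Finset (E d)}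
    (hK : K ∈ M.cells) (g : E d → ℝ) : cellInt Ω K g = ∫ x in hull K, g x := by
  rw [cellInt, M.restrict_hull hreg hK]

/-- The mesh axiom places the common vertices in the first cell only. Applying it in both orders
gives two vertex sets with the same hull, which therefore coincide. -/
theorem exists_inter_eq {K K' : Finset (E d)} (hK : K ∈ M.cells) (hK' : K' ∈ M.cells) :
    ∃ A, A ⊆ K ∧ A ⊆ K' ∧ hull K ∩ hull K' = hull A := by
  obtain ⟨A, hA, h⟩ := M.matching K hK K' hK'
  obtain ⟨A', hA', h'⟩ := M.matching K' hK' K hK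
  have : A = A' := eq_of_hull_eq ((M.isSimplex hK).indep_subset hA)
    ((M.isSimplex hK').indep_subset hA') (by rw [← h, ← h', inter_comm])
  exact ⟨A, hA, this ▸ hA', h⟩

theorem volume_inter_eq_zero {K K' : Finset (E d)} (hK : K ∈ M.cells) (hK' : K' ∈ M.cells)
    (hne : K ≠ K') : volume (hull K ∩ hull K') = 0 := by
  obtain ⟨A, hA, hA', h⟩ := M.exists_inter_eq hK hK'
  rw [h]
  refine (M.isSimplex hK).volume_hull_eq_zero (hA.ssubset_of_ne ?_)
  rintro rfl
  exact hne (Finset.eq_of_subset_of_card_le hA' (by rw [M.card_eq _ hK, M.card_eq _ hK']))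

/-- A common point lies in the shared subsimplex of the two cells. Intersecting vertex sets inside
one simplex at a time shows that it lies in the hull of F ∩ F', a proper subset of the vertices of
F. -/
theorem surface_inter_eq_zero (hd : 0 < d) {F F' : Finset (E d)} (hF : F ∈ M.faces)
    (hF' : F' ∈ M.faces) (hne : F ≠ F') :
    (μHE[d - 1] : Measure (E d)) (hull F ∩ hull F') = 0 := by
  classical
  obtain ⟨K, hK, hFK⟩ := hF
  obtain ⟨K', hK', hFK'⟩ := hF'
  obtain ⟨A, hA, hA', h⟩ := M.exists_inter_eq hK hK'
  have hF1 := Finset.mem_powersetCard.1 hFK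
  have hF2 := Finset.mem_powersetCard.1 hFK'
  have hG : F ∩ F' ⊂ F := by
    refine Finset.inter_subset_left.ssubset_of_ne fun he => hne ?_
    exact Finset.eq_of_subset_of_card_le (Finset.inter_eq_left.1 he) (by rw [hF1.2, hF2.2])
  refine measure_mono_null ?_ ((M.isSimplex hK).surface_hull_eq_zero hd hFK hG)
  rintro x ⟨hx, hx'⟩
  have hxA : x ∈ hull A := h ▸ ⟨hull_mono hF1.1 hx, hull_mono hF2.1 hx'⟩
  have h1 : x ∈ hull (F ∩ A) := (M.isSimplex hK).hull_inter hF1.1 hA ▸ ⟨hx, hxA⟩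
  have h2 : x ∈ hull (F' ∩ A) := (M.isSimplex hK').hull_inter hF2.1 hA' ▸ ⟨hx', hxA⟩
  have h3 : x ∈ hull ((F ∩ A) ∩ (F' ∩ A)) := (M.isSimplex hK).hull_inter
    (Finset.inter_subset_right.trans hA) (Finset.inter_subset_right.trans hA) ▸ ⟨h1, h2⟩
  refine hull_mono ?_ h3
  intro y
  simp only [Finset.mem_inter]
  tauto

theorem finite_faces : M.faces.Finite := by
  refine (M.cells.finite_toSet.biUnion fun K _ => (facets K).finite_toSet).subset ?_
  rintro F ⟨K, hK, hF⟩
  exact mem_biUnion hK hF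

theorem hull_subset_skeleton {F : Finset (E d)} (hF : F ∈ M.faces) : hull F ⊆ M.skeleton :=
  subset_biUnion_of_mem (u := fun F => hull F) hF

theorem measurableSet_skeleton : MeasurableSet M.skeleton :=
  M.finite_faces.measurableSet_biUnion fun F _ => measurableSet_hull F

theorem surf_restrict_hull {F : Finset (E d)} (hF : F ∈ M.faces) :
    M.surf.restrict (hull F) = (μHE[d - 1] : Measure (E d)).restrict (hull F) := by
  rw [Measure.restrict_restrict (measurableSet_hull F),
    inter_eq_left.2 (M.hull_subset_skeleton hF)]

theorem faceInt_eq {F : Finset (E d)} (hF : F ∈ M.faces) (g : E d → ℝ) :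
    M.faceInt F g = ∫ x in hull F, g x ∂μHE[d - 1] := by
  rw [faceInt, M.surf_restrict_hull hF]

theorem isFiniteMeasure_surf (hd : 0 < d) : IsFiniteMeasure M.surf := by
  refine ⟨?_⟩
  rw [Measure.restrict_apply_univ]
  refine (measure_biUnion_lt_top M.finite_faces ?_)
  rintro F ⟨K, hK, hF⟩
  exact (M.isSimplex hK).surface_lt_top hd hF

theorem isFiniteMeasure_vol (M : SimplicialMesh Ω) : IsFiniteMeasure (vol Ω) := by
  refine ⟨?_⟩
  rw [Measure.restrict_apply_univ]
  have h : IsCompact (⋃ K ∈ M.cells, hull K) :=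
    M.cells.isCompact_biUnion fun K _ => isCompact_hull K
  exact (measure_mono (subset_closure.trans M.cover.ge)).trans_lt h.measure_lt_top

/-- A boundary face does not meet the open set `Ω`. -/
theorem boundaryFace_inter_eq_empty (hd : 0 < d) (hΩ : IsOpen Ω) {F : Finset (E d)}
    (hF : F ∈ M.boundaryFaces) : hull F ∩ Ω = ∅ := by
  classical
  obtain ⟨⟨K, hK, hFK⟩, hFi⟩ := hF
  have hKs := M.isSimplex hK
  by_contra hne
  obtain ⟨x₀, hx₀F, hx₀Ω⟩ := nonempty_iff_ne_empty.2 hne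
  have hd' : (0 : ℝ) < d := by exact_mod_cast hd
  have hFK' := Finset.mem_powersetCard.1 hFK
  have hFne : F.Nonempty := by rw [← Finset.card_pos, hFK'.2]; exact hd
  set c := F.centroid ℝ id with hc
  have hcF : c ∈ hull F := Finset.centroid_mem_convexHull F hFne
  -- The height over `b` is zero at `b` and equals h on the facet opposite to `b`. Height below h
  -- thus means a positive barycentric coordinate at `b`.
  have hlt : ∀ b ∈ F, ∀ x ∈ hull F, ∀ h : ℝ, 0 < h →
      (∀ y ∈ hull (K.erase b), inner ℝ (outerNormal K (K.erase b)) (y - b) = h) →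
      inner ℝ (outerNormal K (K.erase b)) (x - b) ≤ h := by
    intro b hb x hx h hpos hh
    obtain ⟨y, hy, t, h0, h1, rfl⟩ :=
      (hKs.mem_hull_iff_cone hd (hFK'.1 hb)).1 (hull_mono hFK'.1 hx)
    rw [add_sub_cancel_left, real_inner_smul_right, hh y hy]
    nlinarith
  -- At the barycentre of F the inequality is strict, since the vertex `b` itself contributes height
  -- zero to the average.
  have hcb : ∀ b ∈ F, ∀ h : ℝ, 0 < h →
      (∀ y ∈ hull (K.erase b), inner ℝ (outerNormal K (K.erase b)) (y - b) = h) →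
      inner ℝ (outerNormal K (K.erase b)) (c - b) < h := by
    intro b hb h hpos hh
    have e1 : (d : ℝ) • (c - b) = ∑ v ∈ F, (v - b) := by
      rw [Finset.sum_sub_distrib, Finset.sum_const, hFK'.2, hc, finset_centroid_eq F hFne, hFK'.2,
        smul_sub, smul_inv_smul₀ hd'.ne', Nat.cast_smul_eq_nsmul]
    have e2 : d * inner ℝ (outerNormal K (K.erase b)) (c - b) =
        ∑ v ∈ F, inner ℝ (outerNormal K (K.erase b)) (v - b) := by
      rw [← real_inner_smul_right, e1, inner_sum]
    have e3 : ∑ v ∈ F, inner ℝ (outerNormal K (K.erase b)) (v - b) < ∑ v ∈ F, h := by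
      refine Finset.sum_lt_sum (fun v hv => hlt b hb v (mem_hull_of_mem hv) h hpos hh)
        ⟨b, hb, by simpa using hpos⟩
    rw [← e2, Finset.sum_const, hFK'.2, nsmul_eq_mul] at e3
    exact lt_of_mul_lt_mul_left e3 hd'.le
  obtain ⟨a, ha, rfl⟩ := (mem_facets_iff hKs.card_eq).1 hFK
  obtain ⟨ha1, hapos, han, -, hah⟩ := hKs.exists_height hd ha
  -- a point of the face inside `Ω` with positive barycentric coordinates
  obtain ⟨x, hxF, hxΩ, hxb⟩ : ∃ x ∈ hull (K.erase a), x ∈ Ω ∧ ∀ b ∈ K.erase a,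
      x ∉ hull (K.erase b) := by
    have hcont : Filter.Tendsto (fun ε : ℝ => x₀ + ε • (c - x₀)) (nhdsWithin 0 (Ioi 0))
        (nhds x₀) := by
      have : Continuous (fun ε : ℝ => x₀ + ε • (c - x₀)) := by fun_prop
      have h1 := this.tendsto 0
      simp only [zero_smul, add_zero] at h1
      exact h1.mono_left nhdsWithin_le_nhds
    have h1 : ∀ᶠ ε : ℝ in nhdsWithin 0 (Ioi 0), ε ∈ Ioo (0 : ℝ) 1 := Ioo_mem_nhdsGT one_pos
    obtain ⟨ε, hε, hεΩ⟩ := (h1.and (hcont.eventually (hΩ.mem_nhds hx₀Ω))).exists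
    refine ⟨_, (convex_hull _).add_smul_sub_mem hx₀F hcF ⟨hε.1.le, hε.2.le⟩, hεΩ, ?_⟩
    intro b hb hxb
    obtain ⟨h, hpos, -, -, hh⟩ := hKs.exists_height hd (Finset.mem_of_mem_erase hb)
    have e1 := hh _ hxb
    have e2 : x₀ + ε • (c - x₀) - b = (1 - ε) • (x₀ - b) + ε • (c - b) := by module
    rw [e2, inner_add_right, real_inner_smul_right, real_inner_smul_right] at e1
    have e3 := hlt b hb x₀ hx₀F h hpos hh
    have e4 := hcb b hb h hpos hh
    nlinarith [hε.1, hε.2]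
  -- leaving `K` through that point leads into another cell
  set n := outerNormal K (K.erase a)
  have hclosed : IsClosed (⋃ K' ∈ M.cells.erase K, hull K') :=
    ((M.cells.erase K).isCompact_biUnion fun K _ => isCompact_hull K).isClosed
  have htend : Filter.Tendsto (fun t : ℝ => x + t • n) (nhdsWithin 0 (Ioi 0)) (nhds x) := by
    have : Continuous (fun t : ℝ => x + t • n) := by fun_prop
    have h1 := this.tendsto 0
    simp only [zero_smul, add_zero] at h1
    exact h1.mono_left nhdsWithin_le_nhds
  have hmem : x ∈ ⋃ K' ∈ M.cells.erase K, hull K' := by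
    refine hclosed.mem_of_tendsto htend ?_
    filter_upwards [htend.eventually (hΩ.mem_nhds hxΩ), self_mem_nhdsWithin] with t ht htpos
    have h1 : x + t • n ∈ ⋃ K ∈ M.cells, hull K := M.cover ▸ subset_closure ht
    simp only [mem_iUnion] at h1 ⊢
    obtain ⟨K', hK', hx'⟩ := h1
    refine ⟨K', Finset.mem_erase.2 ⟨?_, hK'⟩, hx'⟩
    -- Points of K have height over `a` at most that of F, whereas x + t n lies strictly higher.
    rintro rfl
    obtain ⟨y, hy, s, h0, h1, he⟩ := (hKs.mem_hull_iff_cone hd ha).1 hx'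
    have e1 : inner ℝ n (x + t • n - a) = inner ℝ n (s • (y - a)) := by rw [he]; congr 1; abel
    have e2 : x + t • n - a = (x - a) + t • n := by abel
    rw [e2, inner_add_right, hah x hxF, real_inner_smul_right, real_inner_smul_right, hah y hy,
      real_inner_self_eq_norm_mul_norm, han] at e1
    have htpos' : 0 < t := htpos
    nlinarith
  simp only [mem_iUnion] at hmem
  obtain ⟨K', hK', hxK'⟩ := hmem
  obtain ⟨hne', hK'⟩ := Finset.mem_erase.1 hK'
  obtain ⟨A, hA, hA', h⟩ := M.exists_inter_eq hK hK'
  have hxA : x ∈ hull A := h ▸ ⟨hull_mono (Finset.erase_subset _ _) hxF, hxK'⟩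
  -- Since x is on no facet opposite to a vertex of F, a set of vertices of K whose hull contains x
  -- must contain all of F. So F is also a facet of the other cell, which a boundary face cannot be.
  have hFA : K.erase a ⊆ A := by
    intro b hb
    by_contra hbA
    exact hxb b hb (hull_mono (Finset.subset_erase.2 ⟨hA, hbA⟩) hxA)
  exact hFi ⟨K, hK, K', hK', hne'.symm, hFK,
    Finset.mem_powersetCard.2 ⟨hFA.trans hA', hFK'.2⟩⟩

theorem ae_vol_mem_cells (hΩ : IsOpen Ω) : ∀ᵐ x ∂(vol Ω), x ∈ ⋃ K ∈ M.cells, hull K :=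
  (ae_restrict_iff' hΩ.measurableSet).2 (ae_of_all _ fun _ hx => M.cover ▸ subset_closure hx)

theorem ae_surf_mem_faces : ∀ᵐ x ∂M.surf, x ∈ ⋃ F ∈ M.faces, hull F :=
  ae_restrict_mem M.measurableSet_skeleton

theorem integral_vol_eq_sum (hΩ : IsOpen Ω) {f : E d → ℝ} (hf : Integrable f (vol Ω)) :
    ∫ x in Ω, f x = ∑ K ∈ M.cells, cellInt Ω K f := by
  have h := hasSum_integral_iUnion_ae (μ := vol Ω) (f := f) (s := fun K : M.cells => hull K.1)
    (fun K => (measurableSet_hull _).nullMeasurableSet) ?_ hf.integrableOn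
  · have h1 := h.unique (hasSum_fintype _)
    have h2 : (⋃ K : M.cells, hull K.1) =ᵐ[vol Ω] univ := by
      rw [ae_eq_univ]
      have h3 := M.ae_vol_mem_cells hΩ
      rw [ae_iff] at h3
      rw [iUnion_subtype]
      exact h3
    rw [setIntegral_congr_set h2, setIntegral_univ] at h1
    rw [h1, ← Finset.sum_coe_sort M.cells]
    rfl
  · intro K K' hne
    refine nonpos_iff_eq_zero.1 ((Measure.restrict_apply_le _ _).trans (le_of_eq ?_))
    exact M.volume_inter_eq_zero K.2 K'.2 fun h => hne (Subtype.ext h)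

end SimplicialMesh
end HHO

namespace HHO

/-! ### Continuous functionals on `L²` -/

section L2

variable {X : Type*} [MeasurableSpace X] {μ : Measure X} {F : Type*} [NormedAddCommGroup F]
  [InnerProductSpace ℝ F]

theorem integrable_inner_of_memLp {f g : X → F} (hf : MemLp f 2 μ) (hg : MemLp g 2 μ) :
    Integrable (fun x => inner ℝ (f x) (g x)) μ := by
  refine (L2.integrable_inner (𝕜 := ℝ) (hf.toLp f) (hg.toLp g)).congr ?_
  filter_upwards [hf.coeFn_toLp, hg.coeFn_toLp] with x h1 h2
  rw [h1, h2]

theorem L2_norm_sq_eq_integral (f : Lp F 2 μ) : ‖f‖ ^ 2 = ∫ x, ‖f x‖ ^ 2 ∂μ := by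
  rw [← real_inner_self_eq_norm_sq, L2.inner_def]
  simp_rw [real_inner_self_eq_norm_sq]

theorem continuous_setIntegral_inner (S : Set X) {g : X → F} (hg : MemLp g 2 (μ.restrict S)) :
    Continuous fun f : Lp F 2 μ => ∫ x in S, inner ℝ (f x) (g x) ∂μ := by
  have h : (fun f : Lp F 2 μ => ∫ x in S, inner ℝ (f x) (g x) ∂μ) =
      fun f => inner ℝ (LpToLpRestrictCLM X F ℝ μ 2 S f) (hg.toLp g) := by
    funext f
    rw [L2.inner_def]
    refine integral_congr_ae ?_
    filter_upwards [LpToLpRestrictCLM_coeFn ℝ S f, hg.coeFn_toLp] with x h1 h2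
    rw [h1, h2]
  rw [h]
  fun_prop

theorem continuous_setIntegral_norm_sub_sq (S : Set X) {g : X → F}
    (hg : MemLp g 2 (μ.restrict S)) :
    Continuous fun f : Lp F 2 μ => ∫ x in S, ‖f x - g x‖ ^ 2 ∂μ := by
  have h : (fun f : Lp F 2 μ => ∫ x in S, ‖f x - g x‖ ^ 2 ∂μ) =
      fun f => ‖LpToLpRestrictCLM X F ℝ μ 2 S f - hg.toLp g‖ ^ 2 := by
    funext f
    rw [L2_norm_sq_eq_integral]
    refine integral_congr_ae ?_
    filter_upwards [LpToLpRestrictCLM_coeFn ℝ S f, hg.coeFn_toLp,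
      Lp.coeFn_sub (LpToLpRestrictCLM X F ℝ μ 2 S f) (hg.toLp g)] with x h1 h2 h3
    rw [h3, Pi.sub_apply, h1, h2]
  rw [h]
  fun_prop

/-- Overlaps only increase the right side, so the pieces need not be disjoint; interfaces may be
counted once for each adjacent cell. -/
theorem integral_le_sum_of_ae_mem {ι : Type*} (t : Finset ι) {S : ι → Set X}
    (hS : ∀ i ∈ t, MeasurableSet (S i)) (hcov : ∀ᵐ x ∂μ, ∃ i ∈ t, x ∈ S i) {f : X → ℝ}
    (hf : Integrable f μ) (hf0 : ∀ x, 0 ≤ f x) :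
    ∫ x, f x ∂μ ≤ ∑ i ∈ t, ∫ x in S i, f x ∂μ := by
  have h1 : ∑ i ∈ t, ∫ x in S i, f x ∂μ = ∫ x, ∑ i ∈ t, (S i).indicator f x ∂μ := by
    rw [integral_finsetSum _ fun i hi => hf.indicator (hS i hi)]
    exact Finset.sum_congr rfl fun i hi => (integral_indicator (hS i hi)).symm
  rw [h1]
  refine integral_mono_ae hf (integrable_finsetSum _ fun i hi => hf.indicator (hS i hi)) ?_
  filter_upwards [hcov] with x ⟨i, hi, hx⟩
  rw [← indicator_of_mem hx f]
  exact Finset.single_le_sum (f := fun i => (S i).indicator f x)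
    (fun j _ => indicator_nonneg (fun y _ => hf0 y) x) hi

end L2

variable {d : ℕ}

theorem memLp_of_continuous {F : Type*} [NormedAddCommGroup F] {μ : Measure (E d)}
    {A : Finset (E d)} [IsFiniteMeasure (μ.restrict (hull A))] {g : E d → F} {p : ℝ≥0∞}
    (hg : Continuous g) : MemLp g p (μ.restrict (hull A)) := by
  obtain ⟨C, hC⟩ := (isCompact_hull A).exists_bound_of_continuousOn hg.continuousOn
  refine MemLp.of_bound ?_ C ((ae_restrict_iff' (measurableSet_hull A)).2 (ae_of_all _ hC))
  exact hg.continuousOn.aestronglyMeasurable_of_subset_isCompact (isCompact_hull A)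
    (measurableSet_hull A) subset_rfl

theorem IsTest.memLp {Ω : Set (E d)} {φ : E d → ℝ} (hφ : IsTest Ω φ) {μ : Measure (E d)}
    [IsFiniteMeasure μ] {p : ℝ≥0∞} : MemLp φ p μ :=
  hφ.1.continuous.memLp_of_hasCompactSupport hφ.2.1

theorem gradient_add {φ ψ : E d → ℝ} (hφ : Differentiable ℝ φ) (hψ : Differentiable ℝ ψ) :
    ∇ (φ + ψ) = ∇ φ + ∇ ψ := by
  funext x
  simp only [gradient, Pi.add_apply]
  rw [fderiv_add (hφ x) (hψ x), map_add]

theorem gradient_sub {φ ψ : E d → ℝ} (hφ : Differentiable ℝ φ) (hψ : Differentiable ℝ ψ) :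
    ∇ (φ - ψ) = ∇ φ - ∇ ψ := by
  funext x
  simp only [gradient, Pi.sub_apply]
  rw [fderiv_sub (hφ x) (hψ x), map_sub]

theorem gradient_smul (c : ℝ) {φ : E d → ℝ} (hφ : Differentiable ℝ φ) :
    ∇ (c • φ) = c • ∇ φ := by
  funext x
  simp only [gradient, Pi.smul_apply]
  rw [fderiv_const_smul (hφ x), map_smul]

/-! ### The graph of the trace operator: Green's formula and facet bounds by density -/

namespace SimplicialMesh

variable {Ω : Set (E d)} (M : SimplicialMesh Ω)

instance isFiniteMeasure_surf' [NeZero d] : IsFiniteMeasure M.surf :=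
  M.isFiniteMeasure_surf (NeZero.pos d)

/-- The triples `(φ, ∇φ, φ|_Σ)` with `φ ∈ C_c^∞(Ω)`. -/
def testTriples : Submodule ℝ ((L2 Ω × L2vec Ω) × M.L2skel) where
  carrier := {z | ∃ φ : E d → ℝ, IsTest Ω φ ∧
      z.1.1 =ᵐ[vol Ω] φ ∧ z.1.2 =ᵐ[vol Ω] ∇ φ ∧ z.2 =ᵐ[M.surf] φ}
  zero_mem' := by
    refine ⟨0, IsTest.zero Ω, Lp.coeFn_zero ℝ 2 (vol Ω), ?_, Lp.coeFn_zero ℝ 2 M.surf⟩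
    have h : ∇ (0 : E d → ℝ) = 0 := by
      funext x
      exact gradient_const x (0 : ℝ)
    rw [h]
    exact Lp.coeFn_zero (E d) 2 (vol Ω)
  add_mem' := by
    rintro v w ⟨φ, hφ, h1, h2, h5⟩ ⟨ψ, hψ, h3, h4, h6⟩
    refine ⟨φ + ψ, hφ.add hψ, (Lp.coeFn_add v.1.1 w.1.1).trans (h1.add h3), ?_,
      (Lp.coeFn_add v.2 w.2).trans (h5.add h6)⟩
    rw [gradient_add (hφ.1.differentiable (by simp)) (hψ.1.differentiable (by simp))]
    exact (Lp.coeFn_add v.1.2 w.1.2).trans (h2.add h4)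
  smul_mem' := by
    rintro c v ⟨φ, hφ, h1, h2, h5⟩
    refine ⟨c • φ, hφ.smul c, (Lp.coeFn_smul c v.1.1).trans (h1.const_smul c), ?_,
      (Lp.coeFn_smul c v.2).trans (h5.const_smul c)⟩
    rw [gradient_smul c (hφ.1.differentiable (by simp))]
    exact (Lp.coeFn_smul c v.1.2).trans (h2.const_smul c)

/-- The closed graph `{(v, ∇v, v|_Σ)}` of the trace operator on `H^1_0(Ω)`. -/
def traceGraph : Submodule ℝ ((L2 Ω × L2vec Ω) × M.L2skel) := M.testTriples.topologicalClosure

variable {M}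

/-- The density principle: a closed condition on (v, ∇v, v|_Σ) need only be verified for test
functions, where classical calculus applies. -/
theorem traceGraph_induction {P : (L2 Ω × L2vec Ω) × M.L2skel → Prop} (hP : IsClosed {z | P z})
    (h : ∀ z (φ : E d → ℝ), IsTest Ω φ → z.1.1 =ᵐ[vol Ω] φ → z.1.2 =ᵐ[vol Ω] ∇ φ →
      z.2 =ᵐ[M.surf] φ → P z) {z : (L2 Ω × L2vec Ω) × M.L2skel} (hz : z ∈ M.traceGraph) : P z :=
  closure_minimal (s := (M.testTriples : Set ((L2 Ω × L2vec Ω) × M.L2skel)))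
    (fun z ⟨φ, h1, h2, h3, h4⟩ => h z φ h1 h2 h3 h4) hP hz

theorem facet_mem_faces {K F : Finset (E d)} (hK : K ∈ M.cells) (hF : F ∈ facets K) :
    F ∈ M.faces := ⟨K, hK, hF⟩

/-- Green's formula on a cell for functions in `H^1_0(Ω)`. -/
theorem green [NeZero d] [IsFiniteMeasure (vol Ω)] (hreg : interior (closure Ω) = Ω)
    {K : Finset (E d)} (hK : K ∈ M.cells) {X : E d → E d} (hX : ContDiff ℝ 1 X)
    {z : (L2 Ω × L2vec Ω) × M.L2skel} (hz : z ∈ M.traceGraph) :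
    cellInt Ω K (fun x => inner ℝ (z.1.2 x) (X x)) + cellInt Ω K (fun x => z.1.1 x * divg X x) =
      ∑ F ∈ facets K, M.faceInt F (fun x => z.2 x * inner ℝ (X x) (outerNormal K F)) := by
  have hdiv := continuous_divg hX
  have hXc := hX.continuous
  refine traceGraph_induction (P := fun z => cellInt Ω K (fun x => inner ℝ (z.1.2 x) (X x)) +
    cellInt Ω K (fun x => z.1.1 x * divg X x) =
      ∑ F ∈ facets K, M.faceInt F (fun x => z.2 x * inner ℝ (X x) (outerNormal K F))) ?_ ?_ hz
  · refine isClosed_eq (Continuous.add ?_ ?_) (continuous_finsetSum _ fun F hF => ?_)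
    · exact (continuous_setIntegral_inner (μ := vol Ω) (hull K) (memLp_of_continuous hXc)).comp
        (continuous_snd.comp continuous_fst)
    · have := (continuous_setIntegral_inner (μ := vol Ω) (hull K)
        (memLp_of_continuous hdiv)).comp
        (continuous_fst.comp (continuous_fst (X := L2 Ω × L2vec Ω) (Y := M.L2skel)))
      refine this.congr fun z => integral_congr_ae (ae_of_all _ fun x => ?_)
      simp [mul_comm]
    · have := (continuous_setIntegral_inner (μ := M.surf) (hull F)
        (memLp_of_continuous (g := fun x => inner ℝ (X x) (outerNormal K F)) (by fun_prop))).comp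
        (continuous_snd (X := L2 Ω × L2vec Ω) (Y := M.L2skel))
      refine this.congr fun z => integral_congr_ae (ae_of_all _ fun x => ?_)
      simp [mul_comm]
  · intro z φ hφ h1 h2 h3
    have hφ1 : ContDiff ℝ 1 φ := hφ.1.of_le (by norm_cast)
    have g := (M.isSimplex hK).setIntegral_green (NeZero.pos d) hX hφ1
    have hφc := hφ1.continuous
    have hφ' : Continuous (fderiv ℝ φ) := hφ1.continuous_fderiv (by simp)
    have hint : ∀ {g : E d → ℝ}, Continuous g → IntegrableOn g (hull K) := fun hg =>
      hg.continuousOn.integrableOn_compact (isCompact_hull K)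
    rw [integral_add (hint (by fun_prop)) (hint (by fun_prop))] at g
    have e1 : cellInt Ω K (fun x => inner ℝ (z.1.2 x) (X x)) =
        ∫ x in hull K, fderiv ℝ φ x (X x) := by
      rw [← M.cellInt_eq hreg hK]
      refine integral_congr_ae (ae_restrict_of_ae ?_)
      filter_upwards [h2] with x hx
      rw [hx, inner_gradient]
    have e2 : cellInt Ω K (fun x => z.1.1 x * divg X x) = ∫ x in hull K, φ x * divg X x := by
      rw [← M.cellInt_eq hreg hK]
      refine integral_congr_ae (ae_restrict_of_ae ?_)
      filter_upwards [h1] with x hx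
      rw [hx]
    rw [e1, e2, g]
    refine Finset.sum_congr rfl fun F hF => ?_
    rw [← M.faceInt_eq (facet_mem_faces hK hF)]
    refine integral_congr_ae (ae_restrict_of_ae ?_)
    filter_upwards [h3] with x hx
    rw [hx]

/-- This is the trace inequality for φ − q, passed to the closure. With q = 0 it bounds the trace
operator; with q a smooth representative of v on the cell it identifies the trace on the facet. -/
theorem exists_facet_bound [NeZero d] [IsFiniteMeasure (vol Ω)]
    (hreg : interior (closure Ω) = Ω) {K F : Finset (E d)} (hK : K ∈ M.cells)
    (hF : F ∈ facets K) :
    ∃ C : ℝ, 0 ≤ C ∧ ∀ z ∈ M.traceGraph, ∀ q : E d → ℝ, ContDiff ℝ ∞ q →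
      M.faceInt F (fun x => ‖z.2 x - q x‖ ^ 2) ≤
        C * (cellInt Ω K (fun x => ‖z.1.1 x - q x‖ ^ 2) +
          cellInt Ω K (fun x => ‖z.1.2 x - ∇ q x‖ ^ 2)) := by
  obtain ⟨C, hC0, hC⟩ := (M.isSimplex hK).exists_trace_inequality (NeZero.pos d) hF
  refine ⟨C, hC0, fun z hz q hq => ?_⟩
  have hqc := hq.continuous
  have hq' := (contDiff_gradient hq).continuous
  refine traceGraph_induction (P := fun z => M.faceInt F (fun x => ‖z.2 x - q x‖ ^ 2) ≤
        C * (cellInt Ω K (fun x => ‖z.1.1 x - q x‖ ^ 2) +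
          cellInt Ω K (fun x => ‖z.1.2 x - ∇ q x‖ ^ 2))) ?_ ?_ hz
  · refine isClosed_le ?_ (continuous_const.mul (Continuous.add ?_ ?_))
    · exact (continuous_setIntegral_norm_sub_sq (μ := M.surf) (hull F)
        (memLp_of_continuous hqc)).comp continuous_snd
    · exact (continuous_setIntegral_norm_sub_sq (μ := vol Ω) (hull K)
        (memLp_of_continuous hqc)).comp (continuous_fst.comp continuous_fst)
    · exact (continuous_setIntegral_norm_sub_sq (μ := vol Ω) (hull K)
        (memLp_of_continuous hq')).comp (continuous_snd.comp continuous_fst)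
  · intro z φ hφ h1 h2 h3
    have h := hC (fun x => φ x - q x) ((hφ.1.sub hq).of_le (by norm_cast))
    rw [← M.faceInt_eq (facet_mem_faces hK hF), ← M.cellInt_eq hreg hK,
      ← M.cellInt_eq hreg hK] at h
    have e1 : M.faceInt F (fun x => ‖z.2 x - q x‖ ^ 2) =
        M.faceInt F (fun x => (φ x - q x) ^ 2) := by
      refine integral_congr_ae (ae_restrict_of_ae ?_)
      filter_upwards [h3] with x hx
      simp [hx]
    have e2 : cellInt Ω K (fun x => ‖z.1.1 x - q x‖ ^ 2) =
        cellInt Ω K (fun x => (φ x - q x) ^ 2) := by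
      refine integral_congr_ae (ae_restrict_of_ae ?_)
      filter_upwards [h1] with x hx
      simp [hx]
    have e3 : cellInt Ω K (fun x => ‖z.1.2 x - ∇ q x‖ ^ 2) =
        cellInt Ω K (fun x => ‖fderiv ℝ (fun x => φ x - q x) x‖ ^ 2) := by
      refine integral_congr_ae (ae_restrict_of_ae ?_)
      filter_upwards [h2] with x hx
      change _ = ‖fderiv ℝ (φ - q) x‖ ^ 2
      rw [hx, ← norm_gradient, gradient_sub (hφ.1.differentiable (by simp))
        (hq.differentiable (by simp)), Pi.sub_apply]
    rw [e1, e2, e3]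
    exact h

end SimplicialMesh
end HHO

/-! ### Integration by parts on Ω, and existence and uniqueness of traces -/

namespace HHO

theorem ae_eq_of_integral_norm_sub_sq_le {X : Type*} [MeasurableSpace X] {μ : Measure X}
    {F : Type*} [NormedAddCommGroup F] {f g : X → F} (hf : MemLp f 2 μ) (hg : MemLp g 2 μ)
    (h : ∫ x, ‖f x - g x‖ ^ 2 ∂μ ≤ 0) : f =ᵐ[μ] g := by
  have hi : Integrable (fun x => ‖f x - g x‖ ^ 2) μ := (hf.sub hg).norm.integrable_sq
  have h0 := (integral_eq_zero_iff_of_nonneg (fun _ => sq_nonneg _) hi).1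
    (h.antisymm (integral_nonneg fun _ => sq_nonneg _))
  filter_upwards [h0] with x hx
  simpa [sub_eq_zero] using hx

variable {d : ℕ}

theorem integral_fderiv_eq_zero {f : E d → ℝ} (hf : ContDiff ℝ 1 f) (hc : HasCompactSupport f)
    (v : E d) : ∫ x, fderiv ℝ f x v = 0 := by
  have hf' : Continuous (fderiv ℝ f) := hf.continuous_fderiv (by simp)
  have hi1 : Integrable (fun x => fderiv ℝ f x v) :=
    Continuous.integrable_of_hasCompactSupport (by fun_prop)
      ((hc.fderiv ℝ).comp_left (g := fun L : E d →L[ℝ] ℝ => L v) rfl)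
  have h := integral_mul_fderiv_eq_neg_fderiv_mul_of_integrable (μ := volume) (f := f)
    (g := fun _ : E d => (1 : ℝ)) (v := v) (by simpa using hi1) (by simp)
    (by simpa using hf.continuous.integrable_of_hasCompactSupport hc)
    (fun x _ => hf.differentiable (by simp) x) (fun x _ => differentiableAt_const _)
  simpa using h.symm

theorem integral_divg_eq_zero {X : E d → E d} (hX : ContDiff ℝ 1 X) (hc : HasCompactSupport X) :
    ∫ x, divg X x = 0 := by
  have hXi : ∀ i, ContDiff ℝ 1 (fun x => X x i) := fun i => by fun_prop
  have hci : ∀ i, HasCompactSupport (fun x => X x i) := fun i =>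
    hc.comp_left (g := fun w : E d => w i) rfl
  have e : ∀ x, divg X x = ∑ i, fderiv ℝ (fun x => X x i) x (EuclideanSpace.single i 1) := fun x =>
    Finset.sum_congr rfl fun i _ => fderiv_apply_coord (hX.differentiable (by simp) x) _ _
  simp_rw [e]
  rw [integral_finsetSum]
  · exact Finset.sum_eq_zero fun i _ => integral_fderiv_eq_zero (hXi i) (hci i) _
  · intro i _
    have : Continuous (fderiv ℝ (fun x => X x i)) := (hXi i).continuous_fderiv (by simp)
    exact Continuous.integrable_of_hasCompactSupport (by fun_prop)
      (((hci i).fderiv ℝ).comp_left (g := fun L : E d →L[ℝ] ℝ => L (EuclideanSpace.single i 1)) rfl)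

theorem integral_green_eq_zero {φ : E d → ℝ} {X : E d → E d} (hφ : ContDiff ℝ 1 φ)
    (hX : ContDiff ℝ 1 X) (hc : HasCompactSupport fun x => φ x • X x) :
    ∫ x, (fderiv ℝ φ x (X x) + φ x * divg X x) = 0 := by
  rw [← integral_divg_eq_zero (hφ.smul hX) hc]
  exact integral_congr_ae (ae_of_all _ fun x =>
    (divg_smul (hφ.differentiable (by simp) x) (hX.differentiable (by simp) x)).symm)

namespace SimplicialMesh

variable {Ω : Set (E d)} {M : SimplicialMesh Ω}

theorem memLp_vol (M : SimplicialMesh Ω) [IsFiniteMeasure (vol Ω)] {F : Type*}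
    [NormedAddCommGroup F] {g : E d → F} {p : ℝ≥0∞} (hΩ : IsOpen Ω) (hg : Continuous g) :
    MemLp g p (vol Ω) := by
  have hcomp : IsCompact (closure Ω) := by
    rw [← M.cover]
    exact M.cells.isCompact_biUnion fun K _ => isCompact_hull K
  obtain ⟨C, hC⟩ := hcomp.exists_bound_of_continuousOn hg.continuousOn
  refine MemLp.of_bound ?_ C ((ae_restrict_iff' hΩ.measurableSet).2
    (ae_of_all _ fun x hx => hC x (subset_closure hx)))
  exact hg.continuousOn.aestronglyMeasurable_of_subset_isCompact hcomp
    hΩ.measurableSet subset_closure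

/-- Integration by parts for functions in `H^1_0(Ω)`. -/
theorem global_green [NeZero d] [IsFiniteMeasure (vol Ω)] (hΩ : IsOpen Ω)
    {X : E d → E d} (hX : ContDiff ℝ 1 X)
    {z : (L2 Ω × L2vec Ω) × M.L2skel} (hz : z ∈ M.traceGraph) :
    (∫ x in Ω, inner ℝ (z.1.2 x) (X x)) + ∫ x in Ω, z.1.1 x * divg X x = 0 := by
  have hdiv := continuous_divg hX
  have hXc := hX.continuous
  have hu : ∀ f : E d → ℝ, ∫ x in univ, f x ∂(vol Ω) = ∫ x in Ω, f x := fun f => by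
    rw [setIntegral_univ]
  refine traceGraph_induction (P := fun z => (∫ x in Ω, inner ℝ (z.1.2 x) (X x)) +
    ∫ x in Ω, z.1.1 x * divg X x = 0) ?_ ?_ hz
  · refine isClosed_eq (Continuous.add ?_ ?_) continuous_const
    · have := (continuous_setIntegral_inner (μ := vol Ω) univ (g := X)
        (by rw [Measure.restrict_univ]; exact M.memLp_vol hΩ hXc)).comp
        (continuous_snd.comp (continuous_fst (X := L2 Ω × L2vec Ω) (Y := M.L2skel)))
      exact this.congr fun z => hu _
    · have := (continuous_setIntegral_inner (μ := vol Ω) univ (g := divg X)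
        (by rw [Measure.restrict_univ]; exact M.memLp_vol hΩ hdiv)).comp
        (continuous_fst.comp (continuous_fst (X := L2 Ω × L2vec Ω) (Y := M.L2skel)))
      refine this.congr fun z => (hu _).trans (integral_congr_ae (ae_of_all _ fun x => ?_))
      simp [mul_comm]
  · intro z φ hφ h1 h2 _
    have hφ1 : ContDiff ℝ 1 φ := hφ.1.of_le (by norm_cast)
    have hφ' : Continuous (fderiv ℝ φ) := hφ1.continuous_fderiv (by simp)
    have e1 : ∫ x in Ω, inner ℝ (z.1.2 x) (X x) = ∫ x, fderiv ℝ φ x (X x) := by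
      rw [← setIntegral_eq_integral_of_forall_compl_eq_zero (s := Ω)
        (f := fun x => fderiv ℝ φ x (X x))]
      · refine integral_congr_ae ?_
        filter_upwards [h2] with x hx
        rw [hx, inner_gradient]
      · intro x hx
        have : x ∉ tsupport (fderiv ℝ φ) := fun h => hx (hφ.2.2 (tsupport_fderiv_subset ℝ h))
        rw [image_eq_zero_of_notMem_tsupport this]
        rfl
    have e2 : ∫ x in Ω, z.1.1 x * divg X x = ∫ x, φ x * divg X x := by
      rw [← setIntegral_eq_integral_of_forall_compl_eq_zero (s := Ω)
        (f := fun x => φ x * divg X x)]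
      · refine integral_congr_ae ?_
        filter_upwards [h1] with x hx
        rw [hx]
      · intro x hx
        rw [image_eq_zero_of_notMem_tsupport fun h => hx (hφ.2.2 h), zero_mul]
    have hc1 : HasCompactSupport fun x => fderiv ℝ φ x (X x) :=
      (hφ.2.1.fderiv ℝ).mono' (fun x hx => subset_tsupport _ fun h => hx (by simp [h]))
    have hφc := hφ1.continuous
    have hc2 : HasCompactSupport fun x => φ x * divg X x := hφ.2.1.mul_right
    rw [e1, e2, ← integral_add (Continuous.integrable_of_hasCompactSupport (by fun_prop) hc1)
      (Continuous.integrable_of_hasCompactSupport (by fun_prop) hc2)]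
    exact integral_green_eq_zero hφ1 hX hφ.2.1.smul_right

/-- Test functions are supported in Ω, which a boundary face does not meet, and vanishing on the
face is a closed condition. -/
theorem trace_ae_eq_zero [NeZero d] (hΩ : IsOpen Ω) {F : Finset (E d)}
    (hF : F ∈ M.boundaryFaces) {z : (L2 Ω × L2vec Ω) × M.L2skel} (hz : z ∈ M.traceGraph) :
    z.2 =ᵐ[M.surf.restrict (hull F)] 0 := by
  have h0 : MemLp (0 : E d → ℝ) 2 (M.surf.restrict (hull F)) := MemLp.zero
  refine ae_eq_of_integral_norm_sub_sq_le ((Lp.memLp z.2).restrict _) h0 ?_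
  refine traceGraph_induction (P := fun z =>
    ∫ x in hull F, ‖z.2 x - (0 : E d → ℝ) x‖ ^ 2 ∂M.surf ≤ 0) ?_ ?_ hz
  · exact isClosed_le ((continuous_setIntegral_norm_sub_sq (hull F) h0).comp continuous_snd)
      continuous_const
  · intro z φ hφ _ _ h3
    refine le_of_eq (integral_eq_zero_of_ae ?_)
    filter_upwards [ae_restrict_of_ae h3, ae_restrict_mem (measurableSet_hull F)] with x hx hxF
    have : φ x = 0 := image_eq_zero_of_notMem_tsupport fun h => by
      have : x ∈ hull F ∩ Ω := ⟨hxF, hφ.2.2 h⟩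
      rw [M.boundaryFace_inter_eq_empty (NeZero.pos d) hΩ hF] at this
      exact this
    simp [hx, this]

theorem exists_trace_bound [NeZero d] [IsFiniteMeasure (vol Ω)]
    (hreg : interior (closure Ω) = Ω) :
    ∃ C : ℝ, 0 ≤ C ∧ ∀ z ∈ M.traceGraph, ‖z.2‖ ≤ C * ‖z.1‖ := by
  have hb := fun (K F : Finset (E d)) (hK : K ∈ M.cells) (hF : F ∈ facets K) =>
    M.exists_facet_bound hreg hK hF
  choose! C hC0 hC using hb
  set t : Finset (Σ _ : Finset (E d), Finset (E d)) := M.cells.sigma facets with ht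
  have hmem : ∀ i ∈ t, i.1 ∈ M.cells ∧ i.2 ∈ facets i.1 := fun i hi => Finset.mem_sigma.1 hi
  refine ⟨√(∑ i ∈ t, C i.1 i.2 * 2), Real.sqrt_nonneg _, fun z hz => ?_⟩
  have h0 : 0 ≤ ∑ i ∈ t, C i.1 i.2 * 2 :=
    Finset.sum_nonneg fun i hi => mul_nonneg (hC0 _ _ (hmem i hi).1 (hmem i hi).2) two_pos.le
  refine le_of_sq_le_sq ?_ (by positivity)
  rw [mul_pow, Real.sq_sqrt h0, L2_norm_sq_eq_integral, Finset.sum_mul]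
  refine (integral_le_sum_of_ae_mem t (S := fun i => hull i.2) (fun i _ => measurableSet_hull _)
    ?_ (Lp.memLp z.2).norm.integrable_sq fun _ => sq_nonneg _).trans
    (Finset.sum_le_sum fun i hi => ?_)
  · filter_upwards [M.ae_surf_mem_faces] with x hx
    simp only [mem_iUnion] at hx
    obtain ⟨F, ⟨K, hK, hF⟩, hx⟩ := hx
    exact ⟨⟨K, F⟩, Finset.mem_sigma.2 ⟨hK, hF⟩, hx⟩
  · obtain ⟨hK, hF⟩ := hmem i hi
    have h := hC _ _ hK hF z hz 0 contDiff_const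
    have hg : ∀ x, ∇ (0 : E d → ℝ) x = 0 := fun x => gradient_const x (0 : ℝ)
    simp only [Pi.zero_apply, sub_zero, hg] at h
    refine h.trans ?_
    rw [mul_assoc]
    refine mul_le_mul_of_nonneg_left ?_ (hC0 _ _ hK hF)
    have h1 : cellInt Ω i.1 (fun x => ‖z.1.1 x‖ ^ 2) ≤ ‖z.1.1‖ ^ 2 := by
      rw [L2_norm_sq_eq_integral]
      exact setIntegral_le_integral (Lp.memLp z.1.1).norm.integrable_sq
        (ae_of_all _ fun _ => sq_nonneg _)
    have h2 : cellInt Ω i.1 (fun x => ‖z.1.2 x‖ ^ 2) ≤ ‖z.1.2‖ ^ 2 := by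
      rw [L2_norm_sq_eq_integral]
      exact setIntegral_le_integral (Lp.memLp z.1.2).norm.integrable_sq
        (ae_of_all _ fun _ => sq_nonneg _)
    have h3 : ‖z.1.1‖ ^ 2 ≤ ‖z.1‖ ^ 2 := pow_le_pow_left₀ (norm_nonneg _) (norm_fst_le z.1) 2
    have h4 : ‖z.1.2‖ ^ 2 ≤ ‖z.1‖ ^ 2 := pow_le_pow_left₀ (norm_nonneg _) (norm_snd_le z.1) 2
    linarith

/-- By the trace bound, forgetting the trace component is bounded below on the closed graph, hence
has closed range. The range contains all test pairs and therefore their closure H^1_0. -/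
theorem exists_mem_traceGraph [NeZero d] [IsFiniteMeasure (vol Ω)]
    (hreg : interior (closure Ω) = Ω) (v : H10 Ω) :
    ∃ t, ((v : L2 Ω × L2vec Ω), t) ∈ M.traceGraph := by
  obtain ⟨C, hC0, hC⟩ := M.exists_trace_bound hreg
  let f : M.traceGraph →L[ℝ] L2 Ω × L2vec Ω :=
    (ContinuousLinearMap.fst ℝ (L2 Ω × L2vec Ω) M.L2skel).comp M.traceGraph.subtypeL
  have hf : AntilipschitzWith (max 1 C).toNNReal f := by
    refine f.antilipschitz_of_bound fun z => ?_
    rw [Real.coe_toNNReal _ (by positivity)]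
    refine max_le ?_ ?_
    · exact le_mul_of_one_le_left (norm_nonneg _) (le_max_left _ _)
    · exact (hC z z.2).trans (mul_le_mul_of_nonneg_right (le_max_right _ _) (norm_nonneg _))
  have : CompleteSpace M.traceGraph :=
    M.testTriples.isClosed_topologicalClosure.completeSpace_coe
  have hcl := hf.isClosed_range f.uniformContinuous
  have hsub : (H10 Ω : Set (L2 Ω × L2vec Ω)) ⊆ range f := by
    refine closure_minimal (s := (testPairs Ω : Set (L2 Ω × L2vec Ω))) ?_ hcl
    rintro w ⟨φ, hφ, h1, h2⟩
    have hm : MemLp φ 2 M.surf := hφ.memLp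
    refine ⟨⟨(w, hm.toLp φ), subset_closure ⟨φ, hφ, h1, h2,
      hm.coeFn_toLp⟩⟩, rfl⟩
  obtain ⟨z, hz⟩ := hsub v.2
  refine ⟨z.1.2, ?_⟩
  rw [← hz]
  exact z.2

theorem trace_mem [NeZero d] [IsFiniteMeasure (vol Ω)]
    (hreg : interior (closure Ω) = Ω) (v : H10 Ω) :
    ((v : L2 Ω × L2vec Ω), M.trace v) ∈ M.traceGraph :=
  Classical.epsilon_spec (M.exists_mem_traceGraph hreg v)

/-- The difference of two candidates belongs to the graph over zero, where the trace bound forces it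
to vanish. Linearity of the trace is a consequence. -/
theorem trace_unique [NeZero d] [IsFiniteMeasure (vol Ω)]
    (hreg : interior (closure Ω) = Ω) {v : H10 Ω} {t : M.L2skel}
    (h : ((v : L2 Ω × L2vec Ω), t) ∈ M.traceGraph) : M.trace v = t := by
  obtain ⟨C, hC0, hC⟩ := M.exists_trace_bound hreg
  have h1 := hC _ (M.traceGraph.sub_mem (M.trace_mem hreg v) h)
  simp only [Prod.mk_sub_mk, sub_self, norm_zero, mul_zero] at h1
  exact sub_eq_zero.1 (norm_le_zero_iff.1 h1)

theorem trace_add [NeZero d] [IsFiniteMeasure (vol Ω)]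
    (hreg : interior (closure Ω) = Ω) (v w : H10 Ω) :
    M.trace (v + w) = M.trace v + M.trace w :=
  M.trace_unique hreg (M.traceGraph.add_mem (M.trace_mem hreg v) (M.trace_mem hreg w))

theorem trace_smul [NeZero d] [IsFiniteMeasure (vol Ω)]
    (hreg : interior (closure Ω) = Ω) (c : ℝ) (v : H10 Ω) :
    M.trace (c • v) = c • M.trace v :=
  M.trace_unique hreg (M.traceGraph.smul_mem c (M.trace_mem hreg v))

end SimplicialMesh
end HHO

/-! ### Identifying gradients, functions and traces on a single cell -/

namespace HHO

variable {d : ℕ}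

namespace SimplicialMesh

variable {Ω : Set (E d)} {M : SimplicialMesh Ω}

/-- On a cell where an `H^1_0`-function is smooth, the weak gradient is the classical one. -/
theorem grad_ae_eq [NeZero d] [IsFiniteMeasure (vol Ω)] (hΩ : IsOpen Ω)
    (hreg : interior (closure Ω) = Ω) {K : Finset (E d)} (hK : K ∈ M.cells) {q : E d → ℝ}
    (hq : ContDiff ℝ ∞ q) {z : (L2 Ω × L2vec Ω) × M.L2skel} (hz : z ∈ M.traceGraph)
    (h : z.1.1 =ᵐ[(vol Ω).restrict (hull K)] q) :
    z.1.2 =ᵐ[(vol Ω).restrict (hull K)] ∇ q := by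
  have hq1 : ContDiff ℝ 1 q := hq.of_le (by norm_cast)
  have hqc := hq.continuous
  have hq' := (contDiff_gradient hq).continuous
  set U := interior (hull K) with hU
  have hUΩ : U ⊆ Ω := M.interior_hull_subset hreg hK
  have hmem : MemLp (fun x => z.1.2 x - ∇ q x) 2 (vol Ω) :=
    (Lp.memLp z.1.2).sub (M.memLp_vol hΩ hq')
  have hint : Integrable (fun x => z.1.2 x - ∇ q x) (vol Ω) := hmem.integrable (by norm_num)
  -- By the fundamental lemma of the calculus of variations it suffices to test with ξ e, where ξ is
  -- a bump in the interior of K and e a fixed vector. Integrating by parts on both sides leaves ∫ v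
  -- div(ξ e) and ∫ q div(ξ e), which agree because v = q on K.
  have key : ∀ᵐ x ∂(vol Ω), x ∈ U → z.1.2 x - ∇ q x = 0 := by
    refine isOpen_interior.ae_eq_zero_of_integral_contDiff_smul_eq_zero
      (hint.locallyIntegrable.locallyIntegrableOn _) fun ξ hξ hξc hξU => ?_
    have hξ1 : ContDiff ℝ 1 ξ := hξ.of_le (by norm_cast)
    have hξcont := hξ.continuous
    obtain ⟨B, hB⟩ := hξcont.bounded_above_of_compact_support hξc
    have hint2 : Integrable (fun x => ξ x • (z.1.2 x - ∇ q x)) (vol Ω) :=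
      hint.bdd_smul B hξcont.aestronglyMeasurable (ae_of_all _ hB)
    refine ext_inner_left ℝ fun e => ?_
    rw [inner_zero_right, ← integral_inner hint2]
    set X : E d → E d := fun x => ξ x • e with hX
    have hX1 : ContDiff ℝ 1 X := hξ1.smul contDiff_const
    have hXc : HasCompactSupport X := hξc.smul_right
    have hdc : Continuous (divg X) := continuous_divg hX1
    have hXU : ∀ x ∉ U, X x = 0 := fun x hx => by
      simp only [hX]
      rw [image_eq_zero_of_notMem_tsupport fun h => hx (hξU h), zero_smul]
    have hdU : ∀ x ∉ U, divg X x = 0 := fun x hx => by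
      have : x ∉ tsupport (fderiv ℝ X) := fun h => hx (hξU
        (closure_mono (Function.support_smul_subset_left ξ (fun _ => e))
          (tsupport_fderiv_subset ℝ h)))
      simp [divg, image_eq_zero_of_notMem_tsupport this]
    have g1 := global_green hΩ hX1 hz
    have hqX : HasCompactSupport fun x => q x • X x :=
      hXc.mono' fun x hx => subset_tsupport _ fun h => hx (by simp only [h, smul_zero])
    have g2 := integral_green_eq_zero hq1 hX1 hqX
    have hXcont := hX1.continuous
    have hfq : Continuous (fderiv ℝ q) := hq1.continuous_fderiv (by simp)
    have hc1 : HasCompactSupport fun x => fderiv ℝ q x (X x) :=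
      hXc.mono' fun x hx => subset_tsupport _ fun h => hx (by simp [h])
    have hc2 : HasCompactSupport fun x => q x * divg X x :=
      hXc.mono' fun x hx => by
        by_contra h
        refine hx ?_
        have : x ∉ tsupport (fderiv ℝ X) := fun h' => h (tsupport_fderiv_subset ℝ h')
        simp [divg, image_eq_zero_of_notMem_tsupport this]
    rw [integral_add (Continuous.integrable_of_hasCompactSupport (by fun_prop) hc1)
      (Continuous.integrable_of_hasCompactSupport (by fun_prop) hc2)] at g2
    have e1 : ∫ x, fderiv ℝ q x (X x) = ∫ x in Ω, inner ℝ (∇ q x) (X x) := by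
      rw [← setIntegral_eq_integral_of_forall_compl_eq_zero (s := Ω)
        (f := fun x => fderiv ℝ q x (X x))]
      · simp_rw [inner_gradient]
      · intro x hx
        rw [hXU x fun h => hx (hUΩ h), map_zero]
    have e2 : ∫ x, q x * divg X x = ∫ x in Ω, z.1.1 x * divg X x := by
      rw [← setIntegral_eq_integral_of_forall_compl_eq_zero (s := Ω)
        (f := fun x => q x * divg X x)]
      · refine integral_congr_ae ?_
        have h' := (ae_restrict_iff' (measurableSet_hull K)).1 h
        filter_upwards [h'] with x hx
        by_cases hxU : x ∈ U
        · rw [hx (interior_subset hxU)]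
        · rw [hdU x hxU, mul_zero, mul_zero]
      · intro x hx
        rw [hdU x fun h => hx (hUΩ h), mul_zero]
    have e3 : ∀ x, inner ℝ e (ξ x • (z.1.2 x - ∇ q x)) =
        inner ℝ (z.1.2 x) (X x) - inner ℝ (∇ q x) (X x) := fun x => by
      simp only [hX, real_inner_smul_right, inner_sub_right, real_inner_comm e]
      ring
    have i1 : Integrable (fun x => inner ℝ (z.1.2 x) (X x)) (vol Ω) :=
      integrable_inner_of_memLp (Lp.memLp z.1.2) (M.memLp_vol hΩ hXcont)
    have i2 : Integrable (fun x => inner ℝ (∇ q x) (X x)) (vol Ω) :=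
      integrable_inner_of_memLp (M.memLp_vol hΩ hq') (M.memLp_vol hΩ hXcont)
    simp_rw [e3]
    rw [integral_sub i1 i2, ← e1]
    linarith
  have hnull : ∀ᵐ x ∂(volume.restrict (hull K)), x ∈ U := by
    rw [ae_restrict_iff' (measurableSet_hull K), ae_iff]
    refine measure_mono_null ?_ ((convex_hull K).addHaar_frontier volume)
    intro x hx
    simp only [mem_ofPred_eq, Classical.not_imp] at hx
    exact ⟨subset_closure hx.1, hx.2⟩
  rw [← M.restrict_hull hreg hK] at hnull
  filter_upwards [ae_restrict_of_ae key, hnull] with x h1 h2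
  exact sub_eq_zero.1 (h1 h2)

/-- An `H^1_0`-function with the same gradient as a smooth function on a cell differs from it
by a constant there. -/
theorem exists_ae_eq_add_const [NeZero d] [IsFiniteMeasure (vol Ω)]
    (hreg : interior (closure Ω) = Ω) {K : Finset (E d)} (hK : K ∈ M.cells) {q : E d → ℝ}
    (hq : ContDiff ℝ ∞ q) {z : (L2 Ω × L2vec Ω) × M.L2skel} (hz : z ∈ M.traceGraph)
    (h : z.1.2 =ᵐ[(vol Ω).restrict (hull K)] ∇ q) :
    ∃ c : ℝ, z.1.1 =ᵐ[(vol Ω).restrict (hull K)] fun x => q x + c := by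
  obtain ⟨C, hC⟩ := exists_poincare (isCompact_hull K) (convex_hull K)
  have hqc := hq.continuous
  have hq' := (contDiff_gradient hq).continuous
  have hmq : MemLp q 2 ((vol Ω).restrict (hull K)) := memLp_of_continuous hqc
  have hintq : Integrable q ((vol Ω).restrict (hull K)) := hmq.integrable (by norm_num)
  have hintL : ∀ f : L2 Ω, Integrable f ((vol Ω).restrict (hull K)) := fun f =>
    ((Lp.memLp f).restrict (hull K)).integrable (by norm_num)
  set m := (volume : Measure (E d)).real (hull K) with hm
  -- Poincaré's inequality for φ − q extends from test functions to the whole graph, since every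
  -- term is L²-continuous.
  have key : m * (cellInt Ω K fun x => ‖z.1.1 x - q x‖ ^ 2) -
      (cellInt Ω K fun x => z.1.1 x - q x) ^ 2 ≤
      C * cellInt Ω K fun x => ‖z.1.2 x - ∇ q x‖ ^ 2 := by
    refine traceGraph_induction (P := fun z => m * (cellInt Ω K fun x => ‖z.1.1 x - q x‖ ^ 2) -
      (cellInt Ω K fun x => z.1.1 x - q x) ^ 2 ≤
      C * cellInt Ω K fun x => ‖z.1.2 x - ∇ q x‖ ^ 2) ?_ ?_ hz
    · refine isClosed_le (Continuous.sub (continuous_const.mul ?_) (Continuous.pow ?_ 2))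
        (continuous_const.mul ?_)
      · exact (continuous_setIntegral_norm_sub_sq (μ := vol Ω) (hull K) hmq).comp
          (continuous_fst.comp continuous_fst)
      · have h1 := ((continuous_setIntegral_inner (μ := vol Ω) (hull K) (g := fun _ => (1 : ℝ))
          (memLp_of_continuous continuous_const)).comp (continuous_fst.comp
          (continuous_fst (X := L2 Ω × L2vec Ω) (Y := M.L2skel)))).sub
          (continuous_const (y := cellInt Ω K q))
        refine h1.congr fun z => ?_
        simp only [cellInt]
        rw [integral_sub (hintL _) hintq]
        simp
      · exact (continuous_setIntegral_norm_sub_sq (μ := vol Ω) (hull K)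
          (memLp_of_continuous hq')).comp (continuous_snd.comp continuous_fst)
    · intro z φ hφ h1 h2 _
      have h := hC (fun x => φ x - q x) ((hφ.1.sub hq).of_le (by norm_cast))
      rw [← M.cellInt_eq hreg hK, ← M.cellInt_eq hreg hK, ← M.cellInt_eq hreg hK] at h
      have e1 : (cellInt Ω K fun x => z.1.1 x - q x) = cellInt Ω K fun x => φ x - q x := by
        refine integral_congr_ae (ae_restrict_of_ae ?_)
        filter_upwards [h1] with x hx
        simp [hx]
      have e2 : (cellInt Ω K fun x => ‖z.1.1 x - q x‖ ^ 2) =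
          cellInt Ω K (fun x => (φ x - q x) ^ 2) := by
        refine integral_congr_ae (ae_restrict_of_ae ?_)
        filter_upwards [h1] with x hx
        simp [hx]
      have e3 : (cellInt Ω K fun x => ‖z.1.2 x - ∇ q x‖ ^ 2) =
          cellInt Ω K (fun x => ‖fderiv ℝ (fun x => φ x - q x) x‖ ^ 2) := by
        refine integral_congr_ae (ae_restrict_of_ae ?_)
        filter_upwards [h2] with x hx
        change _ = ‖fderiv ℝ (φ - q) x‖ ^ 2
        rw [hx, ← norm_gradient, gradient_sub (hφ.1.differentiable (by simp))
          (hq.differentiable (by simp)), Pi.sub_apply]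
      rw [e1, e2, e3]
      exact h
  have e0 : (cellInt Ω K fun x => ‖z.1.2 x - ∇ q x‖ ^ 2) = 0 := by
    refine integral_eq_zero_of_ae ?_
    filter_upwards [h] with x hx
    simp [hx]
  rw [e0, mul_zero] at key
  have hm0 : 0 < m := by
    rw [hm, measureReal_def, ENNReal.toReal_pos_iff]
    refine ⟨?_, (isCompact_hull K).measure_lt_top⟩
    exact (isOpen_interior.measure_pos volume (M.isSimplex hK).interior_nonempty).trans_le
      (measure_mono interior_subset)
  set I := cellInt Ω K fun x => z.1.1 x - q x with hI
  -- The constant is the mean of v − q over the cell. The integrated squared deviation from it is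
  -- the left side of `key` divided by the volume, hence nonpositive.
  refine ⟨I / m, ae_eq_of_integral_norm_sub_sq_le ((Lp.memLp z.1.1).restrict _)
    (hmq.add (memLp_const _)) ?_⟩
  have hw : MemLp (fun x => z.1.1 x - q x) 2 ((vol Ω).restrict (hull K)) :=
    ((Lp.memLp z.1.1).restrict _).sub hmq
  have e1 : ∀ x, ‖z.1.1 x - (q x + I / m)‖ ^ 2 =
      ‖z.1.1 x - q x‖ ^ 2 - 2 * (I / m) * (z.1.1 x - q x) + (I / m) ^ 2 := fun x => by
    rw [Real.norm_eq_abs, Real.norm_eq_abs, sq_abs, sq_abs]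
    ring
  have hmm : ((vol Ω).restrict (hull K)).real univ = m := by
    rw [M.restrict_hull hreg hK, measureReal_restrict_apply_univ]
  simp_rw [e1]
  have i1 : Integrable (fun x => ‖z.1.1 x - q x‖ ^ 2) ((vol Ω).restrict (hull K)) :=
    hw.norm.integrable_sq
  have i2 : Integrable (fun x => 2 * (I / m) * (z.1.1 x - q x)) ((vol Ω).restrict (hull K)) :=
    (hw.integrable (by norm_num)).const_mul _
  have i3 : Integrable (fun x => ‖z.1.1 x - q x‖ ^ 2 - 2 * (I / m) * (z.1.1 x - q x))
      ((vol Ω).restrict (hull K)) := i1.sub i2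
  rw [integral_add i3 (integrable_const _), integral_sub i1 i2, integral_const_mul,
    integral_const, hmm]
  change cellInt Ω K (fun x => ‖z.1.1 x - q x‖ ^ 2) - 2 * (I / m) * I + m • (I / m) ^ 2 ≤ 0
  have e2 : cellInt Ω K (fun x => ‖z.1.1 x - q x‖ ^ 2) - 2 * (I / m) * I + m • (I / m) ^ 2 =
      (m * cellInt Ω K (fun x => ‖z.1.1 x - q x‖ ^ 2) - I ^ 2) / m := by
    rw [smul_eq_mul]
    field_simp
    ring
  rw [e2]
  exact div_nonpos_of_nonpos_of_nonneg key hm0.le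

/-- On the facets of a cell where an `H^1_0`-function is smooth, its trace is the restriction. -/
theorem trace_ae_eq [NeZero d] [IsFiniteMeasure (vol Ω)] (hΩ : IsOpen Ω)
    (hreg : interior (closure Ω) = Ω) {K F : Finset (E d)} (hK : K ∈ M.cells)
    (hF : F ∈ facets K) {q : E d → ℝ}
    (hq : ContDiff ℝ ∞ q) {z : (L2 Ω × L2vec Ω) × M.L2skel} (hz : z ∈ M.traceGraph)
    (h : z.1.1 =ᵐ[(vol Ω).restrict (hull K)] q) :
    z.2 =ᵐ[M.surf.restrict (hull F)] q := by
  obtain ⟨C, -, hC⟩ := M.exists_facet_bound hreg hK hF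
  refine ae_eq_of_integral_norm_sub_sq_le ((Lp.memLp z.2).restrict _)
    (memLp_of_continuous hq.continuous) ?_
  refine (hC z hz q hq).trans (le_of_eq ?_)
  have e1 : (cellInt Ω K fun x => ‖z.1.1 x - q x‖ ^ 2) = 0 := by
    refine integral_eq_zero_of_ae ?_
    filter_upwards [h] with x hx
    simp [hx]
  have e2 : (cellInt Ω K fun x => ‖z.1.2 x - ∇ q x‖ ^ 2) = 0 := by
    refine integral_eq_zero_of_ae ?_
    filter_upwards [M.grad_ae_eq hΩ hreg hK hq hz h] with x hx
    simp [hx]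
  rw [e1, e2, add_zero, mul_zero]

end SimplicialMesh
end HHO

namespace HHO

/-! ### Riesz representation and moments -/

/-- A functional vanishing on the kernel of a symmetric bilinear form on a finite-dimensional space
is represented by the form. -/
theorem exists_repr {V : Type*} [AddCommGroup V] [Module ℝ V] [Module.Finite ℝ V]
    (B : V →ₗ[ℝ] V →ₗ[ℝ] ℝ) (hB : ∀ x y, B x y = B y x) (l : V →ₗ[ℝ] ℝ)
    (hl : ∀ x, B x x = 0 → l x = 0) : ∃ g, ∀ r, B g r = l r := by
  -- In finite dimension the range of the transpose is the annihilator of the kernel of `B`, and a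
  -- kernel vector x satisfies B x x = 0. Definiteness of `B` is not needed.
  have h1 : l ∈ B.dualMap.range := by
    rw [LinearMap.range_dualMap_eq_dualAnnihilator_ker, Submodule.mem_dualAnnihilator]
    intro x hx
    refine hl x ?_
    rw [LinearMap.mem_ker.1 hx, LinearMap.zero_apply]
  obtain ⟨φ, hφ⟩ := h1
  obtain ⟨g, rfl⟩ := (Module.evalEquiv ℝ V).surjective φ
  refine ⟨g, fun r => ?_⟩
  rw [← hφ, hB]
  rfl

section Moments

variable {X : Type*} [MeasurableSpace X] {ν : Measure X}

theorem integrable_mul {f g : X → ℝ} (hf : MemLp f 2 ν) (hg : MemLp g 2 ν) :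
    Integrable (fun x => f x * g x) ν :=
  hf.integrable_mul hg

theorem ae_eq_zero_of_integral_mul_self {f : X → ℝ} (hf : MemLp f 2 ν)
    (h : ∫ x, f x * f x ∂ν = 0) : f =ᵐ[ν] 0 := by
  filter_upwards [(integral_eq_zero_iff_of_nonneg (fun x => mul_self_nonneg (f x))
    (integrable_mul hf hf)).1 h] with x hx
  exact mul_self_eq_zero.1 hx

theorem integral_mul_add {r f g : X → ℝ} (hr : MemLp r 2 ν) (hf : MemLp f 2 ν)
    (hg : MemLp g 2 ν) :
    ∫ x, r x * (f x + g x) ∂ν = ∫ x, r x * f x ∂ν + ∫ x, r x * g x ∂ν := by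
  simp_rw [mul_add]
  exact integral_add (integrable_mul hr hf) (integrable_mul hr hg)

theorem integral_mul_sub {r f g : X → ℝ} (hr : MemLp r 2 ν) (hf : MemLp f 2 ν)
    (hg : MemLp g 2 ν) :
    ∫ x, r x * (f x - g x) ∂ν = ∫ x, r x * f x ∂ν - ∫ x, r x * g x ∂ν := by
  simp_rw [mul_sub]
  exact integral_sub (integrable_mul hr hf) (integrable_mul hr hg)

theorem integral_mul_const_mul (c : ℝ) (r f : X → ℝ) :
    ∫ x, r x * (c * f x) ∂ν = c * ∫ x, r x * f x ∂ν := by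
  rw [← integral_const_mul]
  congr 1 with x
  ring

variable {P : Submodule ℝ (X → ℝ)}

/-- The Gram form on `P` may be degenerate: a nonzero polynomial on ℝ^d can vanish on a face. Its
isotropic elements vanish almost everywhere, so the moment functional vanishes on them and is still
represented. Uniqueness holds only almost everywhere. -/
theorem exists_proj [Module.Finite ℝ P] (hP : ∀ q ∈ P, MemLp q 2 ν) {f : X → ℝ}
    (hf : MemLp f 2 ν) : ∃ g ∈ P, ∀ r ∈ P, ∫ x, r x * g x ∂ν = ∫ x, r x * f x ∂ν := by
  have hadd : ∀ (a b : P) (g : X → ℝ), MemLp g 2 ν → ∫ x, (a + b).1 x * g x ∂ν =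
      ∫ x, a.1 x * g x ∂ν + ∫ x, b.1 x * g x ∂ν := by
    intro a b g hg
    rw [← integral_add (integrable_mul (hP _ a.2) hg) (integrable_mul (hP _ b.2) hg)]
    congr 1 with x
    exact add_mul _ _ _
  have hsmul : ∀ (c : ℝ) (a : P) (g : X → ℝ), ∫ x, (c • a).1 x * g x ∂ν =
      c • ∫ x, a.1 x * g x ∂ν := by
    intro c a g
    rw [smul_eq_mul, ← integral_const_mul]
    congr 1 with x
    exact mul_assoc _ _ _
  have hcomm : ∀ a b : P, ∫ x, a.1 x * b.1 x ∂ν = ∫ x, b.1 x * a.1 x ∂ν := by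
    intro a b
    simp_rw [mul_comm]
  obtain ⟨g, hg⟩ := exists_repr
    (LinearMap.mk₂ ℝ (fun a b : P => ∫ x, a.1 x * b.1 x ∂ν)
      (fun a b c => hadd a b _ (hP _ c.2)) (fun c a b => hsmul c a _)
      (fun a b c => by
        rw [hcomm a (b + c), hcomm a b, hcomm a c]
        exact hadd b c _ (hP _ a.2))
      (fun c a b => by
        rw [hcomm a (c • b), hcomm a b]
        exact hsmul c b _))
    hcomm
    { toFun := fun a : P => ∫ x, a.1 x * f x ∂ν
      map_add' := fun a b => hadd a b f hf
      map_smul' := fun c a => hsmul c a f }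
    (fun a ha => by
      have h1 := ae_eq_zero_of_integral_mul_self (hP _ a.2) ha
      refine integral_eq_zero_of_ae ?_
      filter_upwards [h1] with x hx
      rw [hx]
      simp)
  refine ⟨g, g.2, fun r hr => ?_⟩
  have h := hg ⟨r, hr⟩
  simp only [LinearMap.mk₂_apply, LinearMap.coe_mk, AddHom.coe_mk] at h
  rw [← h]
  simp_rw [mul_comm]

theorem ae_eq_of_moments (hP : ∀ q ∈ P, MemLp q 2 ν) {f g : X → ℝ} (hf : f ∈ P) (hg : g ∈ P)
    (h : ∀ r ∈ P, ∫ x, r x * f x ∂ν = ∫ x, r x * g x ∂ν) : f =ᵐ[ν] g := by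
  have h1 := h _ (P.sub_mem hf hg)
  rw [← sub_eq_zero, ← integral_mul_sub (hP _ (P.sub_mem hf hg)) (hP _ hf) (hP _ hg)] at h1
  filter_upwards [ae_eq_zero_of_integral_mul_self (hP _ (P.sub_mem hf hg)) h1] with x hx
  exact sub_eq_zero.1 hx

/-- Gluing of functions given on the members of an almost disjoint family. -/
theorem exists_Lp_glue {ι : Type*} [DecidableEq ι] (t : Finset ι) {S : ι → Set X}
    (hS : ∀ i ∈ t, MeasurableSet (S i)) (hd : ∀ i ∈ t, ∀ j ∈ t, i ≠ j → ν (S i ∩ S j) = 0)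
    {q : ι → X → ℝ} (hq : ∀ i ∈ t, MemLp (q i) 2 (ν.restrict (S i))) :
    ∃ f : Lp ℝ 2 ν, ∀ i ∈ t, f =ᵐ[ν.restrict (S i)] q i := by
  have h : MemLp (fun x => ∑ i ∈ t, (S i).indicator (q i) x) 2 ν :=
    memLp_finsetSum t fun i hi => (memLp_indicator_iff_restrict (hS i hi)).2 (hq i hi)
  refine ⟨h.toLp, fun i hi => Filter.EventuallyEq.trans (ae_restrict_of_ae h.coeFn_toLp) ?_⟩
  have h1 : ∀ j ∈ t, j ≠ i → ∀ᵐ x ∂ν.restrict (S i), x ∉ S j := by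
    intro j hj hne
    rw [ae_restrict_iff' (hS i hi)]
    have h2 := measure_eq_zero_iff_ae_notMem.1 (hd i hi j hj hne.symm)
    filter_upwards [h2] with x hx hxi hxj
    exact hx ⟨hxi, hxj⟩
  have h3 : ∀ᵐ x ∂ν.restrict (S i), ∀ j ∈ t, j ≠ i → x ∉ S j := by
    refine (Filter.eventually_all_finset t).2 fun j hj => ?_
    by_cases hne : j = i
    · exact Filter.Eventually.of_forall fun x h => absurd hne h
    · filter_upwards [h1 j hj hne] with x hx _ using hx
  filter_upwards [h3, ae_restrict_mem (hS i hi)] with x hx hxi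
  rw [Finset.sum_eq_single_of_mem i hi fun j hj hne =>
    indicator_of_notMem (hx j hj hne) _, indicator_of_mem hxi]

end Moments

variable {d : ℕ}

theorem laplacian_add_fun {f g : E d → ℝ} (hf : ContDiff ℝ ∞ f) (hg : ContDiff ℝ ∞ g) :
    Δ (f + g) = Δ f + Δ g := by
  funext x
  exact ContDiffAt.laplacian_add (contDiff_infty.1 hf 2).contDiffAt
    (contDiff_infty.1 hg 2).contDiffAt

theorem laplacian_smul_fun (c : ℝ) {f : E d → ℝ} (hf : ContDiff ℝ ∞ f) :
    Δ (c • f) = c • Δ f := by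
  funext x
  exact laplacian_smul c (contDiff_infty.1 hf 2).contDiffAt

theorem continuous_laplacian_of_mem_polyFun {k : ℤ} {f : E d → ℝ} (hf : f ∈ polyFun d k) :
    Continuous (Δ f) :=
  continuous_of_mem_polyFun (laplacian_mem_polyFun hf)

theorem continuous_gradient_of_mem_polyFun {k : ℤ} {f : E d → ℝ} (hf : f ∈ polyFun d k) :
    Continuous (∇ f) :=
  (contDiff_gradient (contDiff_of_mem_polyFun hf)).continuous

theorem gradient_fun_const (c : ℝ) : ∇ (fun _ : E d => c) = 0 := by
  funext x
  exact gradient_const x c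

section LpMul

variable {X : Type*} [MeasurableSpace X] {μ : Measure X}

theorem memLp_restrict (f : Lp ℝ 2 μ) (S : Set X) : MemLp f 2 (μ.restrict S) :=
  (Lp.memLp f).restrict S

theorem setIntegral_Lp_add_mul (f g : Lp ℝ 2 μ) {S : Set X} {r : X → ℝ}
    (hr : MemLp r 2 (μ.restrict S)) :
    ∫ x in S, (f + g) x * r x ∂μ = ∫ x in S, f x * r x ∂μ + ∫ x in S, g x * r x ∂μ := by
  rw [← integral_add (integrable_mul (memLp_restrict f S) hr)
    (integrable_mul (memLp_restrict g S) hr)]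
  refine integral_congr_ae ?_
  filter_upwards [ae_restrict_of_ae (Lp.coeFn_add f g)] with x hx
  rw [hx, Pi.add_apply, add_mul]

theorem setIntegral_Lp_smul_mul (c : ℝ) (f : Lp ℝ 2 μ) (S : Set X) (r : X → ℝ) :
    ∫ x in S, (c • f) x * r x ∂μ = c * ∫ x in S, f x * r x ∂μ := by
  rw [← integral_const_mul]
  refine integral_congr_ae ?_
  filter_upwards [ae_restrict_of_ae (Lp.coeFn_smul c f)] with x hx
  rw [hx, Pi.smul_apply, smul_eq_mul, mul_assoc]

end LpMul

end HHO

namespace HHO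

variable {d : ℕ}

namespace SimplicialMesh

variable {Ω : Set (E d)} {M : SimplicialMesh Ω}

theorem isOpen_of_regular (hreg : interior (closure Ω) = Ω) : IsOpen Ω := hreg ▸ isOpen_interior

/-! ### Piecewise polynomials -/

section Broken

theorem eq_zero_of_ae_cell (M : SimplicialMesh Ω) (hreg : interior (closure Ω) = Ω)
    {K : Finset (E d)} (hK : K ∈ M.cells) {k : ℤ} {f : E d → ℝ} (hf : f ∈ polyFun d k)
    (h : f =ᵐ[(vol Ω).restrict (hull K)] 0) : f = 0 :=
  (M.isSimplex hK).eq_zero_of_ae hf (M.restrict_hull hreg hK ▸ h)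

theorem eq_of_ae_cell (M : SimplicialMesh Ω) (hreg : interior (closure Ω) = Ω)
    {K : Finset (E d)} (hK : K ∈ M.cells) {k l : ℤ} {f g : E d → ℝ} (hf : f ∈ polyFun d k)
    (hg : g ∈ polyFun d l) (h : f =ᵐ[(vol Ω).restrict (hull K)] g) : f = g := by
  refine sub_eq_zero.1 (M.eq_zero_of_ae_cell hreg hK (k := max k l)
    (Submodule.sub_mem _ (polyFun_mono (le_max_left _ _) hf)
      (polyFun_mono (le_max_right _ _) hg)) ?_)
  filter_upwards [h] with x hx
  exact sub_eq_zero.2 hx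

/-- Polynomials that agree almost everywhere on a cell are equal, so the choice made in `cellPoly`
is forced. -/
theorem cellPoly_eq (M : SimplicialMesh Ω) (hreg : interior (closure Ω) = Ω)
    {K : Finset (E d)} (hK : K ∈ M.cells) {k : ℤ} {q : E d → ℝ} (hq : q ∈ polyFun d k) {f : L2 Ω}
    (h : f =ᵐ[(vol Ω).restrict (hull K)] q) : cellPoly f K = q := by
  have hs : ∃ q : E d → ℝ, (∃ k : ℤ, q ∈ polyFun d k) ∧ f =ᵐ[(vol Ω).restrict (hull K)] q :=
    ⟨q, ⟨k, hq⟩, h⟩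
  obtain ⟨⟨l, hl⟩, h1⟩ := Classical.epsilon_spec hs
  exact M.eq_of_ae_cell hreg hK hl hq (h1.symm.trans h)

theorem cellPoly_mem (hreg : interior (closure Ω) = Ω) {K : Finset (E d)} (hK : K ∈ M.cells)
    {k : ℤ} {f : L2 Ω} (hf : f ∈ M.brokenPoly k) : cellPoly f K ∈ polyFun d k := by
  obtain ⟨q, hq, h⟩ := hf K hK
  rwa [M.cellPoly_eq hreg hK hq h]

theorem ae_eq_cellPoly (hreg : interior (closure Ω) = Ω) {K : Finset (E d)} (hK : K ∈ M.cells)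
    {k : ℤ} {f : L2 Ω} (hf : f ∈ M.brokenPoly k) :
    f =ᵐ[(vol Ω).restrict (hull K)] cellPoly f K := by
  obtain ⟨q, hq, h⟩ := hf K hK
  rwa [M.cellPoly_eq hreg hK hq h]

theorem cellPoly_add (hreg : interior (closure Ω) = Ω) {K : Finset (E d)} (hK : K ∈ M.cells)
    {k : ℤ} {f g : L2 Ω} (hf : f ∈ M.brokenPoly k) (hg : g ∈ M.brokenPoly k) :
    cellPoly (f + g) K = cellPoly f K + cellPoly g K :=
  M.cellPoly_eq hreg hK (Submodule.add_mem _ (cellPoly_mem hreg hK hf) (cellPoly_mem hreg hK hg))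
    (Filter.EventuallyEq.trans (ae_restrict_of_ae (Lp.coeFn_add f g))
      ((ae_eq_cellPoly hreg hK hf).add (ae_eq_cellPoly hreg hK hg)))

theorem cellPoly_smul (hreg : interior (closure Ω) = Ω) {K : Finset (E d)} (hK : K ∈ M.cells)
    {k : ℤ} {f : L2 Ω} (c : ℝ) (hf : f ∈ M.brokenPoly k) :
    cellPoly (c • f) K = c • cellPoly f K :=
  M.cellPoly_eq hreg hK (Submodule.smul_mem _ c (cellPoly_mem hreg hK hf))
    (Filter.EventuallyEq.trans (ae_restrict_of_ae (Lp.coeFn_smul c f))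
      ((ae_eq_cellPoly hreg hK hf).const_smul c))

theorem L2_ext (M : SimplicialMesh Ω) (hreg : interior (closure Ω) = Ω) {f g : L2 Ω}
    (h : ∀ K ∈ M.cells, f =ᵐ[(vol Ω).restrict (hull K)] g) : f = g := by
  refine Lp.ext ?_
  have h1 : ∀ᵐ x ∂vol Ω, ∀ K ∈ M.cells, x ∈ hull K → f x = g x :=
    (Filter.eventually_all_finset _).2 fun K hK =>
      (ae_restrict_iff' (measurableSet_hull K)).1 (h K hK)
  filter_upwards [h1, M.ae_vol_mem_cells (isOpen_of_regular hreg)] with x hx hx'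
  obtain ⟨K, hK, hxK⟩ := mem_iUnion₂.1 hx'
  exact hx K hK hxK

theorem L2skel_ext {f g : M.L2skel}
    (h : ∀ F ∈ M.faces, f =ᵐ[M.surf.restrict (hull F)] g) : f = g := by
  refine Lp.ext ?_
  have h1 : ∀ᵐ x ∂M.surf, ∀ F ∈ M.faces, x ∈ hull F → f x = g x :=
    (Filter.eventually_all_finite M.finite_faces).2 fun F hF =>
      (ae_restrict_iff' (measurableSet_hull F)).1 (h F hF)
  filter_upwards [h1, M.ae_surf_mem_faces] with x hx hx'
  obtain ⟨F, hF, hxF⟩ := mem_iUnion₂.1 hx'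
  exact hx F hF hxF

theorem mem_faces_of_mem_interfaces {F : Finset (E d)} (hF : F ∈ M.interfaces) : F ∈ M.faces := by
  obtain ⟨K, hK, -, -, -, h, -⟩ := hF
  exact ⟨K, hK, h⟩

theorem exists_brokenPoly [IsFiniteMeasure (vol Ω)] (M : SimplicialMesh Ω) {k : ℤ}
    {q : Finset (E d) → E d → ℝ} (hq : ∀ K ∈ M.cells, q K ∈ polyFun d k) :
    ∃ f ∈ M.brokenPoly k, ∀ K ∈ M.cells, f =ᵐ[(vol Ω).restrict (hull K)] q K := by
  classical
  obtain ⟨f, hf⟩ := exists_Lp_glue (ν := vol Ω) M.cells (S := fun K => hull K) (q := q)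
    (fun K _ => measurableSet_hull K)
    (fun K hK K' hK' hne => Measure.absolutelyContinuous_of_le Measure.restrict_le_self
      (M.volume_inter_eq_zero hK hK' hne))
    (fun K hK => memLp_of_continuous (continuous_of_mem_polyFun (hq K hK)))
  exact ⟨f, fun K hK => ⟨q K, hq K hK, hf K hK⟩, hf⟩

theorem exists_skelPoly [NeZero d] (M : SimplicialMesh Ω) {k : ℤ}
    {q : Finset (E d) → E d → ℝ} (hq : ∀ F ∈ M.interfaces, q F ∈ polyFun d k) :
    ∃ f ∈ M.skelPoly k, ∀ F ∈ M.interfaces, f =ᵐ[M.surf.restrict (hull F)] q F := by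
  classical
  -- The zero default on boundary faces builds in the boundary condition of the discrete face space.
  set q' : Finset (E d) → E d → ℝ := fun F => if F ∈ M.interfaces then q F else 0 with hq'
  have hmem : ∀ F, q' F ∈ polyFun d k := by
    intro F
    by_cases h : F ∈ M.interfaces
    · simpa only [hq', if_pos h] using hq F h
    · simp only [hq', if_neg h]
      exact Submodule.zero_mem _
  obtain ⟨f, hf⟩ := exists_Lp_glue (ν := M.surf) M.finite_faces.toFinset
    (S := fun F => hull F) (q := q')
    (fun K _ => measurableSet_hull K)
    (fun F hF F' hF' hne => Measure.restrict_apply_eq_zero' M.measurableSet_skeleton |>.2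
      (measure_mono_null inter_subset_left
        (M.surface_inter_eq_zero (NeZero.pos d) (M.finite_faces.mem_toFinset.1 hF)
          (M.finite_faces.mem_toFinset.1 hF') hne)))
    (fun F _ => memLp_of_continuous (continuous_of_mem_polyFun (hmem F)))
  simp only [Finite.mem_toFinset] at hf
  refine ⟨f, ⟨fun F hF => ⟨q' F, hmem F, hf F hF⟩, fun F hF => ?_⟩, fun F hF => ?_⟩
  · simpa only [hq', if_neg hF.2] using hf F hF.1
  · simpa only [hq', if_pos hF] using hf F (mem_faces_of_mem_interfaces hF)

theorem finite_brokenPoly (M : SimplicialMesh Ω) (hreg : interior (closure Ω) = Ω) (k : ℤ) :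
    Module.Finite ℝ (M.brokenPoly k) := by
  let T : M.brokenPoly k →ₗ[ℝ] (M.cells → polyFun d k) :=
    { toFun := fun f K => ⟨cellPoly f.1 K.1, cellPoly_mem hreg K.2 f.2⟩
      map_add' := fun f g => funext fun K => Subtype.ext (cellPoly_add hreg K.2 f.2 g.2)
      map_smul' := fun c f => funext fun K => Subtype.ext (cellPoly_smul hreg K.2 c f.2) }
  refine Module.Finite.of_injective T fun f g h => Subtype.ext (M.L2_ext hreg fun K hK => ?_)
  have h1 : cellPoly f.1 K = cellPoly g.1 K := congrArg Subtype.val (congrFun h ⟨K, hK⟩)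
  exact (ae_eq_cellPoly hreg hK f.2).trans (h1 ▸ (ae_eq_cellPoly hreg hK g.2).symm)

theorem memLp_poly_face [NeZero d] {k : ℤ} (F : Finset (E d)) {r : E d → ℝ}
    (hr : r ∈ polyFun d k) : MemLp r 2 (M.surf.restrict (hull F)) :=
  memLp_of_continuous (continuous_of_mem_polyFun hr)

theorem memLp_poly_cell [IsFiniteMeasure (vol Ω)] {k : ℤ} (K : Finset (E d)) {r : E d → ℝ}
    (hr : r ∈ polyFun d k) : MemLp r 2 ((vol Ω).restrict (hull K)) :=
  memLp_of_continuous (continuous_of_mem_polyFun hr)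

/-- Face-wise polynomials with the same moments on the interfaces are equal. -/
theorem skelPoly_ext [NeZero d] {k : ℤ} {f g : M.L2skel} (hf : f ∈ M.skelPoly k)
    (hg : g ∈ M.skelPoly k) (h : ∀ F ∈ M.interfaces, ∀ r ∈ polyFun d k,
      M.faceInt F (fun x => r x * f x) = M.faceInt F (fun x => r x * g x)) : f = g := by
  refine L2skel_ext fun F hF => ?_
  by_cases hi : F ∈ M.interfaces
  · obtain ⟨q, hq, h1⟩ := hf.1 F hF
    obtain ⟨r, hr, h2⟩ := hg.1 F hF
    refine h1.trans (Filter.EventuallyEq.trans ?_ h2.symm)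
    refine ae_eq_of_moments (P := polyFun d k) (fun q hq => memLp_poly_face F hq) hq hr
      fun s hs => ?_
    have h3 : ∫ x in hull F, s x * f x ∂M.surf = ∫ x in hull F, s x * q x ∂M.surf :=
      integral_congr_ae (by filter_upwards [h1] with x hx using by rw [hx])
    have h4 : ∫ x in hull F, s x * g x ∂M.surf = ∫ x in hull F, s x * r x ∂M.surf :=
      integral_congr_ae (by filter_upwards [h2] with x hx using by rw [hx])
    rw [← h3, ← h4]
    exact h F hi s hs
  · exact (hf.2 F ⟨hF, hi⟩).trans (hg.2 F ⟨hF, hi⟩).symm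

/-- On a face the representing polynomial on ℝ^d is not unique, so the injection into a
finite-dimensional space is by moments rather than by representatives. -/
theorem finite_skelPoly [NeZero d] (M : SimplicialMesh Ω) (k : ℤ) :
    Module.Finite ℝ (M.skelPoly k) := by
  have : Finite M.faces := M.finite_faces
  let T : M.skelPoly k →ₗ[ℝ] (M.faces → polyFun d k →ₗ[ℝ] ℝ) :=
    { toFun := fun f F =>
        { toFun := fun r => ∫ x in hull F.1, f.1 x * r.1 x ∂M.surf
          map_add' := fun r s => integral_mul_add (memLp_restrict f.1 _)
            (memLp_poly_face F.1 r.2) (memLp_poly_face F.1 s.2)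
          map_smul' := fun c r => integral_mul_const_mul c _ _ }
      map_add' := fun f g => funext fun F => LinearMap.ext fun r =>
        setIntegral_Lp_add_mul f.1 g.1 (memLp_poly_face F.1 r.2)
      map_smul' := fun c f => funext fun F => LinearMap.ext fun r =>
        setIntegral_Lp_smul_mul c f.1 _ _ }
  refine Module.Finite.of_injective T fun f g h => Subtype.ext
    (skelPoly_ext f.2 g.2 fun F hF r hr => ?_)
  have h1 := LinearMap.congr_fun (congrFun h ⟨F, mem_faces_of_mem_interfaces hF⟩) ⟨r, hr⟩
  simp only [faceInt, mul_comm (r _)]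
  exact h1

theorem finite_space [NeZero d] (M : SimplicialMesh Ω) (hreg : interior (closure Ω) = Ω) (p : ℕ) :
    Module.Finite ℝ (M.space p) := by
  have := M.finite_brokenPoly hreg p
  have := M.finite_skelPoly p
  let T : M.space p →ₗ[ℝ] M.brokenPoly p × M.skelPoly p :=
    { toFun := fun s => (⟨s.1.1, s.2.1⟩, ⟨s.1.2, s.2.2⟩)
      map_add' := fun _ _ => rfl
      map_smul' := fun _ _ => rfl }
  refine Module.Finite.of_injective T fun s t h => Subtype.ext (Prod.ext ?_ ?_)
  · exact congrArg (fun z => z.1.1) h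
  · exact congrArg (fun z => z.2.1) h

end Broken

end SimplicialMesh
end HHO

set_option linter.unusedSectionVars false
-- The gradient form on a cell and the local reconstruction problem
namespace HHO

variable {d : ℕ}

/-- The bilinear form `∫_K ∇f · ∇g`. -/
def gradForm (Ω : Set (E d)) (K : Finset (E d)) (f g : E d → ℝ) : ℝ :=
  cellInt Ω K (fun x => inner ℝ (∇ f x) (∇ g x))

section GradForm

variable {Ω : Set (E d)} [IsFiniteMeasure (vol Ω)] {K : Finset (E d)} {k l m : ℤ}
  {f g h : E d → ℝ}

theorem memLp_gradient_cell (hf : f ∈ polyFun d k) :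
    MemLp (∇ f) 2 ((vol Ω).restrict (hull K)) :=
  memLp_of_continuous (continuous_gradient_of_mem_polyFun hf)

theorem gradForm_comm (f g : E d → ℝ) : gradForm Ω K f g = gradForm Ω K g f := by
  simp only [gradForm, real_inner_comm]

theorem gradForm_add_left (hf : f ∈ polyFun d k) (hg : g ∈ polyFun d k) (hh : h ∈ polyFun d l) :
    gradForm Ω K (f + g) h = gradForm Ω K f h + gradForm Ω K g h := by
  simp only [gradForm, cellInt]
  rw [← integral_add (integrable_inner_of_memLp (memLp_gradient_cell hf) (memLp_gradient_cell hh))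
    (integrable_inner_of_memLp (memLp_gradient_cell hg) (memLp_gradient_cell hh)),
    gradient_add ((contDiff_of_mem_polyFun hf (n := 1)).differentiable (by simp))
    ((contDiff_of_mem_polyFun hg (n := 1)).differentiable (by simp))]
  simp only [Pi.add_apply, inner_add_left]

theorem gradForm_smul_left (c : ℝ) (hf : f ∈ polyFun d k) :
    gradForm Ω K (c • f) h = c * gradForm Ω K f h := by
  simp only [gradForm, cellInt]
  rw [← integral_const_mul,
    gradient_smul c ((contDiff_of_mem_polyFun hf (n := 1)).differentiable (by simp))]
  simp only [Pi.smul_apply, real_inner_smul_left]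

theorem gradForm_self_nonneg (f : E d → ℝ) : 0 ≤ gradForm Ω K f f :=
  integral_nonneg fun _ => real_inner_self_nonneg

theorem gradForm_const_right (c : ℝ) : gradForm Ω K f (fun _ => c) = 0 := by
  simp [gradForm, cellInt]

theorem gradient_ae_eq_zero (hf : f ∈ polyFun d k) (h0 : gradForm Ω K f f = 0) :
    ∇ f =ᵐ[(vol Ω).restrict (hull K)] 0 := by
  filter_upwards [(integral_eq_zero_iff_of_nonneg (fun x => real_inner_self_nonneg)
    (integrable_inner_of_memLp (memLp_gradient_cell hf) (memLp_gradient_cell hf))).1 h0] with x hx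
  exact inner_self_eq_zero.1 hx

end GradForm

namespace SimplicialMesh

variable {Ω : Set (E d)} {M : SimplicialMesh Ω}

theorem gradient_eq_of_ae (M : SimplicialMesh Ω) (hreg : interior (closure Ω) = Ω)
    {K : Finset (E d)} (hK : K ∈ M.cells) {k : ℤ} {f g : E d → ℝ} (hf : f ∈ polyFun d k)
    (hg : g ∈ polyFun d k) (h : ∇ f =ᵐ[(vol Ω).restrict (hull K)] ∇ g) :
    ∃ c, f = g + fun _ => c := by
  have hfg := Submodule.sub_mem _ hf hg
  have hd : ∀ {q : E d → ℝ}, q ∈ polyFun d k → Differentiable ℝ q := fun hq =>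
    (contDiff_of_mem_polyFun hq (n := 1)).differentiable (by simp)
  have h1 : ∀ v, (fun x => fderiv ℝ (f - g) x v) = 0 := by
    intro v
    refine M.eq_zero_of_ae_cell hreg hK (fderiv_mem_polyFun hfg v) ?_
    filter_upwards [h] with x hx
    rw [← inner_gradient, gradient_sub (hd hf) (hd hg), Pi.sub_apply, hx, sub_self,
      inner_zero_left, Pi.zero_apply]
  obtain ⟨c, hc⟩ := eq_const_of_fderiv_eq_zero hfg fun x =>
    ContinuousLinearMap.ext fun v => congrFun (h1 v) x
  exact ⟨c, by rw [← hc]; abel⟩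

theorem eq_const_of_gradForm_eq_zero [IsFiniteMeasure (vol Ω)] (M : SimplicialMesh Ω)
    (hreg : interior (closure Ω) = Ω) {K : Finset (E d)} (hK : K ∈ M.cells) {k : ℤ}
    {f : E d → ℝ} (hf : f ∈ polyFun d k) (h : gradForm Ω K f f = 0) : ∃ c, f = fun _ => c := by
  obtain ⟨c, hc⟩ := M.gradient_eq_of_ae hreg hK hf (Submodule.zero_mem _) (by
    rw [show (0 : E d → ℝ) = fun _ => 0 from rfl, gradient_fun_const]
    exact gradient_ae_eq_zero hf h)
  exact ⟨c, by rw [hc, zero_add]⟩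

theorem measureReal_cell_pos (M : SimplicialMesh Ω) (hreg : interior (closure Ω) = Ω)
    {K : Finset (E d)} (hK : K ∈ M.cells) : 0 < ((vol Ω).restrict (hull K)).real univ := by
  rw [M.restrict_hull hreg hK, measureReal_restrict_apply_univ]
  refine ENNReal.toReal_pos (Measure.measure_pos_of_nonempty_interior _
    (M.isSimplex hK).interior_nonempty).ne' (isCompact_hull K).measure_lt_top.ne

theorem cellInt_const (c : ℝ) (K : Finset (E d)) :
    cellInt Ω K (fun _ => c) = ((vol Ω).restrict (hull K)).real univ * c := by
  rw [cellInt, integral_const, smul_eq_mul]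

theorem eq_zero_of_cellInt_const (M : SimplicialMesh Ω) (hreg : interior (closure Ω) = Ω)
    {K : Finset (E d)} (hK : K ∈ M.cells) {c : ℝ} (h : cellInt Ω K (fun _ => c) = 0) : c = 0 := by
  rw [cellInt_const] at h
  exact (mul_eq_zero.1 h).resolve_left (M.measureReal_cell_pos hreg hK).ne'

/-! ### The reconstruction on a cell -/

/-- The right-hand side in the definition of the reconstruction. -/
def reconRhs (M : SimplicialMesh Ω) (s : M.Pairs) (K : Finset (E d)) (q : E d → ℝ) : ℝ :=
  -cellInt Ω K (fun x => s.1 x * (Δ q) x) +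
    ∑ F ∈ facets K, M.faceInt F (fun x => s.2 x * inner ℝ (∇ q x) (outerNormal K F))

/-- The polynomial `g` is the reconstruction of `s` on the cell `K`. -/
structure IsLocalRecon (M : SimplicialMesh Ω) (p : ℕ) (s : M.Pairs) (K : Finset (E d))
    (g : E d → ℝ) : Prop where
  mem : g ∈ polyFun d (p + 1)
  grad_eq : ∀ q ∈ polyFun d (p + 1), gradForm Ω K g q = M.reconRhs s K q
  mean_eq : cellInt Ω K g = cellInt Ω K (fun x => s.1 x)

section Recon

variable [NeZero d] [IsFiniteMeasure (vol Ω)] {p : ℕ} {K : Finset (E d)} {k : ℤ}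

theorem memLp_gradient_normal {q : E d → ℝ} (hq : q ∈ polyFun d k) (n : E d) (F : Finset (E d)) :
    MemLp (fun x => inner ℝ (∇ q x) n) 2 (M.surf.restrict (hull F)) :=
  memLp_of_continuous ((continuous_gradient_of_mem_polyFun hq).inner continuous_const)

theorem memLp_laplacian {q : E d → ℝ} (hq : q ∈ polyFun d k) (K : Finset (E d)) :
    MemLp (Δ q) 2 ((vol Ω).restrict (hull K)) :=
  memLp_of_continuous (continuous_laplacian_of_mem_polyFun hq)

theorem reconRhs_add_right (s : M.Pairs) {q r : E d → ℝ} (hq : q ∈ polyFun d k)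
    (hr : r ∈ polyFun d k) : M.reconRhs s K (q + r) = M.reconRhs s K q + M.reconRhs s K r := by
  simp only [reconRhs, cellInt, faceInt]
  rw [laplacian_add_fun (contDiff_of_mem_polyFun hq) (contDiff_of_mem_polyFun hr),
    gradient_add ((contDiff_of_mem_polyFun hq (n := 1)).differentiable (by simp))
    ((contDiff_of_mem_polyFun hr (n := 1)).differentiable (by simp))]
  simp only [Pi.add_apply, inner_add_left]
  rw [integral_mul_add (memLp_restrict s.1 _) (memLp_laplacian hq K) (memLp_laplacian hr K),
    Finset.sum_congr rfl fun F _ => integral_mul_add (memLp_restrict s.2 (hull F))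
      (memLp_gradient_normal hq (outerNormal K F) F) (memLp_gradient_normal hr (outerNormal K F) F),
    Finset.sum_add_distrib]
  ring

theorem reconRhs_smul_right (s : M.Pairs) (c : ℝ) {q : E d → ℝ} (hq : q ∈ polyFun d k) :
    M.reconRhs s K (c • q) = c * M.reconRhs s K q := by
  simp only [reconRhs, cellInt, faceInt]
  rw [laplacian_smul_fun c (contDiff_of_mem_polyFun hq),
    gradient_smul c ((contDiff_of_mem_polyFun hq (n := 1)).differentiable (by simp))]
  simp only [Pi.smul_apply, real_inner_smul_left, smul_eq_mul]
  rw [integral_mul_const_mul, Finset.sum_congr rfl fun F _ => integral_mul_const_mul _ _ _,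
    ← Finset.mul_sum]
  ring

theorem reconRhs_add_left (s t : M.Pairs) {q : E d → ℝ} (hq : q ∈ polyFun d k) :
    M.reconRhs (s + t) K q = M.reconRhs s K q + M.reconRhs t K q := by
  simp only [reconRhs, cellInt, faceInt, Prod.fst_add, Prod.snd_add]
  rw [setIntegral_Lp_add_mul s.1 t.1 (memLp_laplacian hq K),
    Finset.sum_congr rfl fun F _ => setIntegral_Lp_add_mul s.2 t.2
      (memLp_gradient_normal hq (outerNormal K F) F), Finset.sum_add_distrib]
  ring

theorem reconRhs_smul_left (c : ℝ) (s : M.Pairs) (q : E d → ℝ) :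
    M.reconRhs (c • s) K q = c * M.reconRhs s K q := by
  simp only [reconRhs, cellInt, faceInt, Prod.smul_fst, Prod.smul_snd]
  rw [setIntegral_Lp_smul_mul, Finset.sum_congr rfl fun F _ => setIntegral_Lp_smul_mul c s.2 _ _,
    ← Finset.mul_sum]
  ring

theorem reconRhs_const (s : M.Pairs) (c : ℝ) : M.reconRhs s K (fun _ => c) = 0 := by
  simp [reconRhs, cellInt, faceInt]

theorem cellInt_add {f g : E d → ℝ} (hf : f ∈ polyFun d k) (hg : g ∈ polyFun d k) :
    cellInt Ω K (f + g) = cellInt Ω K f + cellInt Ω K g :=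
  integral_add ((memLp_poly_cell K hf).integrable (by norm_num))
    ((memLp_poly_cell K hg).integrable (by norm_num))

theorem cellInt_smul (c : ℝ) (f : E d → ℝ) : cellInt Ω K (c • f) = c * cellInt Ω K f :=
  integral_const_mul c f

/-- The gradient form is blind to constants, so the product of the means is added to form and load.
The augmented form is definite, hence solvable. Testing with the constant 1, which both gradient
terms ignore, returns the mean condition; subtracting it leaves the gradient equation. -/
theorem exists_isLocalRecon (M : SimplicialMesh Ω) (hreg : interior (closure Ω) = Ω)
    (hK : K ∈ M.cells) (s : M.Pairs) : ∃ g, M.IsLocalRecon p s K g := by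
  set V := polyFun d (p + 1)
  have hadd : ∀ a b c : V, gradForm Ω K (a + b).1 c + cellInt Ω K (a + b).1 * cellInt Ω K c =
      gradForm Ω K a c + cellInt Ω K a * cellInt Ω K c +
      (gradForm Ω K b c + cellInt Ω K b * cellInt Ω K c) := by
    intro a b c
    rw [Submodule.coe_add, gradForm_add_left a.2 b.2 c.2, cellInt_add a.2 b.2]
    ring
  have hsmul : ∀ (t : ℝ) (a c : V), gradForm Ω K (t • a).1 c + cellInt Ω K (t • a).1 * cellInt Ω K c
      = t • (gradForm Ω K a c + cellInt Ω K a * cellInt Ω K c) := by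
    intro t a c
    rw [Submodule.coe_smul, gradForm_smul_left t a.2, cellInt_smul, smul_eq_mul]
    ring
  have hcomm : ∀ a b : V, gradForm Ω K a b + cellInt Ω K a * cellInt Ω K b =
      gradForm Ω K b a + cellInt Ω K b * cellInt Ω K a := by
    intro a b
    rw [gradForm_comm, mul_comm]
  obtain ⟨g, hg⟩ := exists_repr
    (LinearMap.mk₂ ℝ (fun a b : V => gradForm Ω K a b + cellInt Ω K a * cellInt Ω K b) hadd hsmul
      (fun a b c => by rw [hcomm a (b + c), hcomm a b, hcomm a c]; exact hadd b c a)
      (fun t a b => by rw [hcomm a (t • b), hcomm a b]; exact hsmul t b a))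
    hcomm
    { toFun := fun a : V => M.reconRhs s K a + cellInt Ω K (fun x => s.1 x) * cellInt Ω K a
      map_add' := fun a b => by
        rw [Submodule.coe_add, reconRhs_add_right s a.2 b.2, cellInt_add a.2 b.2]
        ring
      map_smul' := fun t a => by
        rw [Submodule.coe_smul, reconRhs_smul_right s t a.2, cellInt_smul, RingHom.id_apply,
          smul_eq_mul]
        ring }
    (fun a ha => by
      simp only [LinearMap.mk₂_apply] at ha
      have h1 := gradForm_self_nonneg (Ω := Ω) (K := K) a.1
      have h2 := mul_self_nonneg (cellInt Ω K a.1)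
      obtain ⟨c, hc⟩ := M.eq_const_of_gradForm_eq_zero hreg hK a.2 (by linarith)
      have h3 : cellInt Ω K a.1 = 0 := mul_self_eq_zero.1 (by linarith)
      simp only [LinearMap.coe_mk, AddHom.coe_mk]
      rw [h3, hc, reconRhs_const]
      ring)
  have hg' : ∀ r ∈ V, gradForm Ω K g r + cellInt Ω K g * cellInt Ω K r =
      M.reconRhs s K r + cellInt Ω K (fun x => s.1 x) * cellInt Ω K r := fun r hr => hg ⟨r, hr⟩
  have hmean : cellInt Ω K g = cellInt Ω K (fun x => s.1 x) := by
    have h1 := hg' _ (const_mem_polyFun (by positivity) 1)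
    rw [reconRhs_const, gradForm_const_right, zero_add, zero_add, cellInt_const, mul_one] at h1
    exact mul_right_cancel₀ (M.measureReal_cell_pos hreg hK).ne' h1
  refine ⟨g, g.2, fun q hq => ?_, hmean⟩
  have := hg' q hq
  rw [hmean] at this
  exact add_right_cancel this

theorem IsLocalRecon.add {s t : M.Pairs} {f g : E d → ℝ} (hf : M.IsLocalRecon p s K f)
    (hg : M.IsLocalRecon p t K g) : M.IsLocalRecon p (s + t) K (f + g) where
  mem := Submodule.add_mem _ hf.mem hg.mem
  grad_eq q hq := by
    rw [gradForm_add_left hf.mem hg.mem hq, reconRhs_add_left s t hq, hf.grad_eq q hq,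
      hg.grad_eq q hq]
  mean_eq := by
    rw [cellInt_add hf.mem hg.mem, hf.mean_eq, hg.mean_eq]
    have := setIntegral_Lp_add_mul s.1 t.1 (S := hull K) (memLp_const (1 : ℝ))
    simp only [mul_one] at this
    exact this.symm

theorem IsLocalRecon.smul (c : ℝ) {s : M.Pairs} {f : E d → ℝ} (hf : M.IsLocalRecon p s K f) :
    M.IsLocalRecon p (c • s) K (c • f) where
  mem := Submodule.smul_mem _ c hf.mem
  grad_eq q hq := by
    rw [gradForm_smul_left c hf.mem, reconRhs_smul_left, hf.grad_eq q hq]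
  mean_eq := by
    rw [cellInt_smul, hf.mean_eq]
    have := setIntegral_Lp_smul_mul c s.1 (hull K) (fun _ => 1)
    simp only [mul_one] at this
    exact this.symm

/-- The difference reconstructs zero data. It has no energy, so it is constant, and its mean is
zero. Linearity of R follows from this uniqueness. -/
theorem IsLocalRecon.unique (hreg : interior (closure Ω) = Ω) (hK : K ∈ M.cells) {s : M.Pairs}
    {f g : E d → ℝ} (hf : M.IsLocalRecon p s K f) (hg : M.IsLocalRecon p s K g) : f = g := by
  have h := hf.add (hg.smul (-1))
  have h0 : s + (-1 : ℝ) • s = 0 := by simp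
  rw [h0] at h
  obtain ⟨c, hc⟩ := M.eq_const_of_gradForm_eq_zero hreg hK h.mem (by
    rw [h.grad_eq _ h.mem, ← zero_smul ℝ (0 : M.Pairs), reconRhs_smul_left, zero_mul])
  have h1 := h.mean_eq
  rw [hc, ← zero_smul ℝ (0 : M.Pairs)] at h1
  have h2 := setIntegral_Lp_smul_mul (μ := vol Ω) 0 (0 : M.Pairs).1 (hull K) (fun _ => 1)
  simp only [mul_one, zero_mul] at h2
  have hc0 := M.eq_zero_of_cellInt_const hreg hK (h1.trans h2)
  have h3 : f + (-1 : ℝ) • g = 0 := by rw [hc, hc0]; rfl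
  rw [neg_one_smul, ← sub_eq_add_neg] at h3
  exact sub_eq_zero.1 h3

theorem recon_spec (M : SimplicialMesh Ω) (hreg : interior (closure Ω) = Ω) (s : M.space p) :
    M.IsRecon p s.1 (M.recon p s) := by
  refine Classical.epsilon_spec ?_
  have h : ∀ K, ∃ g, K ∈ M.cells → M.IsLocalRecon p s.1 K g := by
    intro K
    by_cases hK : K ∈ M.cells
    · obtain ⟨g, hg⟩ := M.exists_isLocalRecon (p := p) hreg hK s.1
      exact ⟨g, fun _ => hg⟩
    · exact ⟨0, fun h => absurd h hK⟩
  choose q hq using h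
  obtain ⟨f, hf, hfq⟩ := M.exists_brokenPoly (k := p + 1) fun K hK => (hq K hK).mem
  refine ⟨f, hf, fun K hK => ?_⟩
  rw [M.cellPoly_eq hreg hK (hq K hK).mem (hfq K hK)]
  refine ⟨(hq K hK).grad_eq, ?_⟩
  rw [← (hq K hK).mean_eq]
  exact integral_congr_ae (hfq K hK)

theorem recon_mem (M : SimplicialMesh Ω) (hreg : interior (closure Ω) = Ω) (s : M.space p) :
    M.recon p s ∈ M.brokenPoly (p + 1) := (M.recon_spec hreg s).1

/-- The reconstruction of `s` on the cell `K`. -/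
def recPoly (M : SimplicialMesh Ω) {p : ℕ} (s : M.space p) (K : Finset (E d)) : E d → ℝ :=
  cellPoly (M.recon p s) K

theorem isLocalRecon_recPoly (M : SimplicialMesh Ω) (hreg : interior (closure Ω) = Ω)
    (hK : K ∈ M.cells) (s : M.space p) : M.IsLocalRecon p s.1 K (M.recPoly s K) := by
  have h := (M.recon_spec hreg s).2 K hK
  refine ⟨cellPoly_mem hreg hK (M.recon_mem hreg s), h.1, ?_⟩
  rw [← h.2]
  exact (integral_congr_ae (ae_eq_cellPoly hreg hK (M.recon_mem hreg s))).symm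

theorem recPoly_mem (M : SimplicialMesh Ω) (hreg : interior (closure Ω) = Ω) (hK : K ∈ M.cells)
    (s : M.space p) : M.recPoly s K ∈ polyFun d (p + 1) := (M.isLocalRecon_recPoly hreg hK s).mem

theorem recPoly_add (M : SimplicialMesh Ω) (hreg : interior (closure Ω) = Ω) (hK : K ∈ M.cells)
    (s t : M.space p) : M.recPoly (s + t) K = M.recPoly s K + M.recPoly t K :=
  (M.isLocalRecon_recPoly hreg hK (s + t)).unique hreg hK
    ((M.isLocalRecon_recPoly hreg hK s).add (M.isLocalRecon_recPoly hreg hK t))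

theorem recPoly_smul (M : SimplicialMesh Ω) (hreg : interior (closure Ω) = Ω) (hK : K ∈ M.cells)
    (c : ℝ) (s : M.space p) : M.recPoly (c • s) K = c • M.recPoly s K :=
  (M.isLocalRecon_recPoly hreg hK (c • s)).unique hreg hK ((M.isLocalRecon_recPoly hreg hK s).smul c)

theorem recon_add (M : SimplicialMesh Ω) (hreg : interior (closure Ω) = Ω) (s t : M.space p) :
    M.recon p (s + t) = M.recon p s + M.recon p t := by
  refine M.L2_ext hreg fun K hK => ?_
  refine (ae_eq_cellPoly hreg hK (M.recon_mem hreg (s + t))).trans ?_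
  refine Filter.EventuallyEq.trans (Filter.EventuallyEq.of_eq ?_) (ae_eq_cellPoly hreg hK
    (Submodule.add_mem _ (M.recon_mem hreg s) (M.recon_mem hreg t))).symm
  rw [cellPoly_add hreg hK (M.recon_mem hreg s) (M.recon_mem hreg t)]
  exact M.recPoly_add hreg hK s t

theorem recon_smul (M : SimplicialMesh Ω) (hreg : interior (closure Ω) = Ω) (c : ℝ)
    (s : M.space p) : M.recon p (c • s) = c • M.recon p s := by
  refine M.L2_ext hreg fun K hK => ?_
  refine (ae_eq_cellPoly hreg hK (M.recon_mem hreg (c • s))).trans ?_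
  refine Filter.EventuallyEq.trans (Filter.EventuallyEq.of_eq ?_) (ae_eq_cellPoly hreg hK
    (Submodule.smul_mem _ c (M.recon_mem hreg s))).symm
  rw [cellPoly_smul hreg hK c (M.recon_mem hreg s)]
  exact M.recPoly_smul hreg hK c s

end Recon

end SimplicialMesh
end HHO

namespace HHO

variable {d : ℕ}

namespace SimplicialMesh

variable {Ω : Set (E d)} {M : SimplicialMesh Ω} [NeZero d] [IsFiniteMeasure (vol Ω)] {p : ℕ}
  {K F : Finset (E d)}

/-! ### Orthogonal projections -/

theorem projCells_spec (M : SimplicialMesh Ω) (p : ℕ)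
    (f : L2 Ω) : M.projCells p f ∈ M.brokenPoly p ∧ ∀ K ∈ M.cells, ∀ q ∈ polyFun d p,
      cellInt Ω K (fun x => q x * M.projCells p f x) = cellInt Ω K (fun x => q x * f x) := by
  have h : ∀ K, ∃ g ∈ polyFun d p, ∀ r ∈ polyFun d p,
      cellInt Ω K (fun x => r x * g x) = cellInt Ω K (fun x => r x * f x) := fun K =>
    exists_proj (fun q hq => memLp_poly_cell K hq) (memLp_restrict f _)
  choose q hq hqf using h
  obtain ⟨g, hg, hgq⟩ := M.exists_brokenPoly fun K _ => hq K
  refine Classical.epsilon_spec (p := fun g => g ∈ M.brokenPoly p ∧ ∀ K ∈ M.cells,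
    ∀ q ∈ polyFun d p, cellInt Ω K (fun x => q x * g x) = cellInt Ω K (fun x => q x * f x))
    ⟨g, hg, fun K hK r hr => ?_⟩
  rw [← hqf K r hr]
  exact integral_congr_ae (by filter_upwards [hgq K hK] with x hx using by rw [hx])

theorem projCells_mem (M : SimplicialMesh Ω) (p : ℕ) (f : L2 Ω) :
    M.projCells p f ∈ M.brokenPoly p := (M.projCells_spec p f).1

theorem projCells_unique (M : SimplicialMesh Ω) (hreg : interior (closure Ω) = Ω) {f g : L2 Ω}
    (hg : g ∈ M.brokenPoly p) (h : ∀ K ∈ M.cells, ∀ q ∈ polyFun d p,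
      cellInt Ω K (fun x => q x * g x) = cellInt Ω K (fun x => q x * f x)) :
    M.projCells p f = g := by
  obtain ⟨h1, h2⟩ := M.projCells_spec p f
  refine M.L2_ext hreg fun K hK => ?_
  obtain ⟨q, hq, hq'⟩ := h1 K hK
  obtain ⟨r, hr, hr'⟩ := hg K hK
  refine hq'.trans (Filter.EventuallyEq.trans ?_ hr'.symm)
  refine ae_eq_of_moments (P := polyFun d p) (fun q hq => memLp_poly_cell K hq) hq hr
    fun s hs => ?_
  have h3 : cellInt Ω K (fun x => s x * M.projCells p f x) = cellInt Ω K (fun x => s x * q x) :=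
    integral_congr_ae (by filter_upwards [hq'] with x hx using by rw [hx])
  have h4 : cellInt Ω K (fun x => s x * g x) = cellInt Ω K (fun x => s x * r x) :=
    integral_congr_ae (by filter_upwards [hr'] with x hx using by rw [hx])
  exact h3.symm.trans ((h2 K hK s hs).trans ((h K hK s hs).symm.trans h4))

theorem projCells_add (M : SimplicialMesh Ω) (hreg : interior (closure Ω) = Ω) (f g : L2 Ω) :
    M.projCells p (f + g) = M.projCells p f + M.projCells p g := by
  obtain ⟨h1, h2⟩ := M.projCells_spec p f
  obtain ⟨h3, h4⟩ := M.projCells_spec p g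
  refine M.projCells_unique hreg (Submodule.add_mem _ h1 h3) fun K hK q hq => ?_
  have h5 := h2 K hK q hq
  have h6 := h4 K hK q hq
  simp only [cellInt, mul_comm (q _)] at h5 h6 ⊢
  rw [setIntegral_Lp_add_mul _ _ (memLp_poly_cell K hq),
    setIntegral_Lp_add_mul _ _ (memLp_poly_cell K hq), h5, h6]

theorem projCells_smul (M : SimplicialMesh Ω) (hreg : interior (closure Ω) = Ω) (c : ℝ)
    (f : L2 Ω) : M.projCells p (c • f) = c • M.projCells p f := by
  obtain ⟨h1, h2⟩ := M.projCells_spec p f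
  refine M.projCells_unique hreg (Submodule.smul_mem _ c h1) fun K hK q hq => ?_
  have h5 := h2 K hK q hq
  simp only [cellInt, mul_comm (q _)] at h5 ⊢
  rw [setIntegral_Lp_smul_mul, setIntegral_Lp_smul_mul, h5]

theorem projCells_eq_self (M : SimplicialMesh Ω) (hreg : interior (closure Ω) = Ω) {f : L2 Ω}
    (hf : f ∈ M.brokenPoly p) : M.projCells p f = f :=
  M.projCells_unique hreg hf fun _ _ _ _ => rfl

theorem projSkel_spec (M : SimplicialMesh Ω) (p : ℕ) (f : M.L2skel) :
    M.projSkel p f ∈ M.skelPoly p ∧ ∀ F ∈ M.interfaces, ∀ r ∈ polyFun d p,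
      M.faceInt F (fun x => r x * M.projSkel p f x) = M.faceInt F (fun x => r x * f x) := by
  have h : ∀ F, ∃ g ∈ polyFun d p, ∀ r ∈ polyFun d p,
      M.faceInt F (fun x => r x * g x) = M.faceInt F (fun x => r x * f x) := fun F =>
    exists_proj (fun q hq => memLp_poly_face F hq) (memLp_restrict f _)
  choose q hq hqf using h
  obtain ⟨g, hg, hgq⟩ := M.exists_skelPoly fun F _ => hq F
  refine Classical.epsilon_spec (p := fun g => g ∈ M.skelPoly p ∧ ∀ F ∈ M.interfaces,
    ∀ r ∈ polyFun d p, M.faceInt F (fun x => r x * g x) = M.faceInt F (fun x => r x * f x))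
    ⟨g, hg, fun F hF r hr => ?_⟩
  rw [← hqf F r hr]
  exact integral_congr_ae (by filter_upwards [hgq F hF] with x hx using by rw [hx])

theorem projFace_spec (M : SimplicialMesh Ω) (p : ℕ) {f : E d → ℝ}
    (hf : MemLp f 2 (M.surf.restrict (hull F))) :
    M.projFace p F f ∈ polyFun d p ∧ ∀ r ∈ polyFun d p,
      M.faceInt F (fun x => r x * M.projFace p F f x) = M.faceInt F (fun x => r x * f x) :=
  Classical.epsilon_spec (p := fun g => g ∈ polyFun d p ∧ ∀ r ∈ polyFun d p,
    M.faceInt F (fun x => r x * g x) = M.faceInt F (fun x => r x * f x))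
    (exists_proj (fun _ hq => memLp_poly_face F hq) hf)

/-! ### The stabilization -/

theorem brokenPoly_mono {k l : ℤ} (h : k ≤ l) : M.brokenPoly k ≤ M.brokenPoly l := by
  intro f hf K hK
  obtain ⟨q, hq, h1⟩ := hf K hK
  exact ⟨q, polyFun_mono h hq, h1⟩

theorem stabOp_mem (M : SimplicialMesh Ω) (hreg : interior (closure Ω) = Ω) (s : M.space p) :
    M.stabOp p s ∈ M.brokenPoly (p + 1) := by
  have h : M.brokenPoly (p : ℤ) ≤ M.brokenPoly (p + 1) := brokenPoly_mono (by lia)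
  exact Submodule.add_mem _ (h s.2.1) (Submodule.sub_mem _ (M.recon_mem hreg s)
    (h (M.projCells_mem p _)))

theorem stabOp_add (M : SimplicialMesh Ω) (hreg : interior (closure Ω) = Ω) (s t : M.space p) :
    M.stabOp p (s + t) = M.stabOp p s + M.stabOp p t := by
  simp only [stabOp, M.recon_add hreg, M.projCells_add hreg, Submodule.coe_add, Prod.fst_add]
  abel

theorem stabOp_smul (M : SimplicialMesh Ω) (hreg : interior (closure Ω) = Ω) (c : ℝ)
    (s : M.space p) : M.stabOp p (c • s) = c • M.stabOp p s := by
  simp only [stabOp, M.recon_smul hreg, M.projCells_smul hreg, Submodule.coe_smul, Prod.smul_fst,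
    smul_add, smul_sub]

/-- The difference of the face component and the trace of the stabilization operator. -/
def defect (M : SimplicialMesh Ω) (s : M.space p) (K : Finset (E d)) (x : E d) : ℝ :=
  s.1.2 x - cellPoly (M.stabOp p s) K x

theorem memLp_defect (M : SimplicialMesh Ω) (hreg : interior (closure Ω) = Ω) (hK : K ∈ M.cells)
    (F : Finset (E d)) (s : M.space p) : MemLp (M.defect s K) 2 (M.surf.restrict (hull F)) :=
  (memLp_restrict s.1.2 _).sub (memLp_poly_face F (cellPoly_mem hreg hK (M.stabOp_mem hreg s)))

theorem defect_add (M : SimplicialMesh Ω) (hreg : interior (closure Ω) = Ω) (hK : K ∈ M.cells)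
    (F : Finset (E d)) (s t : M.space p) :
    M.defect (s + t) K =ᵐ[M.surf.restrict (hull F)] fun x => M.defect s K x + M.defect t K x := by
  filter_upwards [ae_restrict_of_ae (Lp.coeFn_add s.1.2 t.1.2)] with x hx
  simp only [defect, M.stabOp_add hreg, cellPoly_add hreg hK (M.stabOp_mem hreg s)
    (M.stabOp_mem hreg t), Submodule.coe_add, Prod.snd_add, hx, Pi.add_apply]
  ring

theorem defect_smul (M : SimplicialMesh Ω) (hreg : interior (closure Ω) = Ω) (hK : K ∈ M.cells)
    (F : Finset (E d)) (c : ℝ) (s : M.space p) :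
    M.defect (c • s) K =ᵐ[M.surf.restrict (hull F)] fun x => c * M.defect s K x := by
  filter_upwards [ae_restrict_of_ae (Lp.coeFn_smul c s.1.2)] with x hx
  simp only [defect, M.stabOp_smul hreg, cellPoly_smul hreg hK c (M.stabOp_mem hreg s),
    Submodule.coe_smul, Prod.smul_snd, hx, Pi.smul_apply, smul_eq_mul]
  ring

/-- The projection of the defect onto polynomials on a face. -/
def faceDefect (M : SimplicialMesh Ω) (s : M.space p) (K F : Finset (E d)) : E d → ℝ :=
  M.projFace p F (M.defect s K)

theorem faceDefect_spec (M : SimplicialMesh Ω) (hreg : interior (closure Ω) = Ω)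
    (hK : K ∈ M.cells) (F : Finset (E d)) (s : M.space p) :
    M.faceDefect s K F ∈ polyFun d p ∧ ∀ r ∈ polyFun d p,
      M.faceInt F (fun x => r x * M.faceDefect s K F x) =
        M.faceInt F (fun x => r x * M.defect s K x) :=
  M.projFace_spec p (M.memLp_defect hreg hK F s)

variable {wt : Finset (E d) → ℝ}

/-- The first factor is already a polynomial of degree at most p, so the projection in the second
factor can be dropped. Bilinearity then needs no linearity of the chosen face projections, only of
the defect itself. -/
theorem stab_eq (M : SimplicialMesh Ω) (hreg : interior (closure Ω) = Ω) (s σ : M.space p) :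
    M.stab p wt s σ = ∑ K ∈ M.cells, ∑ F ∈ facets K,
      wt F * M.faceInt F (fun x => M.faceDefect s K F x * M.defect σ K x) := by
  refine Finset.sum_congr rfl fun K hK => Finset.sum_congr rfl fun F _ => ?_
  rw [← (M.faceDefect_spec hreg hK F σ).2 _ (M.faceDefect_spec hreg hK F s).1]
  rfl

theorem stab_comm (s σ : M.space p) : M.stab p wt s σ = M.stab p wt σ s := by
  refine Finset.sum_congr rfl fun K _ => Finset.sum_congr rfl fun F _ => ?_
  exact congrArg (wt F * M.faceInt F ·) (funext fun x => mul_comm _ _)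

theorem stab_add_right (M : SimplicialMesh Ω) (hreg : interior (closure Ω) = Ω)
    (s σ τ : M.space p) : M.stab p wt s (σ + τ) = M.stab p wt s σ + M.stab p wt s τ := by
  simp only [M.stab_eq hreg, ← Finset.sum_add_distrib, ← mul_add]
  refine Finset.sum_congr rfl fun K hK => Finset.sum_congr rfl fun F _ => ?_
  congr 1
  rw [faceInt, faceInt, faceInt, ← integral_mul_add
    (memLp_poly_face F (M.faceDefect_spec hreg hK F s).1) (M.memLp_defect hreg hK F σ)
    (M.memLp_defect hreg hK F τ)]
  refine integral_congr_ae ?_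
  filter_upwards [M.defect_add hreg hK F σ τ] with x hx
  rw [hx]

theorem stab_smul_right (M : SimplicialMesh Ω) (hreg : interior (closure Ω) = Ω) (c : ℝ)
    (s σ : M.space p) : M.stab p wt s (c • σ) = c * M.stab p wt s σ := by
  simp only [M.stab_eq hreg, Finset.mul_sum]
  refine Finset.sum_congr rfl fun K hK => Finset.sum_congr rfl fun F _ => ?_
  rw [mul_left_comm]
  congr 1
  rw [faceInt, faceInt, ← integral_mul_const_mul]
  refine integral_congr_ae ?_
  filter_upwards [M.defect_smul hreg hK F c σ] with x hx
  rw [hx]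

theorem stab_self_nonneg (hwt : ∀ F ∈ M.faces, 0 < wt F) (s : M.space p) :
    0 ≤ M.stab p wt s s :=
  Finset.sum_nonneg fun _ hK => Finset.sum_nonneg fun F hF =>
    mul_nonneg (hwt F ⟨_, hK, hF⟩).le (integral_nonneg fun _ => mul_self_nonneg _)

/-- The defects of `s` are orthogonal to polynomials on the faces. -/
def IsDefectFree (M : SimplicialMesh Ω) (s : M.space p) : Prop :=
  ∀ K ∈ M.cells, ∀ F ∈ facets K, ∀ r ∈ polyFun d p,
    M.faceInt F (fun x => r x * M.defect s K x) = 0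

/-- With positive weights every face term is a nonnegative square, so each projected defect vanishes
almost everywhere on its face. -/
theorem isDefectFree_of_stab_eq_zero (M : SimplicialMesh Ω) (hreg : interior (closure Ω) = Ω)
    (hwt : ∀ F ∈ M.faces, 0 < wt F) {s : M.space p} (h : M.stab p wt s s = 0) :
    M.IsDefectFree s := by
  intro K hK F hF r hr
  have h0 : ∀ K ∈ M.cells, ∀ F ∈ facets K,
      0 ≤ wt F * M.faceInt F (fun x => M.faceDefect s K F x * M.faceDefect s K F x) :=
    fun K hK F hF =>
      mul_nonneg (hwt F ⟨_, hK, hF⟩).le (integral_nonneg fun _ => mul_self_nonneg _)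
  have h1 := (Finset.sum_eq_zero_iff_of_nonneg fun K hK => Finset.sum_nonneg (h0 K hK)).1 h K hK
  have h2 := (Finset.sum_eq_zero_iff_of_nonneg (h0 K hK)).1 h1 F hF
  have h3 := (mul_eq_zero.1 h2).resolve_left (hwt F ⟨_, hK, hF⟩).ne'
  obtain ⟨h4, h5⟩ := M.faceDefect_spec hreg hK F s
  have h6 := ae_eq_zero_of_integral_mul_self (memLp_poly_face F h4) h3
  rw [← h5 r hr]
  refine integral_eq_zero_of_ae ?_
  filter_upwards [h6] with x hx
  rw [hx]
  simp

theorem IsDefectFree.stab_eq_zero (hreg : interior (closure Ω) = Ω) {s : M.space p}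
    (h : M.IsDefectFree s) (σ : M.space p) : M.stab p wt σ s = 0 := by
  rw [M.stab_eq hreg]
  refine Finset.sum_eq_zero fun K hK => Finset.sum_eq_zero fun F hF => ?_
  rw [h K hK F hF _ (M.faceDefect_spec hreg hK F σ).1, mul_zero]

/-! ### The bilinear form of the method -/

theorem bForm_eq (s σ : M.space p) : M.bForm p wt s σ =
    ∑ K ∈ M.cells, gradForm Ω K (M.recPoly s K) (M.recPoly σ K) + M.stab p wt s σ := rfl

theorem bForm_comm (s σ : M.space p) : M.bForm p wt s σ = M.bForm p wt σ s := by
  simp only [bForm_eq, stab_comm s, gradForm_comm (M.recPoly s _)]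

theorem bForm_add_left (M : SimplicialMesh Ω) (hreg : interior (closure Ω) = Ω)
    (s t σ : M.space p) : M.bForm p wt (s + t) σ = M.bForm p wt s σ + M.bForm p wt t σ := by
  simp only [bForm_eq, stab_comm _ σ, M.stab_add_right hreg]
  rw [Finset.sum_congr rfl fun K hK => show gradForm Ω K (M.recPoly (s + t) K) (M.recPoly σ K) =
    gradForm Ω K (M.recPoly s K) (M.recPoly σ K) + gradForm Ω K (M.recPoly t K) (M.recPoly σ K) by
      rw [M.recPoly_add hreg hK, gradForm_add_left (M.recPoly_mem hreg hK s)
        (M.recPoly_mem hreg hK t) (M.recPoly_mem hreg hK σ)], Finset.sum_add_distrib]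
  ring

theorem bForm_smul_left (M : SimplicialMesh Ω) (hreg : interior (closure Ω) = Ω) (c : ℝ)
    (s σ : M.space p) : M.bForm p wt (c • s) σ = c * M.bForm p wt s σ := by
  simp only [bForm_eq, stab_comm _ σ, M.stab_smul_right hreg]
  rw [Finset.sum_congr rfl fun K hK => show gradForm Ω K (M.recPoly (c • s) K) (M.recPoly σ K) =
    c * gradForm Ω K (M.recPoly s K) (M.recPoly σ K) by
      rw [M.recPoly_smul hreg hK, gradForm_smul_left c (M.recPoly_mem hreg hK s)],
    ← Finset.mul_sum]
  ring

/-- The form of the method as a bilinear map. -/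
def bLin (M : SimplicialMesh Ω) (hreg : interior (closure Ω) = Ω) (p : ℕ)
    (wt : Finset (E d) → ℝ) : M.space p →ₗ[ℝ] M.space p →ₗ[ℝ] ℝ :=
  LinearMap.mk₂ ℝ (M.bForm p wt) (M.bForm_add_left hreg) (M.bForm_smul_left hreg)
    (fun s σ τ => by rw [bForm_comm s, bForm_comm s, bForm_comm s, M.bForm_add_left hreg])
    (fun c s σ => by rw [bForm_comm s, bForm_comm s, M.bForm_smul_left hreg, smul_eq_mul])

theorem bLin_apply (hreg : interior (closure Ω) = Ω) (s σ : M.space p) :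
    M.bLin hreg p wt s σ = M.bForm p wt s σ := rfl

theorem bForm_self_nonneg (hwt : ∀ F ∈ M.faces, 0 < wt F) (s : M.space p) :
    0 ≤ M.bForm p wt s s :=
  add_nonneg (Finset.sum_nonneg fun _ _ => gradForm_self_nonneg _) (stab_self_nonneg hwt s)

theorem gradForm_eq_zero_of_bForm (hwt : ∀ F ∈ M.faces, 0 < wt F) {s : M.space p}
    (h : M.bForm p wt s s = 0) (hK : K ∈ M.cells) :
    gradForm Ω K (M.recPoly s K) (M.recPoly s K) = 0 := by
  have h0 : ∀ K ∈ M.cells, 0 ≤ gradForm Ω K (M.recPoly s K) (M.recPoly s K) :=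
    fun _ _ => gradForm_self_nonneg _
  have h1 := Finset.sum_nonneg h0
  have h2 := stab_self_nonneg hwt s
  rw [bForm_eq] at h
  exact (Finset.sum_eq_zero_iff_of_nonneg h0).1 (by linarith) K hK

theorem stab_eq_zero_of_bForm (hwt : ∀ F ∈ M.faces, 0 < wt F) {s : M.space p}
    (h : M.bForm p wt s s = 0) : M.stab p wt s s = 0 := by
  have h1 := Finset.sum_nonneg fun K (_ : K ∈ M.cells) =>
    gradForm_self_nonneg (Ω := Ω) (K := K) (M.recPoly s K)
  have h2 := stab_self_nonneg hwt s
  rw [bForm_eq] at h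
  linarith

end SimplicialMesh
end HHO

namespace HHO

variable {d : ℕ}

namespace SimplicialMesh

variable {Ω : Set (E d)} {M : SimplicialMesh Ω} [NeZero d] [IsFiniteMeasure (vol Ω)] {p : ℕ}
  {K F : Finset (E d)}

/-! ### Reconstructions and weak gradients -/

/-- The reconstruction is governed by the moments of cell and face components. -/
theorem cellInt_grad_eq_reconRhs (M : SimplicialMesh Ω) (hreg : interior (closure Ω) = Ω)
    (hK : K ∈ M.cells) {v : H10 Ω} {s : M.Pairs}
    (hc : ∀ q ∈ polyFun d ((p : ℤ) - 1),
      cellInt Ω K (fun x => q x * fn v x) = cellInt Ω K (fun x => q x * s.1 x))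
    (hf : ∀ F ∈ facets K, ∀ r ∈ polyFun d p,
      M.faceInt F (fun x => r x * M.trace v x) = M.faceInt F (fun x => r x * s.2 x))
    {q : E d → ℝ} (hq : q ∈ polyFun d (p + 1)) :
    cellInt Ω K (fun x => inner ℝ (grad v x) (∇ q x)) = M.reconRhs s K q := by
  have hqs : ContDiff ℝ ∞ q := contDiff_of_mem_polyFun hq
  have h1 := M.green hreg hK (contDiff_gradient hqs) (M.trace_mem hreg v)
  rw [← laplacian_eq_divg hqs] at h1
  -- The degrees drop to exactly the available moments: p − 1 for the Laplacian on the cell, and p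
  -- for the normal derivative on a facet. For p = 0 the Laplacian vanishes.
  have h2 : Δ q ∈ polyFun d ((p : ℤ) - 1) :=
    polyFun_mono (by lia) (laplacian_mem_polyFun hq)
  have h3 := hc _ h2
  have h4 : ∀ F ∈ facets K, M.faceInt F (fun x => M.trace v x * inner ℝ (∇ q x) (outerNormal K F)) =
      M.faceInt F (fun x => s.2 x * inner ℝ (∇ q x) (outerNormal K F)) := by
    intro F hF
    have h5 : (fun x => inner ℝ (∇ q x) (outerNormal K F)) ∈ polyFun d p := by
      simp only [inner_gradient]
      exact polyFun_mono (by lia) (fderiv_mem_polyFun hq _)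
    have := hf F hF _ h5
    simpa only [mul_comm (inner ℝ _ _)] using this
  simp only [mul_comm (Δ q _)] at h3
  rw [Finset.sum_congr rfl h4] at h1
  rw [reconRhs, ← h3]
  have h6 : cellInt Ω K (fun x => inner ℝ (grad v x) (∇ q x)) +
    cellInt Ω K (fun x => fn v x * (Δ q) x) = _ := h1
  linarith

/-- Extends moment equality from interfaces to all facets: on a boundary face both the trace and the
discrete face component are zero. -/
theorem moments_facets (M : SimplicialMesh Ω) (hreg : interior (closure Ω) = Ω)
    (hK : K ∈ M.cells) {v : H10 Ω} {s : M.space p}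
    (hf : ∀ F ∈ M.interfaces, ∀ r ∈ polyFun d p,
      M.faceInt F (fun x => r x * M.trace v x) = M.faceInt F (fun x => r x * s.1.2 x))
    (hF : F ∈ facets K) {r : E d → ℝ} (hr : r ∈ polyFun d p) :
    M.faceInt F (fun x => r x * M.trace v x) = M.faceInt F (fun x => r x * s.1.2 x) := by
  by_cases h : F ∈ M.interfaces
  · exact hf F h r hr
  · have hb : F ∈ M.boundaryFaces := ⟨⟨K, hK, hF⟩, h⟩
    refine integral_congr_ae ?_
    filter_upwards [trace_ae_eq_zero (isOpen_of_regular hreg) hb (M.trace_mem hreg v),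
      s.2.2.2 F hb] with x h1 h2
    rw [h1, h2]

/-- If the moments of `s` are those of a piecewise polynomial `u ∈ H^1_0(Ω)`, then `s` is
reconstructed to `u`, without defect. -/
theorem recPoly_of_moments (M : SimplicialMesh Ω) (hreg : interior (closure Ω) = Ω) {u : H10 Ω}
    {s : M.space p} {Q : Finset (E d) → E d → ℝ} (hQ : ∀ K ∈ M.cells, Q K ∈ polyFun d (p + 1))
    (hu : ∀ K ∈ M.cells, fn u =ᵐ[(vol Ω).restrict (hull K)] Q K)
    (hc : ∀ K ∈ M.cells, ∀ q ∈ polyFun d p,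
      cellInt Ω K (fun x => q x * fn u x) = cellInt Ω K (fun x => q x * s.1.1 x))
    (hf : ∀ F ∈ M.interfaces, ∀ r ∈ polyFun d p,
      M.faceInt F (fun x => r x * M.trace u x) = M.faceInt F (fun x => r x * s.1.2 x)) :
    (∀ K ∈ M.cells, grad u =ᵐ[(vol Ω).restrict (hull K)] ∇ (M.recPoly s K)) ∧
      M.IsDefectFree s := by
  have hΩ := isOpen_of_regular hreg
  have hgrad : ∀ K ∈ M.cells, grad u =ᵐ[(vol Ω).restrict (hull K)] ∇ (Q K) := fun K hK =>
    grad_ae_eq hΩ hreg hK (contDiff_of_mem_polyFun (hQ K hK)) (M.trace_mem hreg u) (hu K hK)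
  -- The polynomial `Q K` satisfies the defining conditions of the reconstruction by Green's
  -- formula. The mean condition uses the degree-zero moment, available because cell moments up to
  -- degree p are assumed here.
  have hrec : ∀ K ∈ M.cells, M.recPoly s K = Q K := by
    intro K hK
    refine (M.isLocalRecon_recPoly hreg hK s).unique hreg hK ⟨hQ K hK, fun r hr => ?_, ?_⟩
    · rw [← M.cellInt_grad_eq_reconRhs hreg hK
        (fun q hq => hc K hK q (polyFun_mono (by lia) hq))
        (fun F hF r hr => M.moments_facets hreg hK hf hF hr) hr]
      exact integral_congr_ae (by filter_upwards [hgrad K hK] with x hx using by rw [hx])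
    · have h1 := hc K hK _ (const_mem_polyFun (by positivity) 1)
      simp only [one_mul] at h1
      rw [← h1]
      exact (integral_congr_ae (hu K hK)).symm
  refine ⟨fun K hK => hrec K hK ▸ hgrad K hK, fun K hK F hF r hr => ?_⟩
  have hR : M.recon p s = fn u := M.L2_ext hreg fun K hK =>
    (ae_eq_cellPoly hreg hK (M.recon_mem hreg s)).trans
      ((Filter.EventuallyEq.of_eq (hrec K hK)).trans (hu K hK).symm)
  -- The reconstruction is u, whose cell moments of degree at most p are those of s. Hence its
  -- projection is the cell component and S s = R s = u, whose trace has the face moments of s.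
  have hP : M.projCells p (M.recon p s) = s.1.1 :=
    M.projCells_unique hreg s.2.1 fun K hK q hq => by rw [hR, hc K hK q hq]
  have hS : M.stabOp p s = M.recon p s := by rw [stabOp, hP]; abel
  have h1 : cellPoly (M.stabOp p s) K = Q K := by rw [hS]; exact hrec K hK
  have h2 := M.moments_facets hreg hK hf hF hr
  have h3 := trace_ae_eq hΩ hreg hK hF (contDiff_of_mem_polyFun (hQ K hK)) (M.trace_mem hreg u)
    (hu K hK)
  have h4 : M.faceInt F (fun x => r x * M.trace u x) = M.faceInt F (fun x => r x * Q K x) :=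
    integral_congr_ae (by filter_upwards [h3] with x hx using by rw [hx])
  simp only [defect, h1, faceInt]
  rw [integral_mul_sub (memLp_poly_face F hr) (memLp_restrict s.1.2 _)
    (memLp_poly_face F (hQ K hK))]
  exact sub_eq_zero.2 (h2.symm.trans h4)

/-! ### The extended form -/

theorem hat_add (M : SimplicialMesh Ω) (hreg : interior (closure Ω) = Ω) (v w : H10 Ω) :
    M.hat (v + w) = M.hat v + M.hat w := by
  rw [hat, hat, hat, M.trace_add hreg, Prod.mk_add_mk]
  congr 1

theorem hat_neg (M : SimplicialMesh Ω) (hreg : interior (closure Ω) = Ω) (v : H10 Ω) :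
    M.hat (-v) = -M.hat v := by
  have h := M.trace_smul hreg (-1) v
  rw [neg_one_smul ℝ v, neg_one_smul ℝ (M.trace v)] at h
  rw [hat, hat, h, Prod.neg_mk]
  congr 1

theorem hat_zero (M : SimplicialMesh Ω) (hreg : interior (closure Ω) = Ω) :
    M.hat (0 : H10 Ω) = 0 := by
  have h := M.hat_add hreg 0 0
  rw [add_zero] at h
  exact left_eq_add.1 h

theorem hat_sub (M : SimplicialMesh Ω) (hreg : interior (closure Ω) = Ω) (v w : H10 Ω) :
    M.hat (v - w) = M.hat v - M.hat w := by
  rw [sub_eq_add_neg, M.hat_add hreg, M.hat_neg hreg, sub_eq_add_neg]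

theorem gradient_recPoly_add (M : SimplicialMesh Ω) (hreg : interior (closure Ω) = Ω)
    (hK : K ∈ M.cells) (s t : M.space p) :
    ∇ (M.recPoly (s + t) K) = ∇ (M.recPoly s K) + ∇ (M.recPoly t K) := by
  rw [M.recPoly_add hreg hK, gradient_add
    ((contDiff_of_mem_polyFun (M.recPoly_mem hreg hK s) (n := 1)).differentiable (by simp))
    ((contDiff_of_mem_polyFun (M.recPoly_mem hreg hK t) (n := 1)).differentiable (by simp))]

theorem gradient_recPoly_neg (M : SimplicialMesh Ω) (hreg : interior (closure Ω) = Ω)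
    (hK : K ∈ M.cells) (s : M.space p) : ∇ (M.recPoly (-s) K) = -∇ (M.recPoly s K) := by
  rw [← neg_one_smul ℝ s, M.recPoly_smul hreg hK, gradient_smul _
    ((contDiff_of_mem_polyFun (M.recPoly_mem hreg hK s) (n := 1)).differentiable (by simp)),
    neg_one_smul]

variable {wt : Finset (E d) → ℝ}

theorem pairForm_eq (v w : H10 Ω) (s σ : M.space p) : M.pairForm p wt v s w σ =
    ∑ K ∈ M.cells, cellInt Ω K (fun x => inner ℝ (grad v x + ∇ (M.recPoly s K) x)
      (grad w x + ∇ (M.recPoly σ K) x)) + M.stab p wt s σ := rfl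

theorem pairForm_comm (v w : H10 Ω) (s σ : M.space p) :
    M.pairForm p wt v s w σ = M.pairForm p wt w σ v s := by
  simp only [pairForm_eq, stab_comm s σ]
  congr 1
  exact Finset.sum_congr rfl fun K _ =>
    congrArg (cellInt Ω K) (funext fun x => real_inner_comm _ _)

/-- The difference of the two decompositions is an H^1_0-function equal to a discrete pair, hence
piecewise polynomial of degree p. By `recPoly_of_moments` its gradient is that of the reconstruction
of the pair, and the pair has no defect, so neither part of the form changes. -/
theorem pairForm_congr_left (M : SimplicialMesh Ω) (hreg : interior (closure Ω) = Ω)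
    {v v' : H10 Ω} {s s' : M.space p} (h : M.hat v + s = M.hat v' + s') (w : H10 Ω)
    (σ : M.space p) : M.pairForm p wt v s w σ = M.pairForm p wt v' s' w σ := by
  have h0 : M.hat (v - v') = ((s' + -s : M.space p) : M.Pairs) := by
    rw [M.hat_sub hreg, Submodule.coe_add, Submodule.coe_neg, ← sub_eq_add_neg]
    exact sub_eq_sub_iff_add_eq_add.2 (by rw [h, add_comm])
  have h1 : fn (v - v') = (s' + -s : M.space p).1.1 := congrArg Prod.fst h0
  have h2 : M.trace (v - v') = (s' + -s : M.space p).1.2 := congrArg Prod.snd h0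
  obtain ⟨h3, h4⟩ := M.recPoly_of_moments hreg (u := v - v') (s := s' + -s)
    (Q := fun K => cellPoly (s' + -s : M.space p).1.1 K)
    (fun K hK => polyFun_mono (by lia) (cellPoly_mem hreg hK (s' + -s).2.1))
    (fun K hK => by rw [h1]; exact ae_eq_cellPoly hreg hK (s' + -s).2.1)
    (fun K _ q _ => by rw [h1]) (fun F _ r _ => by rw [h2])
  have h5 := h4.stab_eq_zero (wt := wt) hreg σ
  rw [M.stab_add_right hreg, ← neg_one_smul ℝ s, M.stab_smul_right hreg] at h5
  rw [pairForm_eq, pairForm_eq, stab_comm s, stab_comm s']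
  congr 1
  · refine Finset.sum_congr rfl fun K hK => integral_congr_ae ?_
    have h6 : grad (v - v') =ᵐ[(vol Ω).restrict (hull K)] fun x => grad v x - grad v' x :=
      ae_restrict_of_ae (Lp.coeFn_sub (grad v) (grad v'))
    filter_upwards [h3 K hK, h6] with x h7 h8
    rw [h8, M.gradient_recPoly_add hreg hK, M.gradient_recPoly_neg hreg hK, Pi.add_apply,
      Pi.neg_apply, ← sub_eq_add_neg, sub_eq_sub_iff_add_eq_add] at h7
    rw [h7, add_comm]
  · linarith

theorem aExt_eq (M : SimplicialMesh Ω) (hreg : interior (closure Ω) = Ω) (v w : H10 Ω)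
    (s σ : M.space p) :
    M.aExt p wt (M.hat v + s) (M.hat w + σ) = M.pairForm p wt v s w σ := by
  have hs : ∀ (v : H10 Ω) (s : M.space p), M.hat v + s =
      M.hat (M.split p (M.hat v + s)).1 + (M.split p (M.hat v + s)).2 := fun v s =>
    Classical.epsilon_spec (p := fun z : H10 Ω × M.space p => M.hat v + s = M.hat z.1 + z.2)
      ⟨(v, s), rfl⟩
  rw [aExt, ← M.pairForm_congr_left hreg (hs v s), pairForm_comm,
    ← M.pairForm_congr_left hreg (hs w σ), pairForm_comm]

theorem memLp_grad (v : H10 Ω) (K : Finset (E d)) :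
    MemLp (grad v) 2 ((vol Ω).restrict (hull K)) := (Lp.memLp (grad v)).restrict _

theorem memLp_gradient_recPoly (M : SimplicialMesh Ω) (hreg : interior (closure Ω) = Ω)
    (hK : K ∈ M.cells) (s : M.space p) :
    MemLp (∇ (M.recPoly s K)) 2 ((vol Ω).restrict (hull K)) :=
  memLp_gradient_cell (M.recPoly_mem hreg hK s)

theorem grad_zero_ae (K : Finset (E d)) :
    grad (0 : H10 Ω) =ᵐ[(vol Ω).restrict (hull K)] 0 :=
  ae_restrict_of_ae (Lp.coeFn_zero (E d) 2 (vol Ω))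

theorem grad_neg_ae (v : H10 Ω) (K : Finset (E d)) :
    grad (-v) =ᵐ[(vol Ω).restrict (hull K)] -grad v :=
  ae_restrict_of_ae (Lp.coeFn_neg (grad v))

/-- Both sides equal the right-hand side of the reconstruction problem tested with R s: one by
definition of R, the other by Green's formula and preservation of moments. -/
theorem gradForm_recPoly_eq (M : SimplicialMesh Ω) (hreg : interior (closure Ω) = Ω)
    (hK : K ∈ M.cells) {Es : M.space p →ₗ[ℝ] H10 Ω} {σ : M.space p}
    (h : M.PreservesMoments p Es σ) (s : M.space p) :
    gradForm Ω K (M.recPoly σ K) (M.recPoly s K) =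
      cellInt Ω K (fun x => inner ℝ (grad (Es σ) x) (∇ (M.recPoly s K) x)) := by
  rw [M.cellInt_grad_eq_reconRhs hreg hK (h.1 K hK)
    (fun F hF r hr => M.moments_facets hreg hK h.2 hF hr) (M.recPoly_mem hreg hK s),
    (M.isLocalRecon_recPoly hreg hK σ).grad_eq _ (M.recPoly_mem hreg hK s)]

/-- The key identity for moment-preserving smoothers. -/
theorem aExt_sub_smoother (M : SimplicialMesh Ω) (hreg : interior (closure Ω) = Ω)
    {Es : M.space p →ₗ[ℝ] H10 Ω} {σ : M.space p} (h : M.PreservesMoments p Es σ)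
    (s : M.space p) : M.aExt p wt s (σ - M.hat (Es σ)) = M.stab p wt s σ := by
  have h1 : (s : M.Pairs) = M.hat 0 + s := by rw [M.hat_zero hreg, zero_add]
  have h2 : (σ : M.Pairs) - M.hat (Es σ) = M.hat (-Es σ) + σ := by
    rw [M.hat_neg hreg, sub_eq_neg_add]
  rw [h2]
  conv_lhs => rw [h1]
  rw [M.aExt_eq hreg, pairForm_eq, add_eq_right]
  refine Finset.sum_eq_zero fun K hK => ?_
  have h4 := M.gradForm_recPoly_eq hreg hK h s
  rw [gradForm, ← sub_eq_zero, cellInt, cellInt, ← integral_sub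
    (integrable_inner_of_memLp (M.memLp_gradient_recPoly hreg hK σ)
      (M.memLp_gradient_recPoly hreg hK s))
    (integrable_inner_of_memLp (memLp_grad (Es σ) K) (M.memLp_gradient_recPoly hreg hK s))] at h4
  rw [← h4]
  refine integral_congr_ae ?_
  filter_upwards [grad_zero_ae K, grad_neg_ae (Es σ) K] with x h5 h6
  rw [h5, h6, Pi.zero_apply, zero_add, Pi.neg_apply, ← inner_sub_left, real_inner_comm,
    neg_add_eq_sub]

end SimplicialMesh
end HHO

namespace HHO

variable {d : ℕ}

theorem divg_id (x : E d) : divg (fun y : E d => y) x = d := by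
  simp [divg]

namespace SimplicialMesh

variable {Ω : Set (E d)} {M : SimplicialMesh Ω} [NeZero d] [IsFiniteMeasure (vol Ω)] {p : ℕ}
  {K F : Finset (E d)}

/-! ### Definiteness of the form of the method -/

theorem gradForm_eq_green (M : SimplicialMesh Ω) (hreg : interior (closure Ω) = Ω)
    (hK : K ∈ M.cells) {k l : ℤ} {q r : E d → ℝ} (hq : q ∈ polyFun d k) (hr : r ∈ polyFun d l) :
    gradForm Ω K q r = -cellInt Ω K (fun x => q x * (Δ r) x) +
      ∑ F ∈ facets K, M.faceInt F (fun x => q x * inner ℝ (∇ r x) (outerNormal K F)) := by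
  have hrs : ContDiff ℝ ∞ r := contDiff_of_mem_polyFun hr
  have h := (M.isSimplex hK).setIntegral_green (NeZero.pos d) (contDiff_gradient hrs)
    (contDiff_of_mem_polyFun hq (n := 1))
  rw [← laplacian_eq_divg hrs, ← M.cellInt_eq hreg hK] at h
  simp only [← inner_gradient] at h
  rw [Finset.sum_congr rfl fun F hF => M.faceInt_eq (facet_mem_faces hK hF) _, ← h, gradForm,
    cellInt, cellInt, cellInt, integral_add]
  · ring
  · exact integrable_inner_of_memLp (memLp_gradient_cell hq) (memLp_gradient_cell hr)
  · exact integrable_mul (memLp_poly_cell K hq) (memLp_laplacian hr K)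

/-- An element of the kernel of the form of the method is piecewise constant, with the same
constant on the facets of a cell. -/
theorem exists_const_of_bForm_eq_zero (M : SimplicialMesh Ω) (hreg : interior (closure Ω) = Ω)
    {wt : Finset (E d) → ℝ} (hwt : ∀ F ∈ M.faces, 0 < wt F) {s : M.space p}
    (h : M.bForm p wt s s = 0) (hK : K ∈ M.cells) :
    ∃ c : ℝ, s.1.1 =ᵐ[(vol Ω).restrict (hull K)] (fun _ => c) ∧
      ∀ F ∈ facets K, s.1.2 =ᵐ[M.surf.restrict (hull F)] fun _ => c := by
  have hdf := M.isDefectFree_of_stab_eq_zero hreg hwt (stab_eq_zero_of_bForm hwt h)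
  have hconst : ∀ K ∈ M.cells, ∃ a : ℝ, M.recPoly s K = fun _ => a := fun K hK =>
    M.eq_const_of_gradForm_eq_zero hreg hK (M.recPoly_mem hreg hK s)
      (gradForm_eq_zero_of_bForm hwt h hK)
  -- A piecewise constant reconstruction is fixed by the cell projection, so S s reduces to the cell
  -- component.
  have hR : M.recon p s ∈ M.brokenPoly p := by
    intro K hK
    obtain ⟨a, ha⟩ := hconst K hK
    exact ⟨fun _ => a, const_mem_polyFun (by positivity) a,
      ha ▸ ae_eq_cellPoly hreg hK (M.recon_mem hreg s)⟩
  have hS : M.stabOp p s = s.1.1 := by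
    rw [stabOp, M.projCells_eq_self hreg hR, sub_self, add_zero]
  set q := cellPoly s.1.1 K with hqdef
  have hq : q ∈ polyFun d p := cellPoly_mem hreg hK s.2.1
  have hsq : s.1.1 =ᵐ[(vol Ω).restrict (hull K)] q := ae_eq_cellPoly hreg hK s.2.1
  have hmom : ∀ F ∈ facets K, ∀ r ∈ polyFun d p,
      M.faceInt F (fun x => r x * s.1.2 x) = M.faceInt F (fun x => r x * q x) := by
    intro F hF r hr
    have h1 := hdf K hK F hF r hr
    simp only [defect, hS] at h1
    rw [← hqdef, faceInt, integral_mul_sub (memLp_poly_face F hr) (memLp_restrict s.1.2 _)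
      (memLp_poly_face F hq)] at h1
    exact sub_eq_zero.1 h1
  have hq1 : q ∈ polyFun d (p + 1) := polyFun_mono (by lia) hq
  obtain ⟨a, ha⟩ := hconst K hK
  -- Test the reconstruction identity with the cell component q itself. The left side is zero as R s
  -- is constant. On the right the face component may be replaced by q, since their moments agree,
  -- and Green's formula turns the result into the energy of q.
  have h0 : gradForm Ω K q q = 0 := by
    have h1 := (M.isLocalRecon_recPoly hreg hK s).grad_eq q hq1
    rw [ha, gradForm_comm, gradForm_const_right] at h1
    rw [h1, M.gradForm_eq_green hreg hK hq hq, reconRhs]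
    congr 1
    · exact congrArg Neg.neg <| integral_congr_ae (by filter_upwards [hsq] with x hx using by rw [hx])
    · refine Finset.sum_congr rfl fun F hF => ?_
      have h5 : (fun x => inner ℝ (∇ q x) (outerNormal K F)) ∈ polyFun d p := by
        simp only [inner_gradient]
        exact polyFun_mono (by lia) (fderiv_mem_polyFun hq _)
      simpa only [mul_comm (inner ℝ _ _)] using (hmom F hF _ h5).symm
  obtain ⟨c, hc⟩ := M.eq_const_of_gradForm_eq_zero hreg hK hq h0
  refine ⟨c, hc ▸ hsq, fun F hF => ?_⟩
  obtain ⟨r, hr, h1⟩ := s.2.2.1 F (facet_mem_faces hK hF)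
  refine h1.trans ?_
  rw [← hc]
  refine ae_eq_of_moments (P := polyFun d p) (fun _ hq => memLp_poly_face F hq) hr hq
    fun t ht => ?_
  refine Eq.trans (integral_congr_ae ?_) (hmom F hF t ht)
  filter_upwards [h1] with x hx
  rw [hx]

theorem exists_inner_eq (M : SimplicialMesh Ω) (hK : K ∈ M.cells) (hF : F ∈ facets K) :
    ∃ a : ℝ, ∀ x ∈ hull F, inner ℝ x (outerNormal K F) = a := by
  classical
  obtain ⟨a, ha, rfl⟩ := (mem_facets_iff (M.card_eq K hK)).1 hF
  obtain ⟨h, -, -, -, hh⟩ := (M.isSimplex hK).exists_height (NeZero.pos d) ha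
  refine ⟨h + inner ℝ a (outerNormal K (K.erase a)), fun x hx => ?_⟩
  have := hh x hx
  rw [inner_sub_right] at this
  rw [real_inner_comm, real_inner_comm _ a]
  linarith

/-- Green's formula on a cell for the position field and a function whose trace has the mean of
a constant on each facet. -/
theorem cellInt_position (M : SimplicialMesh Ω) (hreg : interior (closure Ω) = Ω)
    (hK : K ∈ M.cells) {v : H10 Ω} {c : ℝ}
    (hv : ∀ F ∈ facets K, M.faceInt F (fun x => M.trace v x) = M.faceInt F (fun _ => c)) :
    cellInt Ω K (fun x => inner ℝ (grad v x) x) + cellInt Ω K (fun x => fn v x * d) =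
      c * (d * ((vol Ω).restrict (hull K)).real univ) := by
  have h1 := M.green hreg hK (X := fun y : E d => y) contDiff_fun_id (M.trace_mem hreg v)
  have h2 := (M.isSimplex hK).setIntegral_green (NeZero.pos d) (X := fun y : E d => y)
    contDiff_fun_id (contDiff_const (c := c))
  rw [← M.cellInt_eq hreg hK] at h2
  simp only [divg_id] at h1 h2
  rw [fderiv_fun_const] at h2
  simp only [Pi.zero_apply, _root_.zero_apply, zero_add] at h2
  rw [cellInt_const] at h2
  -- On a facet x · n is constant, so only the mean of the trace enters. It may be replaced by the
  -- constant c, for which Green's formula gives c d |K|.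
  have h3 : ∀ F ∈ facets K, M.faceInt F (fun x => M.trace v x * inner ℝ x (outerNormal K F)) =
      ∫ x in hull F, c * inner ℝ x (outerNormal K F) ∂μHE[d - 1] := by
    intro F hF
    obtain ⟨a, ha⟩ := M.exists_inner_eq hK hF
    rw [← M.faceInt_eq (facet_mem_faces hK hF)]
    have h4 : ∀ f : E d → ℝ, M.faceInt F (fun x => f x * inner ℝ x (outerNormal K F)) =
        M.faceInt F f * a := by
      intro f
      rw [faceInt, faceInt, ← integral_mul_const]
      exact setIntegral_congr_fun (measurableSet_hull F) fun x hx => by simp only [ha x hx]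
    rw [h4, h4 (fun _ => c), hv F hF]
  rw [Finset.sum_congr rfl h3, ← h2] at h1
  rw [show c * (d * ((vol Ω).restrict (hull K)).real univ) =
    ((vol Ω).restrict (hull K)).real univ * (c * d) by ring]
  exact h1

/-- If there is a moment-preserving smoother, then the form of the method is definite. -/
theorem eq_zero_of_bForm_eq_zero (M : SimplicialMesh Ω) (hreg : interior (closure Ω) = Ω)
    {wt : Finset (E d) → ℝ} (hwt : ∀ F ∈ M.faces, 0 < wt F) {Es : M.space p →ₗ[ℝ] H10 Ω}
    (hE : ∀ σ, M.PreservesMoments p Es σ) {s : M.space p} (h : M.bForm p wt s s = 0) : s = 0 := by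
  have hΩ := isOpen_of_regular hreg
  have hex : ∀ K, ∃ c : ℝ, K ∈ M.cells → s.1.1 =ᵐ[(vol Ω).restrict (hull K)] (fun _ => c) ∧
      ∀ F ∈ facets K, s.1.2 =ᵐ[M.surf.restrict (hull F)] fun _ => c := by
    intro K
    by_cases hK : K ∈ M.cells
    · obtain ⟨c, hc⟩ := M.exists_const_of_bForm_eq_zero hreg hwt h hK
      exact ⟨c, fun _ => hc⟩
    · exact ⟨0, fun h => absurd h hK⟩
  choose c hc using hex
  have hexF : ∀ F, ∃ K, F ∈ M.interfaces → K ∈ M.cells ∧ F ∈ facets K := by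
    intro F
    by_cases hF : F ∈ M.interfaces
    · obtain ⟨K, hK, hFK⟩ := mem_faces_of_mem_interfaces hF
      exact ⟨K, fun _ => ⟨hK, hFK⟩⟩
    · exact ⟨∅, fun h => absurd h hF⟩
  choose κ hκ using hexF
  -- Squaring the constants makes the final sum over cells one of nonnegative terms, which replaces
  -- any connectivity argument.
  obtain ⟨f', hf', hf⟩ := M.exists_brokenPoly (k := p) (q := fun K _ => c K ^ 2)
    fun K _ => const_mem_polyFun (by positivity) _
  obtain ⟨g', hg', hg⟩ := M.exists_skelPoly (k := p) (q := fun F _ => c (κ F) ^ 2)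
    fun F _ => const_mem_polyFun (by positivity) _
  -- The squares are single-valued on faces: the constants of all adjacent cells equal the face
  -- component of s there, which is zero on boundary faces.
  have hgK : ∀ K ∈ M.cells, ∀ F ∈ facets K,
      g' =ᵐ[M.surf.restrict (hull F)] fun _ => c K ^ 2 := by
    intro K hK F hF
    by_cases hi : F ∈ M.interfaces
    · filter_upwards [hg F hi, (hc K hK).2 F hF, (hc _ (hκ F hi).1).2 F (hκ F hi).2]
        with x h1 h2 h3
      rw [h1, ← h3, h2]
    · have hb : F ∈ M.boundaryFaces := ⟨⟨K, hK, hF⟩, hi⟩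
      filter_upwards [hg'.2 F hb, (hc K hK).2 F hF, s.2.2.2 F hb] with x h1 h2 h3
      rw [h1, ← h2, h3]
      simp
  set s' : M.space p := ⟨(f', g'), hf', hg'⟩
  set v := Es s'
  have hcell : ∀ K ∈ M.cells,
      cellInt Ω K (fun x => inner ℝ (grad v x) x) + cellInt Ω K (fun x => fn v x * d) =
      c K ^ 2 * (d * ((vol Ω).restrict (hull K)).real univ) := by
    intro K hK
    refine M.cellInt_position hreg hK fun F hF => ?_
    have h1 := M.moments_facets hreg hK (hE s').2 hF (const_mem_polyFun (by positivity) 1)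
    simp only [one_mul] at h1
    exact h1.trans (integral_congr_ae (hgK K hK F hF))
  -- Integration by parts on Ω with the position field has no boundary term, so the sum over cells
  -- of d c_K² |K| is zero.
  have hglob := M.global_green hΩ (X := fun y : E d => y) contDiff_fun_id (M.trace_mem hreg v)
  simp only [divg_id] at hglob
  have hid : MemLp (fun y : E d => y) 2 (vol Ω) := M.memLp_vol hΩ continuous_id
  rw [M.integral_vol_eq_sum hΩ (integrable_inner_of_memLp (Lp.memLp _) hid),
    M.integral_vol_eq_sum hΩ (integrable_mul (Lp.memLp _) (memLp_const _)),
    ← Finset.sum_add_distrib] at hglob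
  replace hglob := (Finset.sum_congr rfl hcell).symm.trans hglob
  have hdpos : (0 : ℝ) < d := Nat.cast_pos.2 (NeZero.pos d)
  have hc0 : ∀ K ∈ M.cells, c K = 0 := by
    intro K hK
    have h1 := (Finset.sum_eq_zero_iff_of_nonneg fun K hK => mul_nonneg (sq_nonneg (c K))
      (mul_nonneg hdpos.le (M.measureReal_cell_pos hreg hK).le)).1 hglob K hK
    exact pow_eq_zero_iff two_ne_zero |>.1
      ((mul_eq_zero.1 h1).resolve_right (mul_pos hdpos (M.measureReal_cell_pos hreg hK)).ne')
  refine Subtype.ext (Prod.ext (M.L2_ext hreg fun K hK => ?_) (L2skel_ext fun F hF => ?_))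
  · have h1 := (hc K hK).1
    rw [hc0 K hK] at h1
    exact h1.trans (Filter.EventuallyEq.symm (ae_restrict_of_ae (Lp.coeFn_zero ℝ 2 (vol Ω))))
  · obtain ⟨K, hK, hFK⟩ := hF
    have h1 := (hc K hK).2 F hFK
    rw [hc0 K hK] at h1
    exact h1.trans (Filter.EventuallyEq.symm (ae_restrict_of_ae (Lp.coeFn_zero ℝ 2 M.surf)))

/-- A definite symmetric form on a finite-dimensional space represents every functional exactly
once. -/
theorem existsUnique_solution (M : SimplicialMesh Ω) (hreg : interior (closure Ω) = Ω)
    {wt : Finset (E d) → ℝ} (hwt : ∀ F ∈ M.faces, 0 < wt F) {Es : M.space p →ₗ[ℝ] H10 Ω}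
    (hE : ∀ σ, M.PreservesMoments p Es σ) (f : StrongDual ℝ (H10 Ω)) :
    ∃! U : M.space p, M.SolvesMethod p wt Es f U := by
  have := M.finite_space hreg p
  obtain ⟨U, hU⟩ := exists_repr (M.bLin hreg p wt) (fun s σ => bForm_comm s σ)
    (f.toLinearMap ∘ₗ Es) fun s hs => by
      rw [M.eq_zero_of_bForm_eq_zero hreg hwt hE hs, map_zero]
  refine ⟨U, hU, fun V hV => sub_eq_zero.1 (M.eq_zero_of_bForm_eq_zero hreg hwt hE ?_)⟩
  have h1 : M.bLin hreg p wt (V - U) = 0 := by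
    rw [map_sub, sub_eq_zero]
    exact LinearMap.ext fun σ => (hV σ).trans (hU σ).symm
  exact LinearMap.congr_fun h1 (V - U)

end SimplicialMesh
end HHO

namespace HHO

variable {d : ℕ}

theorem integral_inner_sub_self {X V : Type*} [MeasurableSpace X] {ν : Measure X}
    [NormedAddCommGroup V] [InnerProductSpace ℝ V] {f g : X → V} (hf : MemLp f 2 ν)
    (hg : MemLp g 2 ν) : ∫ x, inner ℝ (f x - g x) (f x - g x) ∂ν =
      ∫ x, inner ℝ (f x) (f x) ∂ν - 2 * ∫ x, inner ℝ (f x) (g x) ∂ν +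
        ∫ x, inner ℝ (g x) (g x) ∂ν := by
  have h1 := integrable_inner_of_memLp hf hf
  have h2 := (integrable_inner_of_memLp hf hg).const_mul 2
  have h3 : Integrable (fun x => inner ℝ (f x) (f x) - 2 * inner ℝ (f x) (g x)) ν := h1.sub h2
  rw [← integral_const_mul, ← integral_sub h1 h2,
    ← integral_add h3 (integrable_inner_of_memLp hg hg)]
  congr 1 with x
  rw [real_inner_sub_sub_self]

namespace SimplicialMesh

variable {Ω : Set (E d)} {M : SimplicialMesh Ω} [NeZero d] [IsFiniteMeasure (vol Ω)] {p : ℕ}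
  {K F : Finset (E d)} {wt : Finset (E d) → ℝ}

/-! ### Functions at distance zero from the discrete space -/

/-- `ŝ` is at distance zero from `u` in the extended energy semi-norm. -/
structure IsCloseTo (M : SimplicialMesh Ω) (u : H10 Ω) (s : M.space p) : Prop where
  grad_ae_eq : ∀ K ∈ M.cells, grad u =ᵐ[(vol Ω).restrict (hull K)] ∇ (M.recPoly s K)
  isDefectFree : M.IsDefectFree s

/-- The functional `σ̂ ↦ ∫_Ω ∇u · ∇_M R σ̂`. -/
def gradFunctional (M : SimplicialMesh Ω) (hreg : interior (closure Ω) = Ω) (p : ℕ) (u : H10 Ω) :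
    M.space p →ₗ[ℝ] ℝ where
  toFun σ := ∑ K ∈ M.cells, cellInt Ω K (fun x => inner ℝ (grad u x) (∇ (M.recPoly σ K) x))
  map_add' σ τ := by
    rw [← Finset.sum_add_distrib]
    refine Finset.sum_congr rfl fun K hK => ?_
    simp only [cellInt]
    rw [← integral_add
      (integrable_inner_of_memLp (memLp_grad u K) (M.memLp_gradient_recPoly hreg hK σ))
      (integrable_inner_of_memLp (memLp_grad u K) (M.memLp_gradient_recPoly hreg hK τ))]
    simp only [M.gradient_recPoly_add hreg hK, Pi.add_apply, inner_add_right]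
  map_smul' c σ := by
    rw [RingHom.id_apply, smul_eq_mul, Finset.mul_sum]
    refine Finset.sum_congr rfl fun K hK => ?_
    simp only [cellInt]
    rw [← integral_const_mul, M.recPoly_smul hreg hK, gradient_smul c
      ((contDiff_of_mem_polyFun (M.recPoly_mem hreg hK σ) (n := 1)).differentiable (by simp))]
    simp only [Pi.smul_apply, real_inner_smul_right]

theorem stab_neg_neg (M : SimplicialMesh Ω) (hreg : interior (closure Ω) = Ω) (s : M.space p) :
    M.stab p wt (-s) (-s) = M.stab p wt s s := by
  rw [← neg_one_smul ℝ s, M.stab_smul_right hreg, stab_comm, M.stab_smul_right hreg]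
  ring

theorem aExt_hat_sub_self (M : SimplicialMesh Ω) (hreg : interior (closure Ω) = Ω) (u : H10 Ω)
    (s : M.space p) : M.aExt p wt (M.hat u - s) (M.hat u - s) =
      ∑ K ∈ M.cells, cellInt Ω K (fun x => inner ℝ (grad u x - ∇ (M.recPoly s K) x)
        (grad u x - ∇ (M.recPoly s K) x)) + M.stab p wt s s := by
  have h1 : M.hat u - (s : M.Pairs) = M.hat u + (-s : M.space p) := by
    rw [Submodule.coe_neg, sub_eq_add_neg]
  rw [h1, M.aExt_eq hreg, pairForm_eq, M.stab_neg_neg hreg]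
  congr 1
  refine Finset.sum_congr rfl fun K hK => ?_
  simp only [M.gradient_recPoly_neg hreg hK, Pi.neg_apply, ← sub_eq_add_neg]

theorem aExt_hat_sub_self_expand (M : SimplicialMesh Ω) (hreg : interior (closure Ω) = Ω)
    (u : H10 Ω) (s : M.space p) : M.aExt p wt (M.hat u - s) (M.hat u - s) =
      ∑ K ∈ M.cells, cellInt Ω K (fun x => inner ℝ (grad u x) (grad u x)) -
        2 * M.gradFunctional hreg p u s + M.bForm p wt s s := by
  rw [M.aExt_hat_sub_self hreg, bForm_eq, ← add_assoc]
  congr 1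
  rw [gradFunctional, LinearMap.coe_mk, AddHom.coe_mk, Finset.mul_sum, ← Finset.sum_sub_distrib,
    ← Finset.sum_add_distrib]
  exact Finset.sum_congr rfl fun K hK =>
    integral_inner_sub_self (memLp_grad u K) (M.memLp_gradient_recPoly hreg hK s)

/-- The distance from the discrete space is attained. -/
theorem exists_isCloseTo (M : SimplicialMesh Ω) (hreg : interior (closure Ω) = Ω)
    (hwt : ∀ F ∈ M.faces, 0 < wt F) {u : H10 Ω} (hu : M.hat u ∈ M.zeroDist p wt) :
    ∃ s : M.space p, M.IsCloseTo u s := by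
  have := M.finite_space hreg p
  -- The best approximation solves the normal equations b_H(s, σ) = ∫ ∇u · ∇Rσ. These are solvable
  -- even if the form is only semidefinite, since the right side vanishes where the form does. No
  -- smoother enters here.
  obtain ⟨s, hs⟩ := exists_repr (M.bLin hreg p wt) (fun s σ => bForm_comm s σ)
    (M.gradFunctional hreg p u) fun σ hσ => Finset.sum_eq_zero fun K hK => by
      have h1 := gradient_ae_eq_zero (M.recPoly_mem hreg hK σ) (gradForm_eq_zero_of_bForm hwt hσ hK)
      refine integral_eq_zero_of_ae ?_
      filter_upwards [h1] with x hx
      rw [hx]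
      simp
  -- By the normal equations the squared distances for t and s differ by b_H(s − t, s − t), which is
  -- nonnegative.
  have hmin : ∀ t : M.space p, M.extNorm p wt (M.hat u - s) ≤ M.extNorm p wt (M.hat u - t) := by
    intro t
    refine Real.sqrt_le_sqrt ?_
    have h1 := bForm_self_nonneg hwt (s - t)
    rw [M.aExt_hat_sub_self_expand hreg, M.aExt_hat_sub_self_expand hreg, ← hs s, ← hs t]
    rw [← bLin_apply hreg] at h1
    simp only [map_sub, LinearMap.sub_apply, bLin_apply] at h1 ⊢
    rw [bForm_comm t s] at h1
    linarith
  have h0 : M.extNorm p wt (M.hat u - s) ≤ 0 := hu.2 ▸ le_ciInf hmin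
  have h1 := Real.sqrt_eq_zero'.1 (le_antisymm h0 (Real.sqrt_nonneg _))
  rw [M.aExt_hat_sub_self hreg] at h1
  have h2 : ∀ K ∈ M.cells, 0 ≤ cellInt Ω K (fun x =>
      inner ℝ (grad u x - ∇ (M.recPoly s K) x) (grad u x - ∇ (M.recPoly s K) x)) :=
    fun _ _ => integral_nonneg fun _ => real_inner_self_nonneg
  have h3 := Finset.sum_nonneg h2
  have h4 := stab_self_nonneg hwt s
  refine ⟨s, fun K hK => ?_, M.isDefectFree_of_stab_eq_zero hreg hwt (by linarith)⟩
  have h5 := (Finset.sum_eq_zero_iff_of_nonneg h2).1 (by linarith) K hK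
  have h6 := (memLp_grad u K).sub (M.memLp_gradient_recPoly hreg hK s)
  filter_upwards [(integral_eq_zero_iff_of_nonneg (fun x => real_inner_self_nonneg)
    (integrable_inner_of_memLp h6 h6)).1 h5] with x hx
  exact sub_eq_zero.1 (inner_self_eq_zero.1 hx)

theorem IsCloseTo.extNorm_eq_zero (hreg : interior (closure Ω) = Ω) {u : H10 Ω} {s : M.space p}
    (h : M.IsCloseTo u s) : M.extNorm p wt (M.hat u - s) = 0 := by
  rw [extNorm, M.aExt_hat_sub_self hreg, h.isDefectFree.stab_eq_zero hreg, add_zero,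
    Finset.sum_eq_zero fun K hK => ?_, Real.sqrt_zero]
  refine integral_eq_zero_of_ae ?_
  filter_upwards [h.grad_ae_eq K hK] with x hx
  rw [hx, sub_self, inner_self_eq_zero.2 rfl, Pi.zero_apply]

/-- Elements at distance zero are indistinguishable to the form: their gradients agree on each cell
and the stabilization does not see a defect-free s. -/
theorem IsCloseTo.aExt_eq (hreg : interior (closure Ω) = Ω) {u : H10 Ω} {s : M.space p}
    (h : M.IsCloseTo u s) (w : H10 Ω) (σ : M.space p) :
    M.aExt p wt (M.hat u) (M.hat w + σ) = M.aExt p wt s (M.hat w + σ) := by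
  have h1 : M.hat u = M.hat u + (0 : M.space p) := by rw [Submodule.coe_zero, add_zero]
  have h2 : (s : M.Pairs) = M.hat 0 + s := by rw [M.hat_zero hreg, zero_add]
  rw [h1, h2, M.aExt_eq hreg, M.aExt_eq hreg, pairForm_eq, pairForm_eq, stab_comm s,
    h.isDefectFree.stab_eq_zero hreg, stab_comm, ← zero_smul ℝ (0 : M.space p),
    M.stab_smul_right hreg, zero_mul]
  congr 1
  refine Finset.sum_congr rfl fun K hK => integral_congr_ae ?_
  filter_upwards [h.grad_ae_eq K hK, grad_zero_ae K] with x h3 h4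
  rw [h3, h4, M.recPoly_smul hreg hK, zero_smul, Pi.zero_apply, zero_add,
    show (0 : E d → ℝ) = fun _ => 0 from rfl, gradient_fun_const, Pi.zero_apply, add_zero]

theorem aForm_eq_sum (hreg : interior (closure Ω) = Ω) (u w : H10 Ω) :
    aForm u w = ∑ K ∈ M.cells, cellInt Ω K (fun x => inner ℝ (grad u x) (grad w x)) :=
  M.integral_vol_eq_sum (isOpen_of_regular hreg)
    (integrable_inner_of_memLp (Lp.memLp _) (Lp.memLp _))

/-- Without a defect, b_H(s, σ) is the gradient part only. Moment preservation turns ∇Rσ into the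
gradient of the smoothed σ, closeness turns ∇R s into ∇u, and the result is the weak Poisson
equation tested with the smoothed σ. -/
theorem IsCloseTo.solvesMethod (hreg : interior (closure Ω) = Ω) {Es : M.space p →ₗ[ℝ] H10 Ω}
    (hE : ∀ σ, M.PreservesMoments p Es σ) {f : StrongDual ℝ (H10 Ω)} {u : H10 Ω}
    (hu : ∀ w, aForm u w = f w) {s : M.space p} (h : M.IsCloseTo u s) :
    M.SolvesMethod p wt Es f s := by
  intro σ
  rw [← hu, aForm_eq_sum (M := M) hreg, bForm_eq, stab_comm, h.isDefectFree.stab_eq_zero hreg,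
    add_zero]
  refine Finset.sum_congr rfl fun K hK => ?_
  rw [gradForm_comm, M.gradForm_recPoly_eq hreg hK (hE σ)]
  refine integral_congr_ae ?_
  filter_upwards [h.grad_ae_eq K hK] with x hx
  rw [hx, real_inner_comm]

/-- The interpolant of a function at distance zero from the discrete space is close to it. -/
theorem IsCloseTo.interp (hreg : interior (closure Ω) = Ω) {u : H10 Ω} {s : M.space p}
    (h : M.IsCloseTo u s) :
    M.IsCloseTo u (⟨M.interp p u, M.projCells_mem p _, (M.projSkel_spec p _).1⟩ : M.space p) := by
  -- Equal gradients mean that u differs from R s by a constant on each cell. So u itself is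
  -- piecewise polynomial of degree p + 1, and the interpolant has its moments by construction.
  have hex : ∀ K, ∃ c : ℝ, K ∈ M.cells →
      fn u =ᵐ[(vol Ω).restrict (hull K)] fun x => M.recPoly s K x + c := by
    intro K
    by_cases hK : K ∈ M.cells
    · obtain ⟨c, hc⟩ := exists_ae_eq_add_const hreg hK
        (contDiff_of_mem_polyFun (M.recPoly_mem hreg hK s)) (M.trace_mem hreg u)
        (h.grad_ae_eq K hK)
      exact ⟨c, fun _ => hc⟩
    · exact ⟨0, fun h => absurd h hK⟩
  choose c hc using hex
  obtain ⟨h1, h2⟩ := M.recPoly_of_moments hreg (u := u)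
    (s := ⟨M.interp p u, M.projCells_mem p _, (M.projSkel_spec p _).1⟩)
    (Q := fun K x => M.recPoly s K x + c K)
    (fun K hK => Submodule.add_mem _ (M.recPoly_mem hreg hK s)
      (const_mem_polyFun (by positivity) (c K))) hc
    (fun K hK q hq => ((M.projCells_spec p (fn u)).2 K hK q hq).symm)
    (fun F hF r hr => ((M.projSkel_spec p (M.trace u)).2 F hF r hr).symm)
  exact ⟨h1, h2⟩

end SimplicialMesh
end HHO

end

/-! ### Assembly of the consistency lemma -/

theorem mainTheorem7 {d : ℕ} (hd : d = 2 ∨ d = 3) {Ω : Set (HHO.E d)} (hΩ : IsOpen Ω)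
    (hreg : interior (closure Ω) = Ω) (M : HHO.SimplicialMesh Ω) (p : ℕ)
    (wt : Finset (HHO.E d) → ℝ) (hwt : ∀ F ∈ M.faces, 0 < wt F)
    (Es : M.space p →ₗ[ℝ] HHO.H10 Ω) :
    -- the extended form is well defined on the sum of the two spaces
    (∀ (v w : HHO.H10 Ω) (s σ : M.space p),
      M.aExt p wt (M.hat v + s) (M.hat w + σ) = M.pairForm p wt v s w σ) ∧
    -- the key identity, for every `σ` whose moments are preserved
    (∀ σ : M.space p, M.PreservesMoments p Es σ →
      ∀ s : M.space p, M.aExt p wt s (σ - M.hat (Es σ)) = M.stab p wt s σ) ∧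
    -- consistency
    ((∀ σ : M.space p, M.PreservesMoments p Es σ) →
      ∀ f : StrongDual ℝ (HHO.H10 Ω),
        (∃! U : M.space p, M.SolvesMethod p wt Es f U) ∧
        ∀ (u : HHO.H10 Ω) (U : M.space p),
          (∀ w : HHO.H10 Ω, HHO.aForm u w = f w) → M.SolvesMethod p wt Es f U →
          M.hat u ∈ M.zeroDist p wt →
            M.extNorm p wt (M.hat u - U) = 0 ∧
            (U : M.Pairs) = M.interp p u ∧
            ∀ σ : M.space p, M.aExt p wt (M.hat u) (σ - M.hat (Es σ)) = 0) := by
  have := M.isFiniteMeasure_vol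
  have : NeZero d := ⟨by rcases hd with rfl | rfl <;> decide⟩
  refine ⟨fun v w s σ => M.aExt_eq hreg v w s σ, fun σ hσ s => M.aExt_sub_smoother hreg hσ s,
    fun hE f => ?_⟩
  have hex := M.existsUnique_solution hreg hwt hE f
  refine ⟨hex, fun u U hu hU hZ => ?_⟩
  obtain ⟨s, hs⟩ := M.exists_isCloseTo hreg hwt hZ
  -- The element at distance zero from u solves the method, so it is the discrete solution.
  obtain rfl := hex.unique hU (hs.solvesMethod hreg hE hu)
  refine ⟨hs.extNorm_eq_zero hreg, ?_, fun σ => ?_⟩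
  -- The interpolant is at distance zero as well, so it solves the same uniquely solvable problem.
  · exact congrArg Subtype.val (hex.unique hU ((hs.interp hreg).solvesMethod hreg hE hu))
  -- The key identity for U has vanishing right side because U has no defect, and U may then be
  -- exchanged for û in the form.
  · have h := M.aExt_sub_smoother (wt := wt) hreg (hE σ) U
    rw [HHO.SimplicialMesh.stab_comm, hs.isDefectFree.stab_eq_zero hreg] at h
    rw [← h, sub_eq_neg_add, ← M.hat_neg hreg]
    exact hs.aExt_eq hreg _ σ
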